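/- **Theorem (Shifted-and-Inverted Power Method with SVRG).** Let $A\in\mathbb R^{n\times d}$, $d\ge 2$, have rows $a_1,\dots,a_n$, let $\Sigma=A^\top A$ have eigenvalues $\lambda_1\ge\lambda_2\ge\dots\ge\lambda_d$, and assume $\mathrm{gap}:=(\lambda_1-\lambda_2)/\lambda_1>0$. Let $\mathrm{nnz}(A)$ be the number of non-zero entries of $A$ and $\mathrm{srank}(A)=\sum_i\lambda_i/\lambda_1=\|A\|_F^2/\|A\|_2^2$. Let $0<\epsilon\le 1$, let $$\Big(1+\tfrac{\mathrm{gap}}{150}\Big)\lambda_1\le\lambda\le\Big(1+\tfrac{\mathrm{gap}}{100}\Big)\lambda_1,$$ and let $\hat\lambda_1$ be an estimate of $\lambda_1$ with $\tfrac{10}{11}(\lambda-\lambda_1)\le\lambda-\hat\lambda_1\le\lambda-\lambda_1$ (for example $\hat\lambda_1=\lambda_1$). Put $B=\lambda I-\Sigma$. *SVRG solver.* Put $\mu=\lambda-\hat\lambda_1$, $\bar S=2\hat\lambda_1\|A\|_F^2/\mu$, $\eta=1/(8\bar S)$, $M=\lceil 64\bar S/\mu\rceil$, $p_i=\|a_i\|_2^2/\|A\|_F^2$,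 and, for a right-hand side $b$, $f(w)=\frac12w^\top Bw-b^\top w=\sum_i\psi_i(w)$ with $\psi_i(w)=\frac12w^\top(\lambda p_iI-a_ia_i^\top)w-\frac1n b^\top w$. An *epoch* from $w_0$ draws $m$ uniformly from $\{1,\dots,M\}$ and returns $w_m$, where $w_{k+1}=w_k-\frac{\eta}{p_i}\big(\nabla\psi_i(w_k)-\nabla\psi_i(w_0)\big)-\eta\nabla f(w_0)$ with a fresh index $i$ drawn with probability $p_i$ in each step. For a unit vector $x$ let $\mathrm{solve}_K(x)$ be the result of $K$ consecutive epochs for $Bw=x$, the first one starting from $x/(x^\top Bx)$. *Algorithm.* Draw $x_0\sim\mathcal N(0,I_d)$ and set $x=x_0/\|x_0\|_2$. Repeat $T_1$ times: $x\leftarrow y/\|y\|_2$ where $y=\mathrm{solve}_{K_1}(x)$. Then repeat $T_2$ times: let $y=\mathrm{solve}_{K_2}(x)$; if $\frac{y^\top\Sigma y}{y^\top y}\ge\hat\lambda_1-\frac{\lambda-\hat\lambda_1}{6}$ and $\|y\|_2\ge\frac23\cdot\frac1{\lambda-\hat\lambda_1}$ set $x\leftarrow y/\|y\|_2$, otherwise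 keep $x$. Return $x$. There is a universal constant $c_0>0$ such that for every $c_1\ge c_0$ there is a constant $C>0$, depending only on $c_1$, such that for all $n,d,A,\lambda,\hat\lambda_1,\epsilon$ as above and all natural numbers $T_1,K_1\in\big[c_0\log\frac d{\mathrm{gap}},\,c_1\log\frac d{\mathrm{gap}}\big]$, $T_2\in\big[c_0\log\frac d\epsilon,\,c_1\log\frac d\epsilon\big]$, $K_2\in[c_0,c_1]$: 1. with probability at least $1-C/d^{10}$ the returned vector $x$ is a unit vector with $x^\top A^\top Ax\ge(1-\epsilon)\lambda_1$; 2. on every run, the total number of steps is at most $$C\Big(\mathrm{nnz}(A)+\frac{d\cdot\mathrm{srank}(A)}{\mathrm{gap}^2}\Big)\Big(\log^2\frac d{\mathrm{gap}}+\log\frac1\epsilon\Big).$$ Here $A$ is given by its non-zero rows as lists of non-zero entries, and one step is one operation on real numbers (loading a rational constant, $+,-,\times,/$, square root, comparison, rounding up to a natural number), one Gaussian number, one uniform draw from $\{1,\dots,M\}$, or one draw of a row index from a table of row probabilities; setting up that table for $r$ rows costs $r$ steps. -/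

import Mathlib

open MeasureTheory ProbabilityTheory Matrix

/-! ## Spectral quantities of a data matrix -/

/-- The `(k+1)`-st largest eigenvalue of `Aᵀ A` (with multiplicity; `k` counts from `0`),
and `0` when `k ≥ d`. -/
noncomputable def eigval {n d : ℕ} (A : Matrix (Fin n) (Fin d) ℝ) (k : ℕ) : ℝ :=
  if h : k < d then
    (isHermitian_conjTranspose_mul_self A).eigenvalues₀
      (Fin.cast (Fintype.card_fin d).symm ⟨k, h⟩)
  else 0

/-- The relative eigenvalue gap `(λ₁ - λ₂) / λ₁` of `Aᵀ A`. -/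
noncomputable def eigengap {n d : ℕ} (A : Matrix (Fin n) (Fin d) ℝ) : ℝ :=
  (eigval A 0 - eigval A 1) / eigval A 0

/-- The stable rank `∑ᵢ λᵢ / λ₁ = ‖A‖_F² / ‖A‖₂²`. -/
noncomputable def stableRank {n d : ℕ} (A : Matrix (Fin n) (Fin d) ℝ) : ℝ :=
  ∑ k : Fin d, eigval A k / eigval A 0

/-- The number of non-zero entries. -/
noncomputable def numNonzero {n d : ℕ} (A : Matrix (Fin n) (Fin d) ℝ) : ℕ :=
  {e : Fin n × Fin d | A e.1 e.2 ≠ 0}.ncard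

/-! ## The machine model: randomized real arithmetic with branching

A program is a tree of instructions. The type `R` of machine reals is a parameter, and all
algorithms below are written uniformly in `R`; hence they can only touch machine reals through
instructions, each of which is charged by `RealProg.run`. Loads, stores and loop counters are not
charged separately: every loop below executes at least one charged instruction per pass. -/

inductive ArithOp
  | plus | minus | times | divide

/-- A table prepared for drawing indices with given weights. -/
structure DrawTable (R : Type) (r : ℕ) where
  weight : Fin r → R

inductive RealProg (R : Type) (α : Type) : Type
  /-- stop and return a value -/
  | ret (a : α)
  /-- load a rational constant -/
  | lit (q : ℚ) (k : R → RealProg R α)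
  /-- a binary arithmetic operation -/
  | arith (o : ArithOp) (x y : R) (k : R → RealProg R α)
  /-- square root -/
  | sqrt (x : R) (k : R → RealProg R α)
  /-- the comparison `x ≤ y` -/
  | leq (x y : R) (k : Bool → RealProg R α)
  /-- the least natural number that is at least `x` -/
  | ceil (x : R) (k : ℕ → RealProg R α)
  /-- a uniformly random element of `{1, …, m}` -/
  | unif (m : ℕ) (k : ℕ → RealProg R α)
  /-- preprocessing of `r` weights, in `r` steps (as in the alias method) -/
  | prepare {r : ℕ} (w : Fin r → R) (k : DrawTable R r → RealProg R α)
  /-- a random index, with probability proportional to the weights of a prepared table;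
  `none` if no weight is positive -/
  | draw {r : ℕ} (t : DrawTable R r) (k : Option (Fin r) → RealProg R α)

noncomputable def ArithOp.eval : ArithOp → ℝ → ℝ → ℝ
  | .plus, x, y => x + y
  | .minus, x, y => x - y
  | .times, x, y => x * y
  | .divide, x, y => x / y

/-- The law on `Fin r` proportional to (the positive parts of) the weights. -/
noncomputable def weightedLaw {r : ℕ} (w : Fin r → ℝ) : PMF (Option (Fin r)) :=
  open scoped Classical in
  if h : ∑' i, ENNReal.ofReal (w i) = 0 then PMF.pure none
  else (PMF.normalize (fun i => ENNReal.ofReal (w i)) h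
    (by rw [tsum_fintype]; exact ENNReal.sum_ne_top.2 fun i _ => ENNReal.ofReal_ne_top)).map some

namespace RealProg

/-- Sequential composition. -/
def seq {R α β : Type} : RealProg R α → (α → RealProg R β) → RealProg R β
  | .ret a, f => f a
  | .lit q k, f => .lit q fun z => (k z).seq f
  | .arith o x y k, f => .arith o x y fun z => (k z).seq f
  | .sqrt x k, f => .sqrt x fun z => (k z).seq f
  | .leq x y k, f => .leq x y fun z => (k z).seq f
  | .ceil x k, f => .ceil x fun z => (k z).seq f
  | .unif m k, f => .unif m fun z => (k z).seq f
  | .prepare w k, f => .prepare w fun z => (k z).seq f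
  | .draw t k, f => .draw t fun z => (k z).seq f

instance {R : Type} : Monad (RealProg R) where
  pure := .ret
  bind := .seq

/-- Charge `c` steps. -/
noncomputable def charge {α : Type} (c : ℕ) (p : PMF (α × ℕ)) : PMF (α × ℕ) :=
  p.map fun o => (o.1, o.2 + c)

open scoped Classical in
/-- Execution over the real numbers: the joint law of the returned value and of the number of
steps. Every instruction costs one step, except `prepare`, which costs one step per weight. -/
noncomputable def run {α : Type} : RealProg ℝ α → PMF (α × ℕ)
  | .ret a => PMF.pure (a, 0)
  | .lit q k => charge 1 (run (k (q : ℝ)))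
  | .arith o x y k => charge 1 (run (k (o.eval x y)))
  | .sqrt x k => charge 1 (run (k (Real.sqrt x)))
  | .leq x y k => charge 1 (run (k (decide (x ≤ y))))
  | .ceil x k => charge 1 (run (k ⌈x⌉₊))
  | .unif m k =>
      (PMF.uniformOfFinset (Finset.Icc 1 (max 1 m))
        (Finset.nonempty_Icc.2 (le_max_left 1 m))).bind fun i => charge 1 (run (k i))
  | .prepare (r := r) w k => charge r (run (k ⟨w⟩))
  | .draw t k => (weightedLaw t.weight).bind fun i => charge 1 (run (k i))

/-! ### Single instructions and loops -/

section
variable {R : Type}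

def const (q : ℚ) : RealProg R R := .lit q .ret
def plus (x y : R) : RealProg R R := .arith .plus x y .ret
def minus (x y : R) : RealProg R R := .arith .minus x y .ret
def times (x y : R) : RealProg R R := .arith .times x y .ret
def divide (x y : R) : RealProg R R := .arith .divide x y .ret
def root (x : R) : RealProg R R := .sqrt x .ret
def isLeq (x y : R) : RealProg R Bool := .leq x y .ret
def natCeil (x : R) : RealProg R ℕ := .ceil x .ret
def uniform (m : ℕ) : RealProg R ℕ := .unif m .ret
def mkTable {r : ℕ} (w : Fin r → R) : RealProg R (DrawTable R r) := .prepare w .ret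
def drawIndex {r : ℕ} (t : DrawTable R r) : RealProg R (Option (Fin r)) := .draw t .ret

/-- Compute the coordinates of a vector one after the other. -/
def vec : {d : ℕ} → (Fin d → RealProg R R) → RealProg R (Fin d → R)
  | 0, _ => .ret Fin.elim0
  | _ + 1, f => do
      let a ← f 0
      let v ← vec fun j => f j.succ
      return Fin.cons a v

/-- Repeat a program `T` times. -/
def repeatTimes {α : Type} : ℕ → (α → RealProg R α) → α → RealProg R α
  | 0, _, a => .ret a
  | T + 1, f, a => do
      let b ← f a
      repeatTimes T f b

/-- `∑ b ∈ l, f b`, accumulated from left to right. -/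
def sumOver {β : Type} (l : List β) (f : β → RealProg R R) : RealProg R R := do
  let z ← const 0
  l.foldlM (fun acc b => do
    let t ← f b
    plus acc t) z

end

end RealProg

/-! ## The algorithm -/

/-- A matrix with `d` columns given by its `r` non-zero rows, each of them a list of
pairs (column, value). -/
structure SparseRows (R : Type) (d : ℕ) where
  r : ℕ
  row : Fin r → List (Fin d × R)

/-- The sparse format of a real matrix: its non-zero rows with their non-zero entries. -/
noncomputable def sparseRows {n d : ℕ} (A : Matrix (Fin n) (Fin d) ℝ) : SparseRows ℝ d :=
  open scoped Classical in
  let l : List (Fin n) := (List.finRange n).filter fun i => ∃ j, A i j ≠ 0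
  { r := l.length
    row := fun k => ((List.finRange d).filter fun j => A (l.get k) j ≠ 0).map
      fun j => (j, A (l.get k) j) }

namespace ShiftInvert

open RealProg

variable {R : Type} {d : ℕ}

/-- `⟨x, y⟩` -/
def dot (x y : Fin d → R) : RealProg R R :=
  sumOver (List.finRange d) fun j => times (x j) (y j)

/-- `⟨a, x⟩` for a sparse row `a` -/
def rowDot (a : List (Fin d × R)) (x : Fin d → R) : RealProg R R :=
  sumOver a fun e => times e.2 (x e.1)

/-- `y + s a` for a sparse row `a`, in place -/
def axpyRow (s : R) (a : List (Fin d × R)) (y : Fin d → R) : RealProg R (Fin d → R) :=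
  a.foldlM (fun y e => do
    let t ← times s e.2
    let u ← plus (y e.1) t
    return Function.update y e.1 u) y

/-- `Aᵀ A x` -/
def applyGram (A : SparseRows R d) (x : Fin d → R) : RealProg R (Fin d → R) := do
  let y ← vec fun _ => const 0
  (List.finRange A.r).foldlM (fun y i => do
    let s ← rowDot (A.row i) x
    axpyRow s (A.row i) y) y

/-- `B x = lam x - Aᵀ A x` -/
def applyShifted (A : SparseRows R d) (lam : R) (x : Fin d → R) : RealProg R (Fin d → R) := do
  let y ← applyGram A x
  vec fun j => do
    let t ← times lam (x j)
    minus t (y j)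

/-- `x / ‖x‖₂` -/
def toUnit (x : Fin d → R) : RealProg R (Fin d → R) := do
  let s ← dot x x
  let t ← root s
  vec fun j => divide (x j) t

/-- The Rayleigh quotient `xᵀ Aᵀ A x / xᵀ x`. -/
def rayleigh (A : SparseRows R d) (x : Fin d → R) : RealProg R R := do
  let y ← applyGram A x
  let s ← dot x y
  let t ← dot x x
  divide s t

/-- The data of the solver: the row probabilities `pᵢ = ‖aᵢ‖² / ‖A‖_F²`, a table for drawing rows
accordingly, the step size `η` and the maximal epoch length `M`. -/
structure Setup (R : Type) (r : ℕ) where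
  p : Fin r → R
  table : DrawTable R r
  eta : R
  M : ℕ

/-- With `S = 2 lamHat ‖A‖_F² / (lam - lamHat)` and `μ = lam - lamHat`, set `η = 1 / (8 S)` and
`M = ⌈64 S / μ⌉`. -/
def setup (A : SparseRows R d) (lam lamHat : R) : RealProg R (Setup R A.r) := do
  let w ← vec fun i => sumOver (A.row i) fun e => times e.2 e.2
  let F ← sumOver (List.finRange A.r) fun i => RealProg.ret (w i)
  let p ← vec fun i => divide (w i) F
  let table ← mkTable p
  let mu ← minus lam lamHat
  let two ← const 2
  let s₁ ← times two lamHat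
  let s₂ ← times s₁ F
  let S ← divide s₂ mu
  let eight ← const 8
  let s₃ ← times eight S
  let one ← const 1
  let eta ← divide one s₃
  let c ← const 64
  let s₄ ← times c S
  let s₅ ← divide s₄ mu
  let M ← natCeil s₅
  return { p := p, table := table, eta := eta, M := M }

/-- One stochastic variance reduced gradient step for `f(x) = xᵀ B x / 2 - bᵀ x = ∑ᵢ ψᵢ(x)` with
`ψᵢ(x) = xᵀ (lam pᵢ I - aᵢ aᵢᵀ) x / 2 - bᵀ x / n`: draw `i` with probability `pᵢ` and return
`x - (η / pᵢ) (∇ψᵢ(x) - ∇ψᵢ(x₀)) - η ∇f(x₀)`, where `g₀ = ∇f(x₀)`. -/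
def svrgStep (A : SparseRows R d) (lam : R) (S : Setup R A.r) (x₀ g₀ x : Fin d → R) :
    RealProg R (Fin d → R) := do
  match ← drawIndex S.table with
  | none => return x
  | some i =>
    let u ← vec fun j => minus (x j) (x₀ j)
    let s ← rowDot (A.row i) u
    let zero ← const 0
    let s' ← minus zero s
    let c ← times lam (S.p i)
    let v ← vec fun j => times c (u j)
    let dpsi ← axpyRow s' (A.row i) v
    let h ← divide S.eta (S.p i)
    vec fun j => do
      let t₁ ← times h (dpsi j)
      let t₂ ← times S.eta (g₀ j)
      let t₃ ← minus (x j) t₁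
      minus t₃ t₂

/-- One epoch of the solver for `B x = b` from `x₀`: draw `m` uniformly from `{1, …, M}` and return
the `m`-th iterate. -/
def svrgEpoch (A : SparseRows R d) (lam : R) (S : Setup R A.r) (b x₀ : Fin d → R) :
    RealProg R (Fin d → R) := do
  let y ← applyShifted A lam x₀
  let g₀ ← vec fun j => minus (y j) (b j)
  let m ← uniform S.M
  repeatTimes m (svrgStep A lam S x₀ g₀) x₀

/-- Approximation of `B⁻¹ x` by `K` epochs, started from `x / (xᵀ B x)`. -/
def solve (A : SparseRows R d) (lam : R) (S : Setup R A.r) (K : ℕ) (x : Fin d → R) :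
    RealProg R (Fin d → R) := do
  let y ← applyShifted A lam x
  let s ← dot x y
  let z ← vec fun j => divide (x j) s
  repeatTimes K (svrgEpoch A lam S x) z

/-- A burn-in iteration: apply the solver and normalize. -/
def burnInStep (A : SparseRows R d) (lam : R) (S : Setup R A.r) (K : ℕ) (x : Fin d → R) :
    RealProg R (Fin d → R) := do
  let y ← solve A lam S K x
  toUnit y

/-- A warm-start iteration: let `y` be the output of the solver, and move to `y / ‖y‖₂` if
`quot(y) ≥ lamHat - (lam - lamHat) / 6` and `‖y‖₂ ≥ (2 / 3) / (lam - lamHat)`; otherwise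
stay at `x`. -/
def warmStep (A : SparseRows R d) (lam lamHat : R) (S : Setup R A.r) (K : ℕ) (x : Fin d → R) :
    RealProg R (Fin d → R) := do
  let y ← solve A lam S K x
  let mu ← minus lam lamHat
  let six ← const 6
  let t₁ ← divide mu six
  let t₂ ← minus lamHat t₁
  let q ← rayleigh A y
  let ok₁ ← isLeq t₂ q
  let s ← dot y y
  let nrm ← root s
  let twoThirds ← const (2 / 3)
  let t₃ ← divide twoThirds mu
  let ok₂ ← isLeq t₃ nrm
  if ok₁ && ok₂ then toUnit y else return x

/-- The shifted-and-inverted power method from the start vector `x₀`: `T₁` burn-in iterations with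
`K₁` solver epochs each, then `T₂` warm-start iterations with `K₂` epochs each. -/
def powerMethod (A : SparseRows R d) (lam lamHat : R) (T₁ K₁ T₂ K₂ : ℕ) (x₀ : Fin d → R) :
    RealProg R (Fin d → R) := do
  let S ← setup A lam lamHat
  let x ← toUnit x₀
  let y ← repeatTimes T₁ (burnInStep A lam S K₁) x
  repeatTimes T₂ (warmStep A lam lamHat S K₂) y

end ShiftInvert

/-! Write `δ = λ - λ₁`. The window for `λ` makes `δ` the smallest eigenvalue of `B = λI - Σ`, with
eigenvector `v`, and puts all other eigenvalues above `101 δ` (`exists_admissible`). An exact step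
`x ↦ B⁻¹ x` therefore divides the squared tangent `tanSq` of the angle to `v`, measured in the norm
of `B`, by at least `101²`. What must be shown is that inexact solves still halve it.

Solver. The summands `ψᵢ` need not be convex, but the second moment of the row gradients at `u` is
at most `S · uᵀBu` (`sum_rowGrad_sq_le`). With `η = 1/(8S)`, a step then lowers the expected squared
distance to the solution `w` by a multiple of the current energy error, up to a smaller multiple of
the energy error at the start of the epoch. Telescoping over an epoch gives a factor `1/4` for the
expected energy error (`expect_epochKernel_le`). The starting point `x/(xᵀBx)` is the multiple of
`x` closest to `w` in the norm of `B`, so the initial error is already proportional to the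
misalignment of `x` (`qform_init_sub_le`).

Burn-in. From a squared tangent polynomial in `d/gap`, a logarithmic number of epochs makes Markov's
inequality strong enough for a union bound over all rounds (`failure_burnIn_le`), until the squared
tangent is at most `1/5`.

Warm start. A constant number of epochs is accurate only in expectation. Every vector that passes
the two tests has squared tangent at most `1/5`, and every accurate vector passes. Hence the bound
`1/5` can never be lost, and a rejection forces a large solver error, which pays for the missing
progress. So the expected `tanSq` halves in each round (`expect_warmKernel_le`), and a single
application of Markov's inequality at the end suffices.

The Gaussian start is badly aligned with probability at most `2/d¹⁰` (`gaussian_start`). For the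
cost, an epoch is one pass over the matrix and at most `M` steps of `O(d)` operations, where `M` is
of order `srank/gap²` (`epoch_length_le`). -/

/-! ## Expectations and iterates of discrete laws -/

namespace PMF

open scoped ENNReal

variable {α β : Type}

/-- The expectation of an extended non-negative function. -/
noncomputable def expect (p : PMF α) (g : α → ℝ≥0∞) : ℝ≥0∞ := ∑' a, p a * g a

theorem expect_pure (a : α) (g : α → ℝ≥0∞) : (PMF.pure a).expect g = g a := by
  classical
  rw [expect, tsum_eq_single a]
  · simp
  · intro b hb
    simp [PMF.pure_apply, hb]

theorem expect_bind (p : PMF α) (f : α → PMF β) (g : β → ℝ≥0∞) :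
    (p.bind f).expect g = p.expect fun a => (f a).expect g := by
  simp only [expect, PMF.bind_apply, ← ENNReal.tsum_mul_right, ← ENNReal.tsum_mul_left]
  rw [ENNReal.tsum_comm]
  simp only [mul_assoc]

theorem expect_map (p : PMF α) (f : α → β) (g : β → ℝ≥0∞) :
    (p.map f).expect g = p.expect (g ∘ f) := by
  rw [PMF.map, expect_bind]
  simp only [Function.comp_apply, expect_pure]
  rfl

theorem expect_mono_of_support {p : PMF α} {g h : α → ℝ≥0∞} (H : ∀ a ∈ p.support, g a ≤ h a) :
    p.expect g ≤ p.expect h := by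
  refine ENNReal.tsum_le_tsum fun a => ?_
  by_cases ha : p a = 0
  · simp [ha]
  · gcongr
    exact H a ((PMF.mem_support_iff p a).2 ha)

theorem expect_mono {p : PMF α} {g h : α → ℝ≥0∞} (H : ∀ a, g a ≤ h a) :
    p.expect g ≤ p.expect h :=
  expect_mono_of_support fun a _ => H a

theorem expect_const (p : PMF α) (c : ℝ≥0∞) : p.expect (fun _ => c) = c := by
  rw [expect, ENNReal.tsum_mul_right, p.tsum_coe, one_mul]

theorem expect_add (p : PMF α) (g h : α → ℝ≥0∞) :
    p.expect (fun a => g a + h a) = p.expect g + p.expect h := by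
  simp only [expect, mul_add, ENNReal.tsum_add]

theorem expect_mul_left (p : PMF α) (c : ℝ≥0∞) (g : α → ℝ≥0∞) :
    p.expect (fun a => c * g a) = c * p.expect g := by
  simp only [expect, ← ENNReal.tsum_mul_left, mul_left_comm]

theorem expect_finset_sum {ι : Type*} (p : PMF α) (s : Finset ι) (g : ι → α → ℝ≥0∞) :
    p.expect (fun a => ∑ i ∈ s, g i a) = ∑ i ∈ s, p.expect (g i) := by
  classical
  induction s using Finset.induction_on with
  | empty => simp [expect]
  | insert i s hi ih => simp only [Finset.sum_insert hi, expect_add, ih]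

/-- The probability that `P` fails. -/
noncomputable def failure (p : PMF α) (P : α → Prop) : ℝ≥0∞ :=
  open scoped Classical in p.expect fun a => if P a then 0 else 1

theorem failure_pure_of {a : α} {P : α → Prop} (h : P a) : (PMF.pure a).failure P = 0 := by
  rw [failure, expect_pure, if_pos h]

theorem failure_le_one (p : PMF α) (P : α → Prop) : p.failure P ≤ 1 := by
  classical
  refine (expect_mono (h := fun _ => 1) fun a => ?_).trans (expect_const p 1).le
  split_ifs <;> simp

theorem failure_bind (p : PMF α) (f : α → PMF β) (P : β → Prop) :
    (p.bind f).failure P = p.expect fun a => (f a).failure P :=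
  expect_bind _ _ _

theorem failure_map (p : PMF α) (f : α → β) (P : β → Prop) :
    (p.map f).failure P = p.failure (P ∘ f) :=
  expect_map _ _ _

/-- If `P` fails under `p` with probability at most `c`, and from `P` the kernel `f` fails `Q` with
probability at most `e`, then the composition fails `Q` with probability at most `c + e`. -/
theorem failure_bind_le {p : PMF α} {f : α → PMF β} {P : α → Prop} {Q : β → Prop}
    {c e : ℝ≥0∞} (hp : p.failure P ≤ c) (hf : ∀ a, P a → (f a).failure Q ≤ e) :
    (p.bind f).failure Q ≤ c + e := by
  classical
  rw [failure_bind]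
  have : ∀ a, (f a).failure Q ≤ (if P a then 0 else 1) + e := fun a => by
    by_cases h : P a
    · simpa [h] using hf a h
    · simpa [h] using (failure_le_one _ _).trans le_self_add
  refine (expect_mono this).trans ?_
  rw [expect_add, expect_const]
  gcongr
  exact hp

/-- Markov's inequality. -/
theorem failure_mul_le {p : PMF α} {P : α → Prop} {g : α → ℝ≥0∞} {c : ℝ≥0∞}
    (h : ∀ a ∈ p.support, ¬ P a → c ≤ g a) : c * p.failure P ≤ p.expect g := by
  classical
  rw [failure, ← expect_mul_left]
  refine expect_mono_of_support fun a ha => ?_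
  by_cases hP : P a
  · simp [hP]
  · simpa [hP] using h a ha hP

theorem toOuterMeasure_eq_expect (p : PMF α) (s : Set α) :
    p.toOuterMeasure s = p.expect (s.indicator 1) := by
  classical
  rw [PMF.toOuterMeasure_apply, expect]
  refine tsum_congr fun a => ?_
  by_cases h : a ∈ s <;> simp [h]

theorem one_sub_failure_le (p : PMF α) (P : α → Prop) :
    1 - p.failure P ≤ p.toOuterMeasure {a | P a} := by
  classical
  rw [tsub_le_iff_right, toOuterMeasure_eq_expect, failure, ← expect_add]
  refine (expect_const p 1).symm.le.trans (expect_mono fun a => ?_)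
  by_cases h : P a <;> simp [h]

/-- The law after `k` steps of a Markov chain. -/
noncomputable def iter (κ : α → PMF α) : ℕ → α → PMF α
  | 0, a => PMF.pure a
  | k + 1, a => (κ a).bind (iter κ k)

/-- The drift inequality is only needed on states satisfying `P`, because the chain never leaves
`P`. In the warm-start phase `P` is alignment with squared tangent at most `1/5`. -/
theorem expect_iter_le {κ : α → PMF α} {P : α → Prop} {g : α → ℝ≥0∞} {c : ℝ≥0∞}
    (hP : ∀ a, P a → ∀ b ∈ (κ a).support, P b) (hg : ∀ a, P a → (κ a).expect g ≤ c * g a)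
    (k : ℕ) : ∀ a, P a → (iter κ k a).expect g ≤ c ^ k * g a := by
  induction k with
  | zero => intro a _; simp [iter, expect_pure]
  | succ k ih =>
    intro a ha
    rw [iter, expect_bind]
    refine (expect_mono_of_support fun b hb => ih b (hP a ha b hb)).trans ?_
    rw [expect_mul_left, pow_succ, mul_assoc]
    gcongr
    exact hg a ha

theorem iter_support {κ : α → PMF α} {P : α → Prop}
    (hP : ∀ a, P a → ∀ b ∈ (κ a).support, P b) (k : ℕ) :
    ∀ a, P a → ∀ b ∈ (iter κ k a).support, P b := by
  induction k with
  | zero =>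
    intro a ha b hb
    rw [iter, PMF.mem_support_pure_iff] at hb
    exact hb ▸ ha
  | succ k ih =>
    intro a ha b hb
    rw [iter, PMF.mem_support_bind_iff] at hb
    obtain ⟨a', ha', hb⟩ := hb
    exact ih a' (hP a ha a' ha') b hb

/-- A union bound along the chain with a target that moves with time. The starting time `t` is a
variable so that the induction can advance it. -/
theorem failure_iter_le {κ : α → PMF α} {P : ℕ → α → Prop} {c : ℝ≥0∞}
    (h : ∀ t a, P t a → (κ a).failure (P (t + 1)) ≤ c) (k : ℕ) :
    ∀ t a, P t a → (iter κ k a).failure (P (t + k)) ≤ k * c := by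
  induction k with
  | zero => intro t a ha; rw [iter, failure_pure_of (by simpa using ha)]; simp
  | succ k ih =>
    intro t a ha
    rw [iter]
    have := failure_bind_le (h t a ha) (ih (t + 1))
    rw [show t + (k + 1) = t + 1 + k by omega]
    refine this.trans (le_of_eq ?_)
    push_cast
    ring

end PMF

/-- Passes from the extended non-negative expectation to a finite real sum, where the one-step
algebra takes place. The outcome `none` carries no mass because the weights sum to one. -/
theorem expect_weightedLaw {r : ℕ} {w : Fin r → ℝ} (hw : ∀ i, 0 ≤ w i) (h1 : ∑ i, w i = 1)
    {g : Option (Fin r) → ℝ} (hg : ∀ o, 0 ≤ g o) :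
    (weightedLaw w).expect (fun o => ENNReal.ofReal (g o)) =
      ENNReal.ofReal (∑ i, w i * g (some i)) := by
  have hsum : ∑' i, ENNReal.ofReal (w i) = 1 := by
    rw [tsum_fintype, ← ENNReal.ofReal_sum_of_nonneg fun i _ => hw i, h1, ENNReal.ofReal_one]
  rw [weightedLaw, dif_neg (by rw [hsum]; exact one_ne_zero), PMF.expect_map, PMF.expect,
    tsum_fintype, ENNReal.ofReal_sum_of_nonneg fun i _ => mul_nonneg (hw i) (hg _)]
  refine Finset.sum_congr rfl fun i _ => ?_
  rw [PMF.normalize_apply, hsum, inv_one, mul_one, Function.comp_apply,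
    ENNReal.ofReal_mul (hw i)]

/-! ## Laws and costs of programs -/

namespace RealProg

variable {α β : Type}

theorem charge_zero (p : PMF (α × ℕ)) : charge 0 p = p := by
  exact PMF.map_id p

theorem charge_charge (a b : ℕ) (p : PMF (α × ℕ)) : charge a (charge b p) = charge (b + a) p := by
  simp only [charge, PMF.map_comp]
  congr 1
  funext o
  simp [add_assoc]

theorem charge_bind (c : ℕ) (p : PMF (α × ℕ)) (f : α → RealProg ℝ β) :
    charge c (p.bind fun o => charge o.2 (f o.1).run) =
      (charge c p).bind fun o => charge o.2 (f o.1).run := by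
  conv_rhs => rw [charge, PMF.bind_map]
  rw [charge, PMF.map_bind]
  congr 1
  funext o
  exact charge_charge _ _ _

theorem run_seq (p : RealProg ℝ α) (f : α → RealProg ℝ β) :
    (p.seq f).run = p.run.bind fun o => charge o.2 (f o.1).run := by
  induction p with
  | ret a => simp [seq, run, PMF.pure_bind, charge_zero]
  | lit q k ih => simp only [seq, run, ih, charge_bind]
  | arith o x y k ih => simp only [seq, run, ih, charge_bind]
  | sqrt x k ih => simp only [seq, run, ih, charge_bind]
  | leq x y k ih => simp only [seq, run, ih, charge_bind]
  | ceil x k ih => simp only [seq, run, ih, charge_bind]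
  | unif m k ih => simp only [seq, run, ih, charge_bind, PMF.bind_bind]
  | prepare w k ih => simp only [seq, run, ih, charge_bind]
  | draw t k ih => simp only [seq, run, ih, charge_bind, PMF.bind_bind]

theorem run_bind (p : RealProg ℝ α) (f : α → RealProg ℝ β) :
    (p >>= f).run = p.run.bind fun o => charge o.2 (f o.1).run :=
  run_seq p f

/-- The law of the returned value. -/
noncomputable def law (p : RealProg ℝ α) : PMF α := p.run.map Prod.fst

theorem map_fst_charge (c : ℕ) (p : PMF (α × ℕ)) : (charge c p).map Prod.fst = p.map Prod.fst := by
  rw [charge, PMF.map_comp]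
  rfl

theorem law_bind (p : RealProg ℝ α) (f : α → RealProg ℝ β) :
    (p >>= f).law = p.law.bind fun a => (f a).law := by
  simp only [law, run_bind, PMF.map_bind, map_fst_charge, PMF.bind_map]
  rfl

theorem law_pure (a : α) : (pure a : RealProg ℝ α).law = PMF.pure a := by
  change (PMF.pure (a, 0)).map Prod.fst = _
  rw [PMF.pure_map]

/-- Every run of the program takes at most `c` steps. -/
def CostLE (p : RealProg ℝ α) (c : ℕ) : Prop := ∀ o ∈ p.run.support, o.2 ≤ c

theorem CostLE.mono {p : RealProg ℝ α} {c c' : ℕ} (h : CostLE p c) (hc : c ≤ c') : CostLE p c' :=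
  fun o ho => (h o ho).trans hc

/-- The continuation is only bounded on possible values. This matters for an epoch, whose loop
length is bounded by `M` only because of how it is drawn. -/
theorem CostLE.bind {p : RealProg ℝ α} {f : α → RealProg ℝ β} {c c' : ℕ} (hp : CostLE p c)
    (hf : ∀ a ∈ p.law.support, CostLE (f a) c') : CostLE (p >>= f) (c + c') := by
  intro o ho
  rw [run_bind, PMF.mem_support_bind_iff] at ho
  obtain ⟨o₁, h₁, ho⟩ := ho
  rw [charge, PMF.mem_support_map_iff] at ho
  obtain ⟨o₂, h₂, rfl⟩ := ho
  have h₃ := hp o₁ h₁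
  have h₄ := hf o₁.1 (by rw [law, PMF.mem_support_map_iff]; exact ⟨o₁, h₁, rfl⟩) o₂ h₂
  simp only
  omega

theorem CostLE.pure (a : α) : CostLE (pure a : RealProg ℝ α) 0 := by
  intro o ho
  change o ∈ (PMF.pure (a, 0)).support at ho
  rw [PMF.mem_support_pure_iff] at ho
  simp [ho]

/-- The program is deterministic, returns `a` and takes at most `c` steps. -/
def Computes (p : RealProg ℝ α) (a : α) (c : ℕ) : Prop := ∃ c' ≤ c, p.run = PMF.pure (a, c')

theorem Computes.mono {p : RealProg ℝ α} {a : α} {c c' : ℕ} (h : Computes p a c) (hc : c ≤ c') :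
    Computes p a c' := by
  obtain ⟨c₁, h₁, h₂⟩ := h
  exact ⟨c₁, h₁.trans hc, h₂⟩

theorem Computes.law {p : RealProg ℝ α} {a : α} {c : ℕ} (h : Computes p a c) :
    p.law = PMF.pure a := by
  obtain ⟨c₁, -, h₂⟩ := h
  rw [RealProg.law, h₂, PMF.pure_map]

theorem Computes.costLE {p : RealProg ℝ α} {a : α} {c : ℕ} (h : Computes p a c) : CostLE p c := by
  obtain ⟨c₁, h₁, h₂⟩ := h
  intro o ho
  rw [h₂, PMF.mem_support_pure_iff] at ho
  simpa [ho] using h₁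

theorem Computes.pure (a : α) : Computes (pure a : RealProg ℝ α) a 0 := ⟨0, le_rfl, rfl⟩

theorem Computes.bind {p : RealProg ℝ α} {f : α → RealProg ℝ β} {a : α} {b : β} {c c' : ℕ}
    (hp : Computes p a c) (hf : Computes (f a) b c') : Computes (p >>= f) b (c + c') := by
  obtain ⟨c₁, h₁, h₂⟩ := hp
  obtain ⟨c₃, h₃, h₄⟩ := hf
  refine ⟨c₃ + c₁, by omega, ?_⟩
  rw [run_bind, h₂, PMF.pure_bind]
  simp [h₄, charge, PMF.pure_map]

theorem Computes.law_bind {p : RealProg ℝ α} {a : α} {c : ℕ} (hp : Computes p a c)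
    (f : α → RealProg ℝ β) : (p >>= f).law = (f a).law := by
  rw [RealProg.law_bind, hp.law, PMF.pure_bind]

theorem Computes.costLE_bind {p : RealProg ℝ α} {f : α → RealProg ℝ β} {a : α} {c c' : ℕ}
    (hp : Computes p a c) (hf : CostLE (f a) c') : CostLE (p >>= f) (c + c') := by
  refine hp.costLE.bind fun b hb => ?_
  rw [hp.law, PMF.mem_support_pure_iff] at hb
  exact hb ▸ hf

theorem computes_const (q : ℚ) : Computes (const q) (q : ℝ) 1 := by
  refine ⟨1, le_rfl, ?_⟩
  simp [const, run, charge, PMF.pure_map]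

theorem computes_plus (x y : ℝ) : Computes (plus x y) (x + y) 1 := by
  refine ⟨1, le_rfl, ?_⟩
  simp [plus, run, charge, PMF.pure_map, ArithOp.eval]

theorem computes_minus (x y : ℝ) : Computes (minus x y) (x - y) 1 := by
  refine ⟨1, le_rfl, ?_⟩
  simp [minus, run, charge, PMF.pure_map, ArithOp.eval]

theorem computes_times (x y : ℝ) : Computes (times x y) (x * y) 1 := by
  refine ⟨1, le_rfl, ?_⟩
  simp [times, run, charge, PMF.pure_map, ArithOp.eval]

theorem computes_divide (x y : ℝ) : Computes (divide x y) (x / y) 1 := by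
  refine ⟨1, le_rfl, ?_⟩
  simp [divide, run, charge, PMF.pure_map, ArithOp.eval]

theorem computes_root (x : ℝ) : Computes (root x) (Real.sqrt x) 1 := by
  refine ⟨1, le_rfl, ?_⟩
  simp [root, run, charge, PMF.pure_map]

open scoped Classical in
theorem computes_isLeq (x y : ℝ) : Computes (isLeq x y) (decide (x ≤ y)) 1 := by
  refine ⟨1, le_rfl, ?_⟩
  simp [isLeq, run, charge, PMF.pure_map]

theorem computes_natCeil (x : ℝ) : Computes (natCeil x) ⌈x⌉₊ 1 := by
  refine ⟨1, le_rfl, ?_⟩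
  simp [natCeil, run, charge, PMF.pure_map]

theorem computes_mkTable {r : ℕ} (w : Fin r → ℝ) : Computes (mkTable w) ⟨w⟩ r := by
  refine ⟨r, le_rfl, ?_⟩
  simp [mkTable, run, charge, PMF.pure_map]

theorem law_uniform (m : ℕ) :
    (uniform m : RealProg ℝ ℕ).law = PMF.uniformOfFinset (Finset.Icc 1 (max 1 m))
      (Finset.nonempty_Icc.2 (le_max_left 1 m)) := by
  simp [law, uniform, run, charge, PMF.pure_map, PMF.map_bind, PMF.bind_pure]

theorem costLE_uniform (m : ℕ) : CostLE (uniform m : RealProg ℝ ℕ) 1 := by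
  intro o ho
  simp only [uniform, run, charge, PMF.pure_map, PMF.mem_support_bind_iff,
    PMF.mem_support_pure_iff] at ho
  obtain ⟨i, -, rfl⟩ := ho
  simp

theorem law_drawIndex {r : ℕ} (t : DrawTable ℝ r) : (drawIndex t).law = weightedLaw t.weight := by
  simp [law, drawIndex, run, charge, PMF.pure_map, PMF.map_bind, PMF.bind_pure]

theorem costLE_drawIndex {r : ℕ} (t : DrawTable ℝ r) : CostLE (drawIndex t) 1 := by
  intro o ho
  simp only [drawIndex, run, charge, PMF.pure_map, PMF.mem_support_bind_iff,
    PMF.mem_support_pure_iff] at ho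
  obtain ⟨i, -, rfl⟩ := ho
  simp

theorem computes_vec {d : ℕ} {f : Fin d → RealProg ℝ ℝ} {g : Fin d → ℝ} {c : Fin d → ℕ}
    (h : ∀ j, Computes (f j) (g j) (c j)) : Computes (vec f) g (∑ j, c j) := by
  induction d with
  | zero =>
    rw [show g = Fin.elim0 from Subsingleton.elim _ _]
    exact (Computes.pure _).mono (Nat.zero_le _)
  | succ d ih =>
    rw [Fin.sum_univ_succ]
    have hg : (Fin.cons (g 0) (fun j => g j.succ) : Fin (d + 1) → ℝ) = g := Fin.cons_self_tail g
    refine (h 0).bind (f := fun a => do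
      let v ← vec fun j => f j.succ
      return (Fin.cons a v : Fin (d + 1) → ℝ)) ?_
    have h' := (ih fun j => h j.succ).bind
      (f := fun v => pure (Fin.cons (g 0) v : Fin (d + 1) → ℝ))
      (Computes.pure (Fin.cons (g 0) (fun j => g j.succ) : Fin (d + 1) → ℝ))
    rwa [hg, add_zero] at h'

theorem computes_vec_const {d : ℕ} {f : Fin d → RealProg ℝ ℝ} {g : Fin d → ℝ} {c : ℕ}
    (h : ∀ j, Computes (f j) (g j) c) : Computes (vec f) g (d * c) := by
  simpa using computes_vec h

theorem computes_foldlM {γ : Type} {f : α → γ → RealProg ℝ α} {g : α → γ → α}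
    {c : γ → ℕ} (h : ∀ a b, Computes (f a b) (g a b) (c b)) (l : List γ) (a : α) :
    Computes (l.foldlM f a) (l.foldl g a) (l.map c).sum := by
  induction l generalizing a with
  | nil => exact Computes.pure a
  | cons b l ih =>
    rw [List.foldlM_cons, List.foldl_cons, List.map_cons, List.sum_cons]
    exact (h a b).bind (ih _)

theorem computes_sumOver {γ : Type} {f : γ → RealProg ℝ ℝ} {g : γ → ℝ} {c : γ → ℕ}
    (h : ∀ b, Computes (f b) (g b) (c b)) (l : List γ) :
    Computes (sumOver l f) (l.map g).sum (1 + (l.map fun b => c b + 1).sum) := by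
  have h₁ := computes_foldlM (f := fun acc b => do
    let t ← f b
    plus acc t) (g := fun acc b => acc + g b)
    (fun a b => (h b).bind (computes_plus a (g b))) l 0
  have h₂ : ∀ a : ℝ, l.foldl (fun acc b => acc + g b) a = a + (l.map g).sum := by
    intro a
    induction l generalizing a with
    | nil => simp
    | cons b l ih =>
      simp only [List.foldl_cons, List.map_cons, List.sum_cons]
      rw [ih (computes_foldlM (fun a b => (h b).bind (computes_plus a (g b))) l 0), add_assoc]
  rw [h₂, zero_add] at h₁
  refine (computes_const 0).bind ?_
  simpa using h₁

theorem law_repeatTimes (T : ℕ) (f : α → RealProg ℝ α) (a : α) :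
    (repeatTimes T f a).law = PMF.iter (fun a => (f a).law) T a := by
  induction T generalizing a with
  | zero => exact law_pure a
  | succ T ih =>
    rw [PMF.iter, repeatTimes, law_bind]
    simp only [ih]

theorem costLE_repeatTimes {f : α → RealProg ℝ α} {c : ℕ} (h : ∀ a, CostLE (f a) c) (T : ℕ)
    (a : α) : CostLE (repeatTimes T f a) (T * c) := by
  induction T generalizing a with
  | zero => exact (CostLE.pure a).mono (Nat.zero_le _)
  | succ T ih =>
    refine CostLE.mono ((h a).bind fun b _ => ih b) (by ring_nf; omega)

end RealProg

/-! ## Laws and costs of the parts of the algorithm -/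

theorem RealProg.Computes.congr {α : Type} {p : RealProg ℝ α} {a a' : α} {c c' : ℕ}
    (h : RealProg.Computes p a c) (ha : a = a') (hc : c ≤ c') : RealProg.Computes p a' c' :=
  ha ▸ h.mono hc

/-- The vector of a list of pairs (column, value). -/
def rowVec {d : ℕ} (a : List (Fin d × ℝ)) : Fin d → ℝ := (a.map fun e => Pi.single e.1 e.2).sum

theorem rowVec_cons {d : ℕ} (e : Fin d × ℝ) (a : List (Fin d × ℝ)) :
    rowVec (e :: a) = Pi.single e.1 e.2 + rowVec a := by
  simp [rowVec]

theorem rowVec_dotProduct {d : ℕ} (a : List (Fin d × ℝ)) (x : Fin d → ℝ) :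
    rowVec a ⬝ᵥ x = (a.map fun e => e.2 * x e.1).sum := by
  induction a with
  | nil => simp [rowVec]
  | cons e a ih => simp [rowVec_cons, add_dotProduct, ih]

theorem rowVec_apply_of_notMem {d : ℕ} {a : List (Fin d × ℝ)} {j : Fin d}
    (h : j ∉ a.map Prod.fst) : rowVec a j = 0 := by
  induction a with
  | nil => simp [rowVec]
  | cons e a ih =>
    simp only [List.map_cons, List.mem_cons, not_or] at h
    rw [rowVec_cons, Pi.add_apply, ih h.2, Pi.single_eq_of_ne h.1, add_zero]

/-- Without repeated columns there are no cross terms, so the row norms computed by `setup` are the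
true ones. -/
theorem rowVec_dotProduct_self {d : ℕ} {a : List (Fin d × ℝ)} (h : (a.map Prod.fst).Nodup) :
    rowVec a ⬝ᵥ rowVec a = (a.map fun e => e.2 * e.2).sum := by
  induction a with
  | nil => simp [rowVec]
  | cons e a ih =>
    simp only [List.map_cons, List.nodup_cons] at h
    have h₀ := rowVec_apply_of_notMem h.1
    simp [rowVec_cons, add_dotProduct, dotProduct_add, ih h.2, h₀]

/-! ### Sparse storage and the matrix it represents -/

namespace SparseRows

variable {d : ℕ}

/-- The matrix of the stored rows. -/
def toMatrix (S : SparseRows ℝ d) : Matrix (Fin S.r) (Fin d) ℝ := fun i => rowVec (S.row i)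

/-- The number of stored entries. -/
def size (S : SparseRows ℝ d) : ℕ := ∑ i, (S.row i).length

/-- There are no empty rows, and no row has two entries in one column. -/
structure Proper (S : SparseRows ℝ d) : Prop where
  pos : ∀ i, 1 ≤ (S.row i).length
  nodup : ∀ i, ((S.row i).map Prod.fst).Nodup

theorem Proper.length_le {S : SparseRows ℝ d} (h : S.Proper) (i : Fin S.r) :
    (S.row i).length ≤ d := by
  simpa using (h.nodup i).length_le_card

/-- Since stored rows are non-empty, work proportional to the number of rows can be charged to the
number of entries. -/
theorem Proper.r_le {S : SparseRows ℝ d} (h : S.Proper) : S.r ≤ S.size := by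
  have := Finset.sum_le_sum fun i (_ : i ∈ Finset.univ) => h.pos i
  simpa [size] using this

end SparseRows

/-- The matrix `lam I - Aᵀ A`. -/
def shifted {m : Type*} [Fintype m] {d : ℕ} (A : Matrix m (Fin d) ℝ) (lam : ℝ) :
    Matrix (Fin d) (Fin d) ℝ :=
  lam • (1 : Matrix (Fin d) (Fin d) ℝ) - Aᵀ * A

/-- The positive multiple of a non-zero vector that has norm `1`. -/
noncomputable def unitize {d : ℕ} (x : Fin d → ℝ) : Fin d → ℝ := (√(x ⬝ᵥ x))⁻¹ • x

/-- The iterate after `x` for a drawn row index. -/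
noncomputable def svrgUpdate {r d : ℕ} (A : Matrix (Fin r) (Fin d) ℝ) (lam : ℝ) (p : Fin r → ℝ)
    (eta : ℝ) (x₀ g₀ x : Fin d → ℝ) : Option (Fin r) → Fin d → ℝ
  | none => x
  | some i => x - (eta / p i) • ((lam * p i) • (x - x₀) - (A i ⬝ᵥ (x - x₀)) • A i) - eta • g₀

/-- The law of the iterate after `x`. -/
noncomputable def svrgKernel {r d : ℕ} (A : Matrix (Fin r) (Fin d) ℝ) (lam : ℝ) (p : Fin r → ℝ)
    (eta : ℝ) (x₀ g₀ x : Fin d → ℝ) : PMF (Fin d → ℝ) :=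
  (weightedLaw p).map (svrgUpdate A lam p eta x₀ g₀ x)

/-- The law of the result of an epoch. -/
noncomputable def epochKernel {r d : ℕ} (A : Matrix (Fin r) (Fin d) ℝ) (lam : ℝ) (p : Fin r → ℝ)
    (eta : ℝ) (M : ℕ) (b x₀ : Fin d → ℝ) : PMF (Fin d → ℝ) :=
  (PMF.uniformOfFinset (Finset.Icc 1 (max 1 M)) (Finset.nonempty_Icc.2 (le_max_left 1 M))).bind
    fun m => PMF.iter (svrgKernel A lam p eta x₀ (shifted A lam *ᵥ x₀ - b)) m x₀

/-- The law of the result of the solver. -/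
noncomputable def solveKernel {r d : ℕ} (A : Matrix (Fin r) (Fin d) ℝ) (lam : ℝ) (p : Fin r → ℝ)
    (eta : ℝ) (M K : ℕ) (x : Fin d → ℝ) : PMF (Fin d → ℝ) :=
  PMF.iter (epochKernel A lam p eta M x) K ((x ⬝ᵥ (shifted A lam *ᵥ x))⁻¹ • x)

/-- The two tests of a warm-start iteration. -/
def WarmTest {r d : ℕ} (A : Matrix (Fin r) (Fin d) ℝ) (lam lamHat : ℝ) (y : Fin d → ℝ) : Prop :=
  lamHat - (lam - lamHat) / 6 ≤ y ⬝ᵥ ((Aᵀ * A) *ᵥ y) / (y ⬝ᵥ y) ∧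
    2 / 3 / (lam - lamHat) ≤ √(y ⬝ᵥ y)

/-- The result of a warm-start iteration from `x` when the solver returns `y`. -/
noncomputable def warmUpdate {r d : ℕ} (A : Matrix (Fin r) (Fin d) ℝ) (lam lamHat : ℝ)
    (x y : Fin d → ℝ) : Fin d → ℝ :=
  open scoped Classical in if WarmTest A lam lamHat y then unitize y else x

namespace ShiftInvert

open RealProg

variable {d : ℕ}

theorem computes_dot (x y : Fin d → ℝ) : Computes (dot x y) (x ⬝ᵥ y) (2 * d + 1) := by
  refine Computes.congr (computes_sumOver (fun j => computes_times (x j) (y j))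
    (List.finRange d)) ?_ ?_
  · rw [dotProduct, ← Fin.sum_univ_def]
  · simp; omega

theorem computes_rowDot (a : List (Fin d × ℝ)) (x : Fin d → ℝ) :
    Computes (rowDot a x) (rowVec a ⬝ᵥ x) (2 * a.length + 1) := by
  refine Computes.congr (computes_sumOver
    (fun e : Fin d × ℝ => computes_times e.2 (x e.1)) a) ?_ ?_
  · rw [rowVec_dotProduct]
  · simp; omega

theorem computes_axpyRow (s : ℝ) (a : List (Fin d × ℝ)) (y : Fin d → ℝ) :
    Computes (axpyRow s a y) (y + s • rowVec a) (2 * a.length) := by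
  have h := computes_foldlM (f := fun (y : Fin d → ℝ) (e : Fin d × ℝ) => do
    let t ← times s e.2
    let u ← plus (y e.1) t
    return Function.update y e.1 u)
    (g := fun y e => Function.update y e.1 (y e.1 + s * e.2)) (c := fun _ => 1 + (1 + 0))
    (fun y e => (computes_times _ _).bind ((computes_plus _ _).bind (by exact Computes.pure _))) a y
  refine h.congr ?_ (by simp [mul_comm])
  clear h
  induction a generalizing y with
  | nil => simp [rowVec]
  | cons e a ih =>
    rw [List.foldl_cons, ih, rowVec_cons, smul_add, ← add_assoc]
    congr 1
    ext j
    by_cases hj : j = e.1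
    · subst hj; simp
    · simp [hj]

theorem gram_mulVec {r : ℕ} (A : Matrix (Fin r) (Fin d) ℝ) (x : Fin d → ℝ) :
    (Aᵀ * A) *ᵥ x = ∑ i, (A i ⬝ᵥ x) • A i := by
  ext j
  rw [← mulVec_mulVec]
  simp [mulVec, dotProduct, Finset.sum_apply, mul_comm]

theorem computes_applyGram {S : SparseRows ℝ d} (hS : S.Proper) (x : Fin d → ℝ) :
    Computes (applyGram S x) ((S.toMatrixᵀ * S.toMatrix) *ᵥ x) (d + 5 * S.size) := by
  have h := computes_foldlM (f := fun y i => do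
    let s ← rowDot (S.row i) x
    axpyRow s (S.row i) y)
    (g := fun y i => y + (rowVec (S.row i) ⬝ᵥ x) • rowVec (S.row i))
    (c := fun i => 2 * (S.row i).length + 1 + 2 * (S.row i).length)
    (fun y i => (computes_rowDot _ _).bind (computes_axpyRow _ _ _))
    (List.finRange S.r) (fun _ => (0 : ℝ))
  have h₁ : ∀ (l : List (Fin S.r)) (y : Fin d → ℝ),
      l.foldl (fun y i => y + (rowVec (S.row i) ⬝ᵥ x) • rowVec (S.row i)) y =
        y + (l.map fun i => (rowVec (S.row i) ⬝ᵥ x) • rowVec (S.row i)).sum := by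
    intro l
    induction l with
    | nil => simp
    | cons i l ih => intro y; rw [List.foldl_cons, ih]; simp [add_assoc]
  refine Computes.congr ((computes_vec_const (c := 1) fun _ => by
    simpa using computes_const 0).bind h) ?_ ?_
  · rw [h₁, ← Fin.sum_univ_def, gram_mulVec]
    change (0 : Fin d → ℝ) + _ = _
    rw [zero_add]
    rfl
  · rw [← Fin.sum_univ_def, mul_one]
    gcongr
    rw [SparseRows.size, Finset.mul_sum]
    refine Finset.sum_le_sum fun i _ => ?_
    -- The additive `1` in the cost of a sparse dot product is absorbed by the length of the row,
    -- which is at least one.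
    have := hS.pos i
    omega

theorem computes_applyShifted {S : SparseRows ℝ d} (hS : S.Proper) (lam : ℝ) (x : Fin d → ℝ) :
    Computes (applyShifted S lam x) (shifted S.toMatrix lam *ᵥ x) (3 * d + 5 * S.size) := by
  refine Computes.congr ((computes_applyGram hS x).bind (computes_vec_const (c := 1 + 1) fun j =>
    (computes_times lam (x j)).bind (computes_minus _ _))) ?_ (by omega)
  ext j
  simp [shifted, sub_mulVec, smul_mulVec]

theorem computes_toUnit (x : Fin d → ℝ) : Computes (toUnit x) (unitize x) (3 * d + 2) := by
  refine Computes.congr ((computes_dot x x).bind ((computes_root _).bind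
    (computes_vec_const (c := 1) fun j => computes_divide _ _))) ?_ (by omega)
  ext j
  simp [unitize, div_eq_inv_mul]

theorem computes_rayleigh {S : SparseRows ℝ d} (hS : S.Proper) (x : Fin d → ℝ) :
    Computes (rayleigh S x) (x ⬝ᵥ ((S.toMatrixᵀ * S.toMatrix) *ᵥ x) / (x ⬝ᵥ x))
      (5 * d + 5 * S.size + 3) :=
  ((computes_applyGram hS x).bind ((computes_dot _ _).bind ((computes_dot _ _).bind
    (computes_divide _ _)))).mono (by omega)

/-- The squared Frobenius norm. -/
def frobSq {r d : ℕ} (A : Matrix (Fin r) (Fin d) ℝ) : ℝ := ∑ i, A i ⬝ᵥ A i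

/-- The row probabilities. -/
noncomputable def rowProb {r d : ℕ} (A : Matrix (Fin r) (Fin d) ℝ) (i : Fin r) : ℝ :=
  A i ⬝ᵥ A i / frobSq A

/-- The smoothness parameter `2 lamHat ‖A‖_F² / (lam - lamHat)`. -/
noncomputable def smoothness {r d : ℕ} (A : Matrix (Fin r) (Fin d) ℝ) (lam lamHat : ℝ) : ℝ :=
  2 * lamHat * frobSq A / (lam - lamHat)

/-- The data computed by `setup`. -/
noncomputable def setupOf {r d : ℕ} (A : Matrix (Fin r) (Fin d) ℝ) (lam lamHat : ℝ) :
    Setup ℝ r where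
  p := rowProb A
  table := ⟨rowProb A⟩
  eta := 1 / (8 * smoothness A lam lamHat)
  M := ⌈64 * smoothness A lam lamHat / (lam - lamHat)⌉₊

theorem computes_setup {S : SparseRows ℝ d} (hS : S.Proper) (lam lamHat : ℝ) :
    Computes (setup S lam lamHat) (setupOf S.toMatrix lam lamHat) (6 * S.size + 14) := by
  have hw : Computes (vec fun i => sumOver (S.row i) fun e => times e.2 e.2)
      (fun i => S.toMatrix i ⬝ᵥ S.toMatrix i) (3 * S.size) := by
    refine Computes.congr (computes_vec fun i => computes_sumOver
      (fun e : Fin d × ℝ => computes_times e.2 e.2) (S.row i)) ?_ ?_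
    · ext i
      exact (rowVec_dotProduct_self (hS.nodup i)).symm
    · rw [SparseRows.size, Finset.mul_sum]
      refine Finset.sum_le_sum fun i _ => ?_
      have := hS.pos i
      simp
      omega
  have hF : Computes (sumOver (List.finRange S.r) fun i =>
      RealProg.ret (S.toMatrix i ⬝ᵥ S.toMatrix i)) (frobSq S.toMatrix) (1 + S.size) := by
    refine Computes.congr (computes_sumOver (fun i => Computes.pure (S.toMatrix i ⬝ᵥ S.toMatrix i))
      (List.finRange S.r)) ?_ ?_
    · rw [← Fin.sum_univ_def, frobSq]
    · simpa using hS.r_le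
  refine Computes.congr (hw.bind (hF.bind
    ((computes_vec_const (c := 1) fun i => computes_divide _ _).bind
    ((computes_mkTable _).bind ((computes_minus _ _).bind ((computes_const _).bind
    ((computes_times _ _).bind ((computes_times _ _).bind ((computes_divide _ _).bind
    ((computes_const _).bind ((computes_times _ _).bind ((computes_const _).bind
    ((computes_divide _ _).bind ((computes_const _).bind ((computes_times _ _).bind
    ((computes_divide _ _).bind ((computes_natCeil _).bind
    (by exact Computes.pure _)))))))))))))))))) ?_ ?_
  · simp [setupOf, smoothness]
    rfl
  · have := hS.r_le
    omega

theorem computes_svrgUpdate {S : SparseRows ℝ d} (lam : ℝ) (D : Setup ℝ S.r)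
    (x₀ g₀ x : Fin d → ℝ) (i : Fin S.r) :
    Computes (do
      let u ← vec fun j => minus (x j) (x₀ j)
      let s ← rowDot (S.row i) u
      let zero ← const 0
      let s' ← minus zero s
      let c ← times lam (D.p i)
      let v ← vec fun j => times c (u j)
      let dpsi ← axpyRow s' (S.row i) v
      let h ← divide D.eta (D.p i)
      vec fun j => do
        let t₁ ← times h (dpsi j)
        let t₂ ← times D.eta (g₀ j)
        let t₃ ← minus (x j) t₁
        minus t₃ t₂)
      (svrgUpdate S.toMatrix lam D.p D.eta x₀ g₀ x (some i))
      (6 * d + 4 * (S.row i).length + 5) := by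
  refine Computes.congr ((computes_vec_const (c := 1) fun j => computes_minus _ _).bind
    ((computes_rowDot _ _).bind
    ((computes_const _).bind ((computes_minus _ _).bind ((computes_times _ _).bind
    ((computes_vec_const (c := 1) fun j => computes_times _ _).bind ((computes_axpyRow _ _ _).bind
    ((computes_divide _ _).bind (computes_vec_const (c := 1 + (1 + (1 + 1))) fun j =>
    (computes_times _ _).bind ((computes_times _ _).bind ((computes_minus _ _).bind
    (computes_minus _ _)))))))))))) ?_ (by omega)
  ext j
  have : (fun j => x j - x₀ j) = x - x₀ := rfl
  simp only [svrgUpdate, this, SparseRows.toMatrix, Pi.sub_apply, Pi.smul_apply, Pi.add_apply,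
    smul_eq_mul, Rat.cast_zero]
  ring

theorem law_svrgStep (S : SparseRows ℝ d) (lam : ℝ) (D : Setup ℝ S.r) (x₀ g₀ x : Fin d → ℝ) :
    (svrgStep S lam D x₀ g₀ x).law =
      (weightedLaw D.table.weight).map (svrgUpdate S.toMatrix lam D.p D.eta x₀ g₀ x) := by
  rw [svrgStep, law_bind, law_drawIndex, PMF.map]
  congr 1
  funext o
  match o with
  | none => exact law_pure _
  | some i => exact (computes_svrgUpdate lam D x₀ g₀ x i).law

theorem costLE_svrgStep {S : SparseRows ℝ d} (hS : S.Proper) (lam : ℝ) (D : Setup ℝ S.r)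
    (x₀ g₀ x : Fin d → ℝ) : CostLE (svrgStep S lam D x₀ g₀ x) (10 * d + 6) := by
  refine ((costLE_drawIndex _).bind (c' := 10 * d + 5) fun o _ => ?_).mono (by omega)
  match o with
  | none => exact (CostLE.pure _).mono (by omega)
  | some i =>
    have := hS.length_le i
    exact (computes_svrgUpdate lam D x₀ g₀ x i).costLE.mono (by omega)

theorem law_svrgEpoch {S : SparseRows ℝ d} (hS : S.Proper) (lam lamHat : ℝ) (b x₀ : Fin d → ℝ) :
    (svrgEpoch S lam (setupOf S.toMatrix lam lamHat) b x₀).law =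
      epochKernel S.toMatrix lam (rowProb S.toMatrix) (setupOf S.toMatrix lam lamHat).eta
        (setupOf S.toMatrix lam lamHat).M b x₀ := by
  rw [svrgEpoch, (computes_applyShifted hS lam x₀).law_bind,
    (computes_vec_const (c := 1) fun j => computes_minus _ _).law_bind, law_bind, law_uniform,
    epochKernel]
  congr 1
  funext m
  rw [law_repeatTimes]
  congr 1
  funext x
  exact law_svrgStep _ _ _ _ _ _

/-- A common unit for the costs of the parts of the algorithm: the number of stored entries plus
`d` times the epoch length. -/
def costUnit (S : SparseRows ℝ d) (M : ℕ) : ℕ := S.size + d * M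

theorem costLE_svrgEpoch {S : SparseRows ℝ d} (hS : S.Proper) (hd : 1 ≤ d) (lam : ℝ)
    (D : Setup ℝ S.r) (hM : 1 ≤ D.M) (b x₀ : Fin d → ℝ) :
    CostLE (svrgEpoch S lam D b x₀) (21 * costUnit S D.M) := by
  refine ((computes_applyShifted hS lam x₀).costLE_bind
    ((computes_vec_const (c := 1) fun j => computes_minus _ _).costLE_bind
    ((costLE_uniform _).bind (c' := D.M * (16 * d)) fun m hm => ?_))).mono ?_
  -- The epoch length is random, but every value in the support is at most `M`; this makes the cost
  -- bound hold on every run.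
  · rw [law_uniform, PMF.mem_support_uniformOfFinset_iff, Finset.mem_Icc, max_eq_right hM] at hm
    refine (costLE_repeatTimes (fun x => costLE_svrgStep hS lam D x₀ _ x) m x₀).mono ?_
    exact Nat.mul_le_mul hm.2 (by omega)
  · have : d ≤ d * D.M := Nat.le_mul_of_pos_right d hM
    rw [costUnit, show D.M * (16 * d) = 16 * (d * D.M) by ring]
    omega

theorem law_solve {S : SparseRows ℝ d} (hS : S.Proper) (lam lamHat : ℝ) (K : ℕ) (x : Fin d → ℝ) :
    (solve S lam (setupOf S.toMatrix lam lamHat) K x).law =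
      solveKernel S.toMatrix lam (rowProb S.toMatrix) (setupOf S.toMatrix lam lamHat).eta
        (setupOf S.toMatrix lam lamHat).M K x := by
  have hz : (fun j => x j / (x ⬝ᵥ (shifted S.toMatrix lam *ᵥ x))) =
      (x ⬝ᵥ (shifted S.toMatrix lam *ᵥ x))⁻¹ • x := by
    ext j
    simp [div_eq_inv_mul]
  rw [solve, (computes_applyShifted hS lam x).law_bind, (computes_dot _ _).law_bind,
    (computes_vec_const (c := 1) fun j => computes_divide _ _).law_bind, law_repeatTimes,
    solveKernel, hz]
  congr 1
  funext x
  exact law_svrgEpoch hS _ _ _ _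

theorem costLE_solve {S : SparseRows ℝ d} (hS : S.Proper) (hd : 1 ≤ d) (lam : ℝ)
    (D : Setup ℝ S.r) (hM : 1 ≤ D.M) (K : ℕ) (x : Fin d → ℝ) :
    CostLE (solve S lam D K x) ((7 + 21 * K) * costUnit S D.M) := by
  refine ((computes_applyShifted hS lam x).costLE_bind ((computes_dot _ _).costLE_bind
    ((computes_vec_const (c := 1) fun j => computes_divide _ _).costLE_bind
    (costLE_repeatTimes (fun y => costLE_svrgEpoch hS hd lam D hM x y) K _)))).mono ?_
  have : d ≤ d * D.M := Nat.le_mul_of_pos_right d hM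
  have h : 6 * d + 1 + 5 * S.size ≤ 7 * costUnit S D.M := by
    rw [costUnit]; omega
  calc _ = 6 * d + 1 + 5 * S.size + K * (21 * costUnit S D.M) := by ring
    _ ≤ 7 * costUnit S D.M + K * (21 * costUnit S D.M) := by gcongr
    _ = _ := by ring

theorem law_burnInStep {S : SparseRows ℝ d} (hS : S.Proper) (lam lamHat : ℝ) (K : ℕ)
    (x : Fin d → ℝ) :
    (burnInStep S lam (setupOf S.toMatrix lam lamHat) K x).law =
      (solveKernel S.toMatrix lam (rowProb S.toMatrix) (setupOf S.toMatrix lam lamHat).eta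
        (setupOf S.toMatrix lam lamHat).M K x).map unitize := by
  rw [burnInStep, law_bind, law_solve hS, PMF.map]
  congr 1
  funext y
  exact (computes_toUnit y).law

theorem costLE_burnInStep {S : SparseRows ℝ d} (hS : S.Proper) (hd : 1 ≤ d) (lam : ℝ)
    (D : Setup ℝ S.r) (hM : 1 ≤ D.M) (K : ℕ) (x : Fin d → ℝ) :
    CostLE (burnInStep S lam D K x) ((12 + 21 * K) * costUnit S D.M) := by
  refine ((costLE_solve hS hd lam D hM K x).bind fun y _ => (computes_toUnit y).costLE).mono ?_
  have : d ≤ d * D.M := Nat.le_mul_of_pos_right d hM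
  have h : 3 * d + 2 ≤ 5 * costUnit S D.M := by
    rw [costUnit]; omega
  calc _ ≤ (7 + 21 * K) * costUnit S D.M + 5 * costUnit S D.M := by gcongr
    _ = _ := by ring

open scoped Classical in
theorem computes_warmUpdate {S : SparseRows ℝ d} (hS : S.Proper) (lam lamHat : ℝ)
    (x y : Fin d → ℝ) :
    Computes (do
      let mu ← minus lam lamHat
      let six ← const 6
      let t₁ ← divide mu six
      let t₂ ← minus lamHat t₁
      let q ← rayleigh S y
      let ok₁ ← isLeq t₂ q
      let s ← dot y y
      let nrm ← root s
      let twoThirds ← const (2 / 3)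
      let t₃ ← divide twoThirds mu
      let ok₂ ← isLeq t₃ nrm
      if ok₁ && ok₂ then toUnit y else return x)
      (warmUpdate S.toMatrix lam lamHat x y) (10 * d + 5 * S.size + 15) := by
  have hlast : ∀ b₁ b₂ : Bool, Computes (if b₁ && b₂ then toUnit y else pure x)
      (if b₁ && b₂ then unitize y else x) (3 * d + 2) := by
    intro b₁ b₂
    split_ifs
    · exact computes_toUnit y
    · exact (Computes.pure x).mono (Nat.zero_le _)
  refine Computes.congr ((computes_minus _ _).bind ((computes_const _).bind ((computes_divide _ _).bind
    ((computes_minus _ _).bind ((computes_rayleigh hS _).bind ((computes_isLeq _ _).bind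
    ((computes_dot _ _).bind ((computes_root _).bind ((computes_const _).bind
    ((computes_divide _ _).bind ((computes_isLeq _ _).bind
    (hlast _ _)))))))))))) ?_ (by omega)
  simp [warmUpdate, WarmTest]

theorem law_warmStep {S : SparseRows ℝ d} (hS : S.Proper) (lam lamHat : ℝ) (K : ℕ)
    (x : Fin d → ℝ) :
    (warmStep S lam lamHat (setupOf S.toMatrix lam lamHat) K x).law =
      (solveKernel S.toMatrix lam (rowProb S.toMatrix) (setupOf S.toMatrix lam lamHat).eta
        (setupOf S.toMatrix lam lamHat).M K x).map (warmUpdate S.toMatrix lam lamHat x) := by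
  rw [warmStep, law_bind, law_solve hS, PMF.map]
  congr 1
  funext y
  exact (computes_warmUpdate hS lam lamHat x y).law

theorem costLE_warmStep {S : SparseRows ℝ d} (hS : S.Proper) (hd : 1 ≤ d) (lam lamHat : ℝ)
    (D : Setup ℝ S.r) (hM : 1 ≤ D.M) (K : ℕ) (x : Fin d → ℝ) :
    CostLE (warmStep S lam lamHat D K x) ((32 + 21 * K) * costUnit S D.M) := by
  refine ((costLE_solve hS hd lam D hM K x).bind fun y _ =>
    (computes_warmUpdate hS lam lamHat x y).costLE).mono ?_
  have : d ≤ d * D.M := Nat.le_mul_of_pos_right d hM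
  have h : 10 * d + 5 * S.size + 15 ≤ 25 * costUnit S D.M := by
    rw [costUnit]; omega
  calc _ ≤ (7 + 21 * K) * costUnit S D.M + 25 * costUnit S D.M := by gcongr
    _ = _ := by ring

/-- The law of a burn-in iteration. -/
noncomputable def burnInKernel {r : ℕ} (A : Matrix (Fin r) (Fin d) ℝ) (lam lamHat : ℝ) (K : ℕ)
    (x : Fin d → ℝ) : PMF (Fin d → ℝ) :=
  (solveKernel A lam (rowProb A) (setupOf A lam lamHat).eta (setupOf A lam lamHat).M K x).map
    unitize

/-- The law of a warm-start iteration. -/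
noncomputable def warmKernel {r : ℕ} (A : Matrix (Fin r) (Fin d) ℝ) (lam lamHat : ℝ) (K : ℕ)
    (x : Fin d → ℝ) : PMF (Fin d → ℝ) :=
  (solveKernel A lam (rowProb A) (setupOf A lam lamHat).eta (setupOf A lam lamHat).M K x).map
    (warmUpdate A lam lamHat x)

theorem law_powerMethod {S : SparseRows ℝ d} (hS : S.Proper) (lam lamHat : ℝ)
    (T₁ K₁ T₂ K₂ : ℕ) (x₀ : Fin d → ℝ) :
    (powerMethod S lam lamHat T₁ K₁ T₂ K₂ x₀).law =
      (PMF.iter (burnInKernel S.toMatrix lam lamHat K₁) T₁ (unitize x₀)).bind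
        (PMF.iter (warmKernel S.toMatrix lam lamHat K₂) T₂) := by
  rw [powerMethod, (computes_setup hS lam lamHat).law_bind, (computes_toUnit x₀).law_bind,
    law_bind, law_repeatTimes]
  simp only [law_repeatTimes, law_burnInStep hS, law_warmStep hS]
  rfl

theorem costLE_powerMethod {S : SparseRows ℝ d} (hS : S.Proper) (hd : 1 ≤ d) (lam lamHat : ℝ)
    (hM : 1 ≤ (setupOf S.toMatrix lam lamHat).M) (T₁ K₁ T₂ K₂ : ℕ) (x₀ : Fin d → ℝ) :
    CostLE (powerMethod S lam lamHat T₁ K₁ T₂ K₂ x₀)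
      ((24 + T₁ * (12 + 21 * K₁) + T₂ * (32 + 21 * K₂)) *
        costUnit S (setupOf S.toMatrix lam lamHat).M) := by
  refine ((computes_setup hS lam lamHat).costLE_bind ((computes_toUnit x₀).costLE_bind
    ((costLE_repeatTimes (fun x => costLE_burnInStep hS hd lam _ hM K₁ x) T₁ _).bind fun y _ =>
    costLE_repeatTimes (fun x => costLE_warmStep hS hd lam lamHat _ hM K₂ x) T₂ y))).mono ?_
  have : d ≤ d * (setupOf S.toMatrix lam lamHat).M := Nat.le_mul_of_pos_right d hM
  have h : 6 * S.size + 14 + (3 * d + 2) ≤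
      24 * costUnit S (setupOf S.toMatrix lam lamHat).M := by
    rw [costUnit]; omega
  generalize costUnit S (setupOf S.toMatrix lam lamHat).M = Q at *
  calc _ = 6 * S.size + 14 + (3 * d + 2) +
      (T₁ * ((12 + 21 * K₁) * Q) + T₂ * ((32 + 21 * K₂) * Q)) := by ring
    _ ≤ 24 * Q + (T₁ * ((12 + 21 * K₁) * Q) + T₂ * ((32 + 21 * K₂) * Q)) := by gcongr
    _ = _ := by ring

end ShiftInvert

/-! ## Spectral facts -/

section Spectral

variable {n d : ℕ} (A : Matrix (Fin n) (Fin d) ℝ)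

theorem gram_symm (x y : Fin d → ℝ) :
    x ⬝ᵥ ((Aᵀ * A) *ᵥ y) = y ⬝ᵥ ((Aᵀ * A) *ᵥ x) := by
  rw [← mulVec_mulVec, ← mulVec_mulVec, dotProduct_mulVec, vecMul_transpose, dotProduct_mulVec y,
    vecMul_transpose, dotProduct_comm]

theorem gram_nonneg (x : Fin d → ℝ) : 0 ≤ x ⬝ᵥ ((Aᵀ * A) *ᵥ x) := by
  rw [← mulVec_mulVec, dotProduct_mulVec, vecMul_transpose]
  exact dotProduct_self_star_nonneg (A *ᵥ x)

/-- The spectral theorem in terms of `⬝ᵥ`, with orthonormality expressed through Parseval's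
identity. The permutation `e` gives the position of each basis vector in the decreasing list of
eigenvalues. -/
theorem exists_eigenbasis : ∃ (w : Fin d → Fin d → ℝ) (e : Fin d ≃ Fin d),
    (∀ x y, x ⬝ᵥ y = ∑ i, (w i ⬝ᵥ x) * (w i ⬝ᵥ y)) ∧ (∀ i, w i ⬝ᵥ w i = 1) ∧
    ∀ i, (Aᵀ * A) *ᵥ w i = eigval A (e i) • w i := by
  have hA := isHermitian_conjTranspose_mul_self A
  let b := hA.eigenvectorBasis
  let e₀ : Fin (Fintype.card (Fin d)) ≃ Fin d := Fintype.equivOfCardEq (Fintype.card_fin _)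
  refine ⟨fun i => (b i).ofLp, e₀.symm.trans (finCongr (Fintype.card_fin d)), ?_, ?_, ?_⟩
  · intro x y
    have h := b.sum_inner_mul_inner (WithLp.toLp 2 x) (WithLp.toLp 2 y)
    simp only [EuclideanSpace.inner_eq_star_dotProduct, star_trivial] at h
    rw [dotProduct_comm, ← h]
    refine Finset.sum_congr rfl fun i _ => ?_
    rw [dotProduct_comm y]
  · intro i
    have h := b.orthonormal.1 i
    have h' : inner ℝ (b i) (b i) = 1 := by rw [real_inner_self_eq_norm_sq, h]; norm_num
    simpa only [EuclideanSpace.inner_eq_star_dotProduct, star_trivial] using h'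
  · intro i
    have h := hA.mulVec_eigenvectorBasis i
    have hT : Aᵀ * A = Aᴴ * A := by rw [conjTranspose_eq_transpose_of_trivial]
    refine ((congrArg (fun M => M *ᵥ (b i).ofLp) hT).trans h).trans ?_
    congr 1
    rw [eigval, dif_pos (Fin.is_lt _)]
    rfl

theorem eigval_antitone {k l : ℕ} (hkl : k ≤ l) (hl : l < d) : eigval A l ≤ eigval A k := by
  rw [eigval, eigval, dif_pos hl, dif_pos (hkl.trans_lt hl)]
  exact (isHermitian_conjTranspose_mul_self A).eigenvalues₀_antitone hkl

/-- Both sides are the trace of `Aᵀ A`: expand every row of `A` in the eigenbasis and exchange the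
two sums. -/
theorem sum_eigval : ∑ k : Fin d, eigval A k = ShiftInvert.frobSq A := by
  obtain ⟨w, e, h₁, h₂, h₃⟩ := exists_eigenbasis A
  have h : ShiftInvert.frobSq A = ∑ i, w i ⬝ᵥ ((Aᵀ * A) *ᵥ w i) := by
    simp only [ShiftInvert.frobSq, h₁ (A _) (A _)]
    rw [Finset.sum_comm]
    refine Finset.sum_congr rfl fun i _ => ?_
    rw [← mulVec_mulVec, dotProduct_mulVec, vecMul_transpose]
    simp [dotProduct, mulVec, mul_comm]
  rw [h, ← e.sum_comp]
  refine Finset.sum_congr rfl fun i _ => ?_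
  rw [h₃, dotProduct_smul, h₂]
  simp

theorem eigval_nonneg (k : ℕ) : 0 ≤ eigval A k := by
  by_cases hk : k < d
  · obtain ⟨w, e, h₁, h₂, h₃⟩ := exists_eigenbasis A
    have h := gram_nonneg A (w (e.symm ⟨k, hk⟩))
    rw [h₃, dotProduct_smul, h₂] at h
    simpa using h
  · rw [eigval, dif_neg hk]

/-- Take the basis vector in position `0`. A vector orthogonal to it expands in the remaining basis
vectors, whose eigenvalues are at most the second one. -/
theorem exists_top_eigenvector (hd : 2 ≤ d) : ∃ v : Fin d → ℝ, v ⬝ᵥ v = 1 ∧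
    (Aᵀ * A) *ᵥ v = eigval A 0 • v ∧
    ∀ u, u ⬝ᵥ v = 0 → u ⬝ᵥ ((Aᵀ * A) *ᵥ u) ≤ eigval A 1 * (u ⬝ᵥ u) := by
  obtain ⟨w, e, h₁, h₂, h₃⟩ := exists_eigenbasis A
  refine ⟨w (e.symm ⟨0, by omega⟩), h₂ _, by simp [h₃], fun u hu => ?_⟩
  rw [h₁ u u, h₁ u, Finset.mul_sum]
  refine Finset.sum_le_sum fun i _ => ?_
  have h : w i ⬝ᵥ ((Aᵀ * A) *ᵥ u) = eigval A (e i) * (w i ⬝ᵥ u) := by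
    rw [gram_symm, h₃, dotProduct_smul, dotProduct_comm, smul_eq_mul]
  rw [h]
  by_cases hi : i = e.symm ⟨0, by omega⟩
  · rw [← hi, dotProduct_comm] at hu
    simp [hu]
  · have h₀ : (e i : ℕ) ≠ 0 := fun h0 => hi (by
      rw [Equiv.eq_symm_apply]; exact Fin.ext h0)
    have := eigval_antitone A (Nat.one_le_iff_ne_zero.2 h₀) (e i).2
    nlinarith [mul_self_nonneg (w i ⬝ᵥ u)]

end Spectral

/-! ## Positive definite forms with an isolated smallest eigenvalue -/

/-- `B` is a symmetric matrix with unit eigenvector `v` of eigenvalue `δ > 0`, and all its other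
eigenvalues are at least `101 δ`. -/
structure IsolatedBottom {d : ℕ} (B : Matrix (Fin d) (Fin d) ℝ) (v : Fin d → ℝ) (δ : ℝ) :
    Prop where
  symm : ∀ x y, x ⬝ᵥ (B *ᵥ y) = y ⬝ᵥ (B *ᵥ x)
  unit : v ⬝ᵥ v = 1
  eig : B *ᵥ v = δ • v
  pos : 0 < δ
  gap : ∀ u, u ⬝ᵥ v = 0 → 101 * δ * (u ⬝ᵥ u) ≤ u ⬝ᵥ (B *ᵥ u)

/-- The quadratic form of a matrix. -/
def qform {d : ℕ} (B : Matrix (Fin d) (Fin d) ℝ) (x : Fin d → ℝ) : ℝ := x ⬝ᵥ (B *ᵥ x)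

/-- The component of `x` orthogonal to the unit vector `v`. -/
def perp {d : ℕ} (v x : Fin d → ℝ) : Fin d → ℝ := x - (v ⬝ᵥ x) • v

theorem dotProduct_self_nonneg' {d : ℕ} (x : Fin d → ℝ) : 0 ≤ x ⬝ᵥ x :=
  Finset.sum_nonneg fun i _ => mul_self_nonneg (x i)

theorem dotProduct_self_eq_zero' {d : ℕ} {x : Fin d → ℝ} (h : x ⬝ᵥ x = 0) : x = 0 :=
  dotProduct_self_eq_zero.1 h

theorem dotProduct_sq_le {d : ℕ} (x y : Fin d → ℝ) : (x ⬝ᵥ y) ^ 2 ≤ (x ⬝ᵥ x) * (y ⬝ᵥ y) := by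
  have := Finset.sum_mul_sq_le_sq_mul_sq Finset.univ x y
  simpa [dotProduct, sq] using this

theorem perp_add {d : ℕ} (v x y : Fin d → ℝ) : perp v (x + y) = perp v x + perp v y := by
  simp only [perp, dotProduct_add, add_smul]
  abel

theorem perp_smul {d : ℕ} (v x : Fin d → ℝ) (c : ℝ) : perp v (c • x) = c • perp v x := by
  simp only [perp, dotProduct_smul, smul_sub, smul_eq_mul, mul_smul]

theorem qform_smul {d : ℕ} (B : Matrix (Fin d) (Fin d) ℝ) (c : ℝ) (x : Fin d → ℝ) :
    qform B (c • x) = c ^ 2 * qform B x := by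
  simp only [qform, mulVec_smul, dotProduct_smul, smul_dotProduct, smul_eq_mul]
  ring

namespace IsolatedBottom

variable {d : ℕ} {B : Matrix (Fin d) (Fin d) ℝ} {v : Fin d → ℝ} {δ : ℝ}

theorem perp_dotProduct (h : IsolatedBottom B v δ) (x : Fin d → ℝ) : perp v x ⬝ᵥ v = 0 := by
  simp [perp, h.unit, dotProduct_comm]

theorem qform_add (h : IsolatedBottom B v δ) (x y : Fin d → ℝ) :
    qform B (x + y) = qform B x + 2 * (x ⬝ᵥ (B *ᵥ y)) + qform B y := by
  simp only [qform, mulVec_add, dotProduct_add, add_dotProduct, h.symm y x]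
  ring

theorem qform_sub (h : IsolatedBottom B v δ) (x y : Fin d → ℝ) :
    qform B (x - y) = qform B x - 2 * (x ⬝ᵥ (B *ᵥ y)) + qform B y := by
  simp only [qform, mulVec_sub, dotProduct_sub, sub_dotProduct, h.symm y x]
  ring

theorem dotProduct_self (h : IsolatedBottom B v δ) (x : Fin d → ℝ) :
    x ⬝ᵥ x = (v ⬝ᵥ x) ^ 2 + perp v x ⬝ᵥ perp v x := by
  simp only [perp, dotProduct_sub, sub_dotProduct, dotProduct_smul, smul_dotProduct, h.unit,
    dotProduct_comm x v, smul_eq_mul]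
  ring

theorem qform_eq (h : IsolatedBottom B v δ) (x : Fin d → ℝ) :
    qform B x = δ * (v ⬝ᵥ x) ^ 2 + qform B (perp v x) := by
  simp only [perp, h.qform_sub, qform_smul, mulVec_smul, h.eig, dotProduct_smul, smul_eq_mul,
    dotProduct_comm x v]
  simp only [qform, h.eig, dotProduct_smul, h.unit, smul_eq_mul]
  ring

theorem qform_perp_ge (h : IsolatedBottom B v δ) (x : Fin d → ℝ) :
    101 * δ * (perp v x ⬝ᵥ perp v x) ≤ qform B (perp v x) :=
  h.gap _ (h.perp_dotProduct x)

theorem qform_perp_nonneg (h : IsolatedBottom B v δ) (x : Fin d → ℝ) :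
    0 ≤ qform B (perp v x) := by
  have := h.qform_perp_ge x
  have h₁ := h.pos
  have h₂ := dotProduct_self_nonneg' (perp v x)
  exact le_trans (by positivity) this

theorem qform_ge (h : IsolatedBottom B v δ) (x : Fin d → ℝ) : δ * (x ⬝ᵥ x) ≤ qform B x := by
  rw [h.qform_eq, h.dotProduct_self]
  nlinarith [h.qform_perp_ge x, h.pos, mul_nonneg h.pos.le (dotProduct_self_nonneg' (perp v x))]

theorem qform_nonneg (h : IsolatedBottom B v δ) (x : Fin d → ℝ) : 0 ≤ qform B x :=
  (mul_nonneg h.pos.le (dotProduct_self_nonneg' x)).trans (h.qform_ge x)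

theorem qform_add_le (h : IsolatedBottom B v δ) (x y : Fin d → ℝ) :
    qform B (x + y) ≤ 2 * qform B x + 2 * qform B y := by
  have h₁ := h.qform_nonneg (x - y)
  rw [h.qform_sub] at h₁
  rw [h.qform_add]
  linarith

theorem exists_solution (h : IsolatedBottom B v δ) (x : Fin d → ℝ) : ∃ w, B *ᵥ w = x := by
  have hinj : Function.Injective B.mulVec := by
    intro a b hab
    have h₁ : B *ᵥ (a - b) = 0 := by rw [mulVec_sub, hab, sub_self]
    have h₂ := h.qform_ge (a - b)
    rw [qform, h₁, dotProduct_zero] at h₂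
    have h₃ := dotProduct_self_nonneg' (a - b)
    have h₄ : (a - b) ⬝ᵥ (a - b) = 0 := by nlinarith [h.pos]
    exact sub_eq_zero.1 (dotProduct_self_eq_zero' h₄)
  have hu : IsUnit B := mulVec_injective_iff_isUnit.1 hinj
  exact mulVec_surjective_iff_isUnit.2 hu x

/-- Facts on the solution `w` of `B w = x`. -/
theorem dotProduct_solution (h : IsolatedBottom B v δ) {w x : Fin d → ℝ} (hw : B *ᵥ w = x) :
    δ * (v ⬝ᵥ w) = v ⬝ᵥ x := by
  rw [← hw, h.symm, h.eig, dotProduct_smul, dotProduct_comm, smul_eq_mul]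

theorem mulVec_perp (h : IsolatedBottom B v δ) {w x : Fin d → ℝ} (hw : B *ᵥ w = x) :
    B *ᵥ perp v w = perp v x := by
  rw [perp, mulVec_sub, hw, mulVec_smul, h.eig, perp, ← h.dotProduct_solution hw, smul_smul,
    mul_comm]

/-- With `w' = perp v w` and `x' = perp v x` one has `q = w'ᵀ B w' = w'ᵀ x'`. Cauchy–Schwarz and
`101 δ |w'|² ≤ q` give `101 δ q² ≤ q |x'|²`, and a factor `q` cancels unless it vanishes. -/
theorem qform_perp_solution_le (h : IsolatedBottom B v δ) {w x : Fin d → ℝ} (hw : B *ᵥ w = x) :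
    101 * δ * qform B (perp v w) ≤ perp v x ⬝ᵥ perp v x := by
  have h₁ : qform B (perp v w) = perp v w ⬝ᵥ perp v x := by rw [qform, h.mulVec_perp hw]
  have h₂ := h.qform_perp_ge w
  have h₃ := dotProduct_sq_le (perp v w) (perp v x)
  rw [← h₁] at h₃
  have h₄ := h.qform_perp_nonneg w
  rcases h₄.eq_or_lt with h₅ | h₅
  · rw [← h₅, mul_zero]
    exact dotProduct_self_nonneg' _
  · have h₆ := mul_le_mul_of_nonneg_right h₂ (dotProduct_self_nonneg' (perp v x))
    have h₇ : qform B (perp v w) * (101 * δ * qform B (perp v w)) ≤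
        qform B (perp v w) * (perp v x ⬝ᵥ perp v x) := by
      nlinarith [h.pos]
    exact le_of_mul_le_mul_left h₇ h₅

/-- The gain of an exact inverse iteration: the orthogonal energy shrinks by `(101 δ)²`, whereas the
squared component along `v` is only divided by `δ²`. -/
theorem sq_qform_perp_solution_le (h : IsolatedBottom B v δ) {w x : Fin d → ℝ}
    (hw : B *ᵥ w = x) : (101 * δ) ^ 2 * qform B (perp v w) ≤ qform B (perp v x) := by
  nlinarith [h.qform_perp_solution_le hw, h.qform_perp_ge x, h.pos]

/-- The error of the best multiple of `x` as an approximate solution of `B w = x`. -/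
theorem qform_init_sub_le (h : IsolatedBottom B v δ) {w x : Fin d → ℝ} (hw : B *ᵥ w = x)
    (hx : x ⬝ᵥ x = 1) : qform B ((x ⬝ᵥ (B *ᵥ x))⁻¹ • x - w) ≤ qform B (perp v x) / δ ^ 2 := by
  have hq : 0 < qform B x := by
    have := h.qform_ge x
    rw [hx] at this
    linarith [h.pos]
  have h₁ : ∀ c : ℝ, qform B (c • x - w) = c ^ 2 * qform B x - 2 * c + qform B w := by
    intro c
    rw [h.qform_sub, qform_smul, hw, smul_dotProduct, hx, smul_eq_mul]
    ring
  -- The error of `c • x` is a quadratic polynomial in `c` minimised at `1 / qform B x`. It is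
  -- compared with `c = 1/δ`, for which the error has no component along `v`.
  have h₂ : qform B ((x ⬝ᵥ (B *ᵥ x))⁻¹ • x - w) ≤ qform B (δ⁻¹ • x - w) := by
    have hqx : x ⬝ᵥ (B *ᵥ x) = qform B x := rfl
    rw [h₁, h₁, hqx]
    have hi : (qform B x)⁻¹ * qform B x = 1 := inv_mul_cancel₀ hq.ne'
    have h₃ := mul_nonneg hq.le (sq_nonneg (δ⁻¹ - (qform B x)⁻¹))
    have h₄ : qform B x * (δ⁻¹ - (qform B x)⁻¹) ^ 2 = δ⁻¹ ^ 2 * qform B x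
      - 2 * δ⁻¹ * ((qform B x)⁻¹ * qform B x) + (qform B x)⁻¹ ^ 2 * qform B x := by ring
    have h₅ : (qform B x)⁻¹ ^ 2 * qform B x = (qform B x)⁻¹ := by rw [sq, mul_assoc, hi, mul_one]
    rw [h₄, hi] at h₃
    linarith
  refine h₂.trans ?_
  have h₃ : v ⬝ᵥ (δ⁻¹ • x - w) = 0 := by
    rw [dotProduct_sub, dotProduct_smul, ← h.dotProduct_solution hw, smul_eq_mul,
      inv_mul_cancel_left₀ h.pos.ne', sub_self]
  have h₄ : perp v (δ⁻¹ • x - w) = δ⁻¹ • perp v x - perp v w := by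
    rw [sub_eq_add_neg, ← neg_one_smul ℝ w, perp_add, perp_smul, perp_smul, neg_one_smul,
      ← sub_eq_add_neg]
  rw [h.qform_eq, h₃, h₄, h.qform_sub, qform_smul, h.mulVec_perp hw, smul_dotProduct, smul_eq_mul]
  have h₅ := h.qform_perp_solution_le hw
  -- The cross term contributes `-2 δ⁻¹ |perp v x|²`, so this bound makes everything except `δ⁻²
  -- qform B (perp v x)` non-positive.
  have h₆ : qform B (perp v w) ≤ δ⁻¹ * (perp v x ⬝ᵥ perp v x) := by
    rw [inv_mul_eq_div, le_div_iff₀ h.pos]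
    nlinarith [mul_nonneg h.pos.le (h.qform_perp_nonneg w)]
  have h₇ : 0 ≤ δ⁻¹ * (perp v x ⬝ᵥ perp v x) :=
    mul_nonneg (inv_nonneg.2 h.pos.le) (dotProduct_self_nonneg' _)
  rw [div_eq_inv_mul, ← inv_pow]
  linarith

end IsolatedBottom

/-! ## Stochastic variance reduced gradient steps -/

namespace PMF

open scoped ENNReal

/-- Telescoping: each step spends `ψ` out of the potential `φ` and receives at most `c`. The
inequality is additive on both sides because `ℝ≥0∞` has only truncated subtraction. -/
theorem sum_expect_iter_le {α : Type} {κ : α → PMF α} {φ ψ : α → ℝ≥0∞} {c : ℝ≥0∞}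
    (h : ∀ a, (κ a).expect φ + ψ a ≤ φ a + c) (k : ℕ) :
    ∀ a, ∑ j ∈ Finset.range k, (iter κ j a).expect ψ ≤ φ a + k * c := by
  induction k with
  | zero => intro a; simp
  | succ k ih =>
    intro a
    rw [Finset.sum_range_succ']
    simp only [iter, expect_bind, expect_pure]
    rw [← expect_finset_sum]
    calc _ ≤ (κ a).expect (fun b => φ b + k * c) + ψ a := by
          gcongr
          exact expect_mono ih
      _ = ((κ a).expect φ + ψ a) + k * c := by rw [expect_add, expect_const]; ring
      _ ≤ (φ a + c) + k * c := add_le_add (h a) le_rfl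
      _ = _ := by push_cast; ring

/-- An epoch returns one of the iterates `1, …, M`, never the iterate `0`. Telescoping therefore
starts after the first step, which leaves the expectation of `φ` after that step. -/
theorem sum_Icc_expect_iter_le {α : Type} {κ : α → PMF α} {φ ψ : α → ℝ≥0∞} {c : ℝ≥0∞}
    (h : ∀ a, (κ a).expect φ + ψ a ≤ φ a + c) (k : ℕ) (a : α) :
    ∑ j ∈ Finset.Icc 1 k, (iter κ j a).expect ψ ≤ (κ a).expect φ + k * c := by
  have h₁ : ∑ j ∈ Finset.Icc 1 k, (iter κ j a).expect ψ =
      ∑ j ∈ Finset.range k, (iter κ (j + 1) a).expect ψ := by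
    rw [Finset.range_eq_Ico, Finset.sum_Ico_add' (fun j => (iter κ j a).expect ψ) 0 k 1]
    rfl
  rw [h₁]
  simp only [iter, expect_bind]
  rw [← expect_finset_sum]
  refine (expect_mono (sum_expect_iter_le h k)).trans ?_
  rw [expect_add, expect_const]

theorem mul_expect_uniformOfFinset {α : Type} {s : Finset α} (hs : s.Nonempty) (g : α → ℝ≥0∞) :
    (s.card : ℝ≥0∞) * (PMF.uniformOfFinset s hs).expect g = ∑ a ∈ s, g a := by
  rw [expect, ← ENNReal.tsum_mul_left, tsum_eq_sum (s := s)]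
  · refine Finset.sum_congr rfl fun a ha => ?_
    rw [PMF.uniformOfFinset_apply_of_mem hs ha, ← mul_assoc, ENNReal.mul_inv_cancel, one_mul]
    · exact_mod_cast hs.card_pos.ne'
    · exact ENNReal.natCast_ne_top _
  · intro a ha
    rw [PMF.uniformOfFinset_apply_of_notMem hs ha]
    simp

end PMF

open ShiftInvert

/-- The assumptions on the rows and on the parameters, with `δ = lam - λ₁`. -/
structure Admissible {r d : ℕ} (A : Matrix (Fin r) (Fin d) ℝ) (lam lamHat : ℝ) (v : Fin d → ℝ)
    (δ : ℝ) : Prop where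
  bottom : IsolatedBottom (shifted A lam) v δ
  row_pos : ∀ i, 0 < A i ⬝ᵥ A i
  delta_le : 100 * δ ≤ lam - δ
  le_frobSq : lam - δ ≤ frobSq A
  mu_le : lam - lamHat ≤ δ
  le_mu : 10 / 11 * δ ≤ lam - lamHat

theorem qform_shifted {r d : ℕ} (A : Matrix (Fin r) (Fin d) ℝ) (lam : ℝ) (u : Fin d → ℝ) :
    qform (shifted A lam) u = lam * (u ⬝ᵥ u) - u ⬝ᵥ ((Aᵀ * A) *ᵥ u) := by
  simp [qform, shifted, sub_mulVec, smul_mulVec, dotProduct_sub]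

theorem dotProduct_gram {r d : ℕ} (A : Matrix (Fin r) (Fin d) ℝ) (u : Fin d → ℝ) :
    u ⬝ᵥ ((Aᵀ * A) *ᵥ u) = ∑ i, (A i ⬝ᵥ u) ^ 2 := by
  rw [gram_mulVec, dotProduct_sum]
  refine Finset.sum_congr rfl fun i _ => ?_
  rw [dotProduct_smul, dotProduct_comm u, sq, smul_eq_mul]

/-- `1 / pᵢ` times the gradient of the quadratic part of the `i`-th summand. -/
noncomputable def rowGrad {r d : ℕ} (A : Matrix (Fin r) (Fin d) ℝ) (lam : ℝ) (i : Fin r)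
    (u : Fin d → ℝ) : Fin d → ℝ :=
  lam • u - ((A i ⬝ᵥ u) / rowProb A i) • A i

theorem rowGrad_sub {r d : ℕ} (A : Matrix (Fin r) (Fin d) ℝ) (lam : ℝ) (i : Fin r)
    (u w : Fin d → ℝ) : rowGrad A lam i (u - w) = rowGrad A lam i u - rowGrad A lam i w := by
  simp only [rowGrad, dotProduct_sub, sub_div, sub_smul, smul_sub]
  abel

namespace Admissible

variable {r d : ℕ} {A : Matrix (Fin r) (Fin d) ℝ} {lam lamHat : ℝ} {v : Fin d → ℝ} {δ : ℝ}

theorem mu_pos (h : Admissible A lam lamHat v δ) : 0 < lam - lamHat := by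
  linarith [h.le_mu, h.bottom.pos]

theorem frobSq_pos (h : Admissible A lam lamHat v δ) : 0 < frobSq A := by
  linarith [h.delta_le, h.bottom.pos, h.le_frobSq]

theorem rowProb_pos (h : Admissible A lam lamHat v δ) (i : Fin r) : 0 < rowProb A i :=
  div_pos (h.row_pos i) h.frobSq_pos

theorem sum_rowProb (h : Admissible A lam lamHat v δ) : ∑ i, rowProb A i = 1 := by
  simp only [rowProb, ← Finset.sum_div]
  exact div_self h.frobSq_pos.ne'

/-- Removes the estimate from the bounds: `lam - lamHat ≤ δ` means `lamHat ≥ λ₁`, so replacing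
`lamHat` by `λ₁ = lam - δ` and the denominator by `δ` can only decrease the smoothness parameter. -/
theorem le_smoothness (h : Admissible A lam lamHat v δ) :
    2 * (lam - δ) * frobSq A ≤ smoothness A lam lamHat * δ := by
  have h₁ := h.mu_pos
  have h₂ := h.frobSq_pos
  have h₃ := h.delta_le
  have h₄ := h.bottom.pos
  have h₅ := h.mu_le
  rw [smoothness, div_mul_eq_mul_div, le_div_iff₀ h₁]
  have h₆ : (lam - δ) * (lam - lamHat) ≤ lamHat * δ := by nlinarith
  nlinarith

theorem smoothness_pos (h : Admissible A lam lamHat v δ) : 0 < smoothness A lam lamHat := by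
  have h₁ := h.le_smoothness
  have h₂ := h.frobSq_pos
  have h₃ := h.delta_le
  have h₄ := h.bottom.pos
  have h₅ : 0 < 2 * (lam - δ) * frobSq A := by
    have : 0 < lam - δ := by linarith
    positivity
  exact pos_of_mul_pos_left (h₅.trans_le h₁) h₄.le

/-- The row gradients average to the gradient. -/
theorem sum_rowGrad (h : Admissible A lam lamHat v δ) (u : Fin d → ℝ) :
    ∑ i, rowProb A i • rowGrad A lam i u = shifted A lam *ᵥ u := by
  have h₁ : ∀ i, rowProb A i • rowGrad A lam i u =
      rowProb A i • (lam • u) - (A i ⬝ᵥ u) • A i := fun i => by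
    rw [rowGrad, smul_sub, smul_smul (rowProb A i) (_ / _), mul_div_cancel₀ _ (h.rowProb_pos i).ne']
  simp only [h₁, Finset.sum_sub_distrib, ← Finset.sum_smul, h.sum_rowProb, ← gram_mulVec]
  simp [shifted, sub_mulVec, smul_mulVec]

/-- The second moment of the row gradients. -/
theorem sum_rowGrad_sq_le (h : Admissible A lam lamHat v δ) (u : Fin d → ℝ) :
    ∑ i, rowProb A i * (rowGrad A lam i u ⬝ᵥ rowGrad A lam i u) ≤
      smoothness A lam lamHat * qform (shifted A lam) u := by
  -- Expansion of the square; importance sampling enters through `‖aᵢ‖² = pᵢ ‖A‖_F²`, which makes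
  -- the coefficient of `(aᵢᵀu)²` independent of `i`.
  have h₁ : ∀ i, rowProb A i * (rowGrad A lam i u ⬝ᵥ rowGrad A lam i u) =
      rowProb A i * (lam ^ 2 * (u ⬝ᵥ u)) + (frobSq A - 2 * lam) * (A i ⬝ᵥ u) ^ 2 := fun i => by
    have hp := (h.rowProb_pos i).ne'
    have hpi : A i ⬝ᵥ A i = rowProb A i * frobSq A := by
      rw [rowProb, div_mul_cancel₀ _ h.frobSq_pos.ne']
    simp only [rowGrad, dotProduct_sub, sub_dotProduct, dotProduct_smul, smul_dotProduct,
      smul_eq_mul, dotProduct_comm u (A i), hpi]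
    field_simp
    ring
  simp only [h₁, Finset.sum_add_distrib, ← Finset.sum_mul, ← Finset.mul_sum, h.sum_rowProb,
    ← dotProduct_gram]
  have h₂ := h.bottom.qform_ge u
  rw [qform_shifted] at h₂ ⊢
  have h₃ := gram_nonneg A u
  have h₄ := h.le_smoothness
  have h₅ := h.smoothness_pos
  have h₆ := h.bottom.pos
  have h₇ := h.delta_le
  have h₈ := h.le_frobSq
  have h₉ := h.frobSq_pos
  have h₀ := dotProduct_self_nonneg' u
  generalize u ⬝ᵥ ((Aᵀ * A) *ᵥ u) = s at *
  generalize u ⬝ᵥ u = a at *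
  generalize smoothness A lam lamHat = S at *
  generalize frobSq A = F at *
  have hl : 0 < lam - δ := by linarith
  -- the claim is linear in `s ∈ [0, (lam - δ) a]`
  have e₁ : lam ≤ S := by
    have : lam * δ ≤ S * δ := by nlinarith
    exact le_of_mul_le_mul_right this h₆
  have e₂ : lam ^ 2 + (F - 2 * lam) * (lam - δ) ≤ S * δ := by nlinarith
  have e₃ : s ≤ (lam - δ) * a := by linarith
  -- Interpolation between the two endpoints: `e₁` settles `s = 0` and `e₂` settles `s = (lam - δ)
  -- a`.
  have e₄ : (lam - δ) * (1 * (lam ^ 2 * a) + (F - 2 * lam) * s - S * (lam * a - s)) =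
      ((lam - δ) * a - s) * (lam * (lam - S)) +
        s * (lam ^ 2 + (F - 2 * lam) * (lam - δ) - S * δ) := by ring
  have e₅ : (lam - δ) * (1 * (lam ^ 2 * a) + (F - 2 * lam) * s - S * (lam * a - s)) ≤ 0 := by
    rw [e₄]
    have t₁ : ((lam - δ) * a - s) * (lam * (lam - S)) ≤ 0 :=
      mul_nonpos_of_nonneg_of_nonpos (by linarith)
        (mul_nonpos_of_nonneg_of_nonpos (by linarith) (by linarith))
    have t₂ : s * (lam ^ 2 + (F - 2 * lam) * (lam - δ) - S * δ) ≤ 0 :=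
      mul_nonpos_of_nonneg_of_nonpos h₃ (by linarith)
    linarith
  have := nonpos_of_mul_nonpos_right e₅ hl
  linarith

/-- Centred at the solution the right-hand side drops out. The step becomes a row gradient at `x -
w`, corrected by a control variate of mean zero built from `x₀ - w`. -/
theorem svrgUpdate_sub (h : Admissible A lam lamHat v δ) {w b : Fin d → ℝ}
    (hw : shifted A lam *ᵥ w = b) (eta : ℝ) (x₀ x : Fin d → ℝ) (i : Fin r) :
    svrgUpdate A lam (rowProb A) eta x₀ (shifted A lam *ᵥ x₀ - b) x (some i) - w =
      (x - w) - eta • (rowGrad A lam i (x - w) -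
        (rowGrad A lam i (x₀ - w) - shifted A lam *ᵥ (x₀ - w))) := by
  have h₁ : (eta / rowProb A i) • ((lam * rowProb A i) • (x - x₀) - (A i ⬝ᵥ (x - x₀)) • A i) =
      eta • (rowGrad A lam i (x - w) - rowGrad A lam i (x₀ - w)) := by
    have hp := (h.rowProb_pos i).ne'
    rw [← rowGrad_sub, sub_sub_sub_cancel_right, rowGrad]
    generalize x - x₀ = u
    generalize A i ⬝ᵥ u = s
    ext j
    simp only [Pi.smul_apply, Pi.sub_apply, smul_eq_mul]
    field_simp
  rw [svrgUpdate, h₁, mulVec_sub, hw]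
  simp only [smul_sub]
  abel

/-- One step decreases the squared distance to the solution `w`. -/
theorem svrg_step_le (h : Admissible A lam lamHat v δ) {w b : Fin d → ℝ}
    (hw : shifted A lam *ᵥ w = b) (x₀ x : Fin d → ℝ) {eta : ℝ}
    (heta : eta = 1 / (8 * smoothness A lam lamHat)) (y : Fin r → Fin d → ℝ)
    (hy : ∀ i, y i = svrgUpdate A lam (rowProb A) eta x₀ (shifted A lam *ᵥ x₀ - b) x (some i)) :
    ∑ i, rowProb A i * ((y i - w) ⬝ᵥ (y i - w)) +
        7 / 4 * eta * qform (shifted A lam) (x - w) ≤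
      (x - w) ⬝ᵥ (x - w) + eta / 4 * qform (shifted A lam) (x₀ - w) := by
  set B := shifted A lam with hB
  set u := x - w with hu
  set u₀ := x₀ - w with hu₀
  have hS := h.smoothness_pos
  have hy' : ∀ i, (y i - w) ⬝ᵥ (y i - w) ≤ u ⬝ᵥ u
      - 2 * eta * (u ⬝ᵥ (rowGrad A lam i u - rowGrad A lam i u₀ + B *ᵥ u₀))
      + eta ^ 2 * (2 * (rowGrad A lam i u ⬝ᵥ rowGrad A lam i u) +
        2 * (rowGrad A lam i u₀ ⬝ᵥ rowGrad A lam i u₀ - 2 * (rowGrad A lam i u₀ ⬝ᵥ B *ᵥ u₀)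
          + (B *ᵥ u₀) ⬝ᵥ (B *ᵥ u₀))) := fun i => by
    rw [hy, h.svrgUpdate_sub hw, ← hu, ← hu₀, ← hB]
    -- Non-negativity of `|p + q|²` is `|p - q|² ≤ 2|p|² + 2|q|²`, used to separate the row gradient
    -- from the control variate.
    have hsq := dotProduct_self_nonneg'
      (rowGrad A lam i u + (rowGrad A lam i u₀ - B *ᵥ u₀))
    simp only [dotProduct_sub, sub_dotProduct, dotProduct_smul, smul_dotProduct, dotProduct_add,
      add_dotProduct, smul_eq_mul, dotProduct_comm _ u, dotProduct_comm (B *ᵥ u₀) (rowGrad _ _ _ _),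
      dotProduct_comm (rowGrad A lam i u₀) (rowGrad A lam i u)] at hsq ⊢
    nlinarith [mul_le_mul_of_nonneg_left hsq (sq_nonneg eta)]
  have hcross : ∀ z c : Fin d → ℝ, ∑ i, rowProb A i * (c ⬝ᵥ rowGrad A lam i z) = c ⬝ᵥ (B *ᵥ z) := by
    intro z c
    rw [hB, ← h.sum_rowGrad, dotProduct_sum]
    simp only [dotProduct_smul, smul_eq_mul]
  have hsum : ∑ i, rowProb A i * ((y i - w) ⬝ᵥ (y i - w)) ≤ u ⬝ᵥ u - 2 * eta * qform B u
      + eta ^ 2 * (2 * ∑ i, rowProb A i * (rowGrad A lam i u ⬝ᵥ rowGrad A lam i u) +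
        2 * ∑ i, rowProb A i * (rowGrad A lam i u₀ ⬝ᵥ rowGrad A lam i u₀)) := by
    calc _ ≤ ∑ i, rowProb A i * (u ⬝ᵥ u
          - 2 * eta * (u ⬝ᵥ (rowGrad A lam i u - rowGrad A lam i u₀ + B *ᵥ u₀))
          + eta ^ 2 * (2 * (rowGrad A lam i u ⬝ᵥ rowGrad A lam i u) +
          2 * (rowGrad A lam i u₀ ⬝ᵥ rowGrad A lam i u₀ - 2 * (rowGrad A lam i u₀ ⬝ᵥ B *ᵥ u₀)
          + (B *ᵥ u₀) ⬝ᵥ (B *ᵥ u₀)))) :=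
          Finset.sum_le_sum fun i _ => mul_le_mul_of_nonneg_left (hy' i) (h.rowProb_pos i).le
      _ = ∑ i, (rowProb A i * (u ⬝ᵥ u - 2 * eta * (u ⬝ᵥ B *ᵥ u₀) +
            2 * eta ^ 2 * ((B *ᵥ u₀) ⬝ᵥ (B *ᵥ u₀)))
          - 2 * eta * (rowProb A i * (u ⬝ᵥ rowGrad A lam i u))
          + 2 * eta * (rowProb A i * (u ⬝ᵥ rowGrad A lam i u₀))
          + 2 * eta ^ 2 * (rowProb A i * (rowGrad A lam i u ⬝ᵥ rowGrad A lam i u))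
          + 2 * eta ^ 2 * (rowProb A i * (rowGrad A lam i u₀ ⬝ᵥ rowGrad A lam i u₀))
          - 4 * eta ^ 2 * (rowProb A i * ((B *ᵥ u₀) ⬝ᵥ rowGrad A lam i u₀))) := by
          refine Finset.sum_congr rfl fun i _ => ?_
          rw [dotProduct_comm (B *ᵥ u₀) (rowGrad _ _ _ _)]
          simp only [dotProduct_sub, dotProduct_add]
          ring
      _ = u ⬝ᵥ u - 2 * eta * qform B u
          + eta ^ 2 * (2 * ∑ i, rowProb A i * (rowGrad A lam i u ⬝ᵥ rowGrad A lam i u) +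
          2 * ∑ i, rowProb A i * (rowGrad A lam i u₀ ⬝ᵥ rowGrad A lam i u₀))
          - 2 * eta ^ 2 * ((B *ᵥ u₀) ⬝ᵥ (B *ᵥ u₀)) := by
          simp only [Finset.sum_add_distrib, Finset.sum_sub_distrib, ← Finset.mul_sum,
            ← Finset.sum_mul, hcross, h.sum_rowProb, qform]
          ring
      _ ≤ _ := by
          have := dotProduct_self_nonneg' (B *ᵥ u₀)
          have : 0 ≤ 2 * eta ^ 2 * ((B *ᵥ u₀) ⬝ᵥ (B *ᵥ u₀)) := by positivity
          linarith
  have h₁ := mul_le_mul_of_nonneg_left (h.sum_rowGrad_sq_le u) (sq_nonneg eta)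
  have h₂ := mul_le_mul_of_nonneg_left (h.sum_rowGrad_sq_le u₀) (sq_nonneg eta)
  -- Since `η S = 1/8`, each second moment costs `2 η² S = η/4` in energy, so `2η` drops to `7η/4`
  -- for the current point and `η/4` is charged to `x₀`.
  have h₃ : ∀ q, eta ^ 2 * (smoothness A lam lamHat * q) = eta / 8 * q := by
    intro q
    rw [heta]
    field_simp
  rw [h₃] at h₁ h₂
  linarith

/-! ### Expected progress of a step, an epoch and the solver -/

open scoped ENNReal

theorem expect_svrgKernel_le (h : Admissible A lam lamHat v δ) {w b : Fin d → ℝ}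
    (hw : shifted A lam *ᵥ w = b) (x₀ x : Fin d → ℝ) {eta : ℝ}
    (heta : eta = 1 / (8 * smoothness A lam lamHat)) :
    (svrgKernel A lam (rowProb A) eta x₀ (shifted A lam *ᵥ x₀ - b) x).expect
        (fun y => ENNReal.ofReal ((y - w) ⬝ᵥ (y - w))) +
        ENNReal.ofReal (7 / 4 * eta * qform (shifted A lam) (x - w)) ≤
      ENNReal.ofReal ((x - w) ⬝ᵥ (x - w)) +
        ENNReal.ofReal (eta / 4 * qform (shifted A lam) (x₀ - w)) := by
  have hS := h.smoothness_pos
  have he : 0 < eta := by rw [heta]; positivity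
  have h₁ := expect_weightedLaw (fun i => (h.rowProb_pos i).le) h.sum_rowProb (g := fun o =>
    (svrgUpdate A lam (rowProb A) eta x₀ (shifted A lam *ᵥ x₀ - b) x o - w) ⬝ᵥ
    (svrgUpdate A lam (rowProb A) eta x₀ (shifted A lam *ᵥ x₀ - b) x o - w))
    (fun o => dotProduct_self_nonneg' _)
  rw [svrgKernel, PMF.expect_map]
  change (weightedLaw (rowProb A)).expect (fun o => ENNReal.ofReal _) + _ ≤ _
  rw [h₁, ← ENNReal.ofReal_add, ← ENNReal.ofReal_add]
  · exact ENNReal.ofReal_le_ofReal (h.svrg_step_le hw x₀ x heta _ fun i => rfl)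
  · exact dotProduct_self_nonneg' _
  · exact mul_nonneg (by positivity) (h.bottom.qform_nonneg _)
  · exact Finset.sum_nonneg fun i _ =>
      mul_nonneg (h.rowProb_pos i).le (dotProduct_self_nonneg' _)
  · exact mul_nonneg (by positivity) (h.bottom.qform_nonneg _)

/-- An epoch reduces the expected error by a factor of at least four. -/
theorem expect_epochKernel_le (h : Admissible A lam lamHat v δ) {w b : Fin d → ℝ}
    (hw : shifted A lam *ᵥ w = b) (x₀ : Fin d → ℝ) :
    (epochKernel A lam (rowProb A) (setupOf A lam lamHat).eta (setupOf A lam lamHat).M b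
        x₀).expect (fun y => ENNReal.ofReal (qform (shifted A lam) (y - w))) ≤
      4⁻¹ * ENNReal.ofReal (qform (shifted A lam) (x₀ - w)) := by
  set eta := (setupOf A lam lamHat).eta with heta
  set M := (setupOf A lam lamHat).M with hM
  have hS := h.smoothness_pos
  have hmu := h.mu_pos
  have hδ := h.bottom.pos
  have he : 0 < eta := by rw [heta, setupOf]; positivity
  have hM₁ : 64 * smoothness A lam lamHat / (lam - lamHat) ≤ M := Nat.le_ceil _
  have hM₀ : (0 : ℝ) < M := lt_of_lt_of_le (by positivity) hM₁
  have hM₂ : 1 ≤ M := by exact_mod_cast hM₀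
  -- `η M ≥ 64 S / (8 S μ) = 8/μ`, and `μ ≤ δ`.
  have hMe : 8 ≤ δ * (eta * M) := by
    have : 64 * smoothness A lam lamHat ≤ M * δ := by
      rw [div_le_iff₀ hmu] at hM₁
      exact hM₁.trans (mul_le_mul_of_nonneg_left h.mu_le hM₀.le)
    rw [heta, setupOf]
    simp only
    rw [one_div, inv_mul_eq_div, ← mul_div_assoc, le_div_iff₀ (by positivity)]
    linarith
  set q := fun y => qform (shifted A lam) (y - w) with hq
  set E := (epochKernel A lam (rowProb A) eta M b x₀).expect fun y => ENNReal.ofReal (q y) with hE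
  have hq₀ : ∀ y, 0 ≤ q y := fun y => h.bottom.qform_nonneg _
  have h₁ := PMF.sum_Icc_expect_iter_le
    (fun x => h.expect_svrgKernel_le hw x₀ x (eta := eta) rfl) M x₀
  have h₂ := h.expect_svrgKernel_le hw x₀ x₀ (eta := eta) rfl
  -- At `x = x₀` the decrease `7η/4` exceeds the noise `η/4`, so the first step does not increase
  -- the expected squared distance.
  have h₃ : (svrgKernel A lam (rowProb A) eta x₀ (shifted A lam *ᵥ x₀ - b) x₀).expect
      (fun y => ENNReal.ofReal ((y - w) ⬝ᵥ (y - w))) ≤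
      ENNReal.ofReal ((x₀ - w) ⬝ᵥ (x₀ - w)) := by
    have h₄ : ENNReal.ofReal (eta / 4 * qform (shifted A lam) (x₀ - w)) ≤
        ENNReal.ofReal (7 / 4 * eta * qform (shifted A lam) (x₀ - w)) := by
      refine ENNReal.ofReal_le_ofReal (mul_le_mul_of_nonneg_right (by linarith) (hq₀ x₀))
    exact ENNReal.le_of_add_le_add_right ENNReal.ofReal_ne_top
      (h₂.trans (add_le_add le_rfl h₄))
  have h₅ : ∀ m, (PMF.iter (svrgKernel A lam (rowProb A) eta x₀ (shifted A lam *ᵥ x₀ - b)) m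
      x₀).expect (fun y => ENNReal.ofReal (7 / 4 * eta * qform (shifted A lam) (y - w))) =
      ENNReal.ofReal (7 / 4 * eta) * (PMF.iter (svrgKernel A lam (rowProb A) eta x₀
        (shifted A lam *ᵥ x₀ - b)) m x₀).expect (fun y => ENNReal.ofReal (q y)) := by
    intro m
    rw [← PMF.expect_mul_left]
    simp only [ENNReal.ofReal_mul (show 0 ≤ 7 / 4 * eta by positivity), hq]
  have h₆ : (M : ℝ≥0∞) * E = ∑ m ∈ Finset.Icc 1 M, (PMF.iter (svrgKernel A lam (rowProb A) eta x₀
        (shifted A lam *ᵥ x₀ - b)) m x₀).expect (fun y => ENNReal.ofReal (q y)) := by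
    have := PMF.mul_expect_uniformOfFinset (Finset.nonempty_Icc.2 (le_max_left 1 M))
      (fun m => (PMF.iter (svrgKernel A lam (rowProb A) eta x₀
        (shifted A lam *ᵥ x₀ - b)) m x₀).expect (fun y => ENNReal.ofReal (q y)))
    rw [hE, epochKernel, PMF.expect_bind]
    simp only [max_eq_right hM₂, Nat.card_Icc, Nat.add_sub_cancel] at this ⊢
    exact this
  simp only [h₅] at h₁
  rw [← Finset.mul_sum, ← h₆] at h₁
  have h₇ := h₁.trans (add_le_add_left h₃ _)
  -- In units of `η M q(x₀)`: the squared distance is at most `1/8`, because it is at most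
  -- `q(x₀)/δ`, and the noise is `1/4`. Their sum `3/8` is below `7/4 · 1/4 = 7/16`.
  have h₈ : ENNReal.ofReal ((x₀ - w) ⬝ᵥ (x₀ - w)) + M * ENNReal.ofReal (eta / 4 * q x₀) ≤
      ENNReal.ofReal (7 / 4 * eta) * (M * (4⁻¹ * ENNReal.ofReal (q x₀))) := by
    have e₁ : (M : ℝ≥0∞) = ENNReal.ofReal M := (ENNReal.ofReal_natCast M).symm
    have e₂ : (4⁻¹ : ℝ≥0∞) = ENNReal.ofReal (1 / 4) := by
      rw [one_div, ENNReal.ofReal_inv_of_pos (by norm_num)]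
      norm_num
    rw [e₁, e₂, ← ENNReal.ofReal_mul (p := 1 / 4) (by norm_num), ← ENNReal.ofReal_mul hM₀.le,
      ← ENNReal.ofReal_mul hM₀.le, ← ENNReal.ofReal_mul (by positivity),
      ← ENNReal.ofReal_add (dotProduct_self_nonneg' _)
        (mul_nonneg hM₀.le (mul_nonneg (by positivity) (hq₀ _)))]
    refine ENNReal.ofReal_le_ofReal ?_
    have t₁ := h.bottom.qform_ge (x₀ - w)
    have t₂ : 0 ≤ (x₀ - w) ⬝ᵥ (x₀ - w) := dotProduct_self_nonneg' _
    have t₃ : 8 * ((x₀ - w) ⬝ᵥ (x₀ - w)) ≤ eta * M * q x₀ := by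
      calc _ ≤ δ * (eta * M) * ((x₀ - w) ⬝ᵥ (x₀ - w)) := mul_le_mul_of_nonneg_right hMe t₂
        _ = eta * M * (δ * ((x₀ - w) ⬝ᵥ (x₀ - w))) := by ring
        _ ≤ _ := mul_le_mul_of_nonneg_left t₁ (by positivity)
    have t₄ : 0 ≤ eta * M * q x₀ := mul_nonneg (by positivity) (hq₀ _)
    linarith
  have h₉ := h₇.trans h₈
  rw [ENNReal.mul_le_mul_iff_right (by simpa using he) ENNReal.ofReal_ne_top,
    ENNReal.mul_le_mul_iff_right (by exact_mod_cast hM₀.ne') (ENNReal.natCast_ne_top _)] at h₉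
  exact h₉

/-- The expected error of the solver. -/
theorem expect_solveKernel_le (h : Admissible A lam lamHat v δ) {w x : Fin d → ℝ}
    (hw : shifted A lam *ᵥ w = x) (hx : x ⬝ᵥ x = 1) (K : ℕ) :
    (solveKernel A lam (rowProb A) (setupOf A lam lamHat).eta (setupOf A lam lamHat).M K
        x).expect (fun y => ENNReal.ofReal (qform (shifted A lam) (y - w))) ≤
      4⁻¹ ^ K * ENNReal.ofReal (qform (shifted A lam) (perp v x) / δ ^ 2) := by
  refine (PMF.expect_iter_le (P := fun _ => True) (fun _ _ _ _ => trivial)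
    (fun y _ => h.expect_epochKernel_le hw y) K _ trivial).trans ?_
  gcongr
  exact h.bottom.qform_init_sub_le hw hx

end Admissible

/-! ## Iterations of the shifted-and-inverted power method -/

/-- The part of `x` orthogonal to `v` is small compared to the part along `v`: in the norm of `B`,
the squared tangent of the angle between `x` and `v` is at most `t`. -/
def Aligned {d : ℕ} (B : Matrix (Fin d) (Fin d) ℝ) (v : Fin d → ℝ) (δ t : ℝ) (x : Fin d → ℝ) :
    Prop :=
  qform B (perp v x) ≤ t * (δ * (v ⬝ᵥ x) ^ 2)

/-- The squared tangent, in the norm of `B`, of the angle between `x` and `v`. -/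
noncomputable def tanSq {d : ℕ} (B : Matrix (Fin d) (Fin d) ℝ) (v : Fin d → ℝ) (δ : ℝ)
    (x : Fin d → ℝ) : ℝ :=
  qform B (perp v x) / (δ * (v ⬝ᵥ x) ^ 2)

theorem Aligned.smul {d : ℕ} {B : Matrix (Fin d) (Fin d) ℝ} {v x : Fin d → ℝ} {δ t : ℝ}
    (h : Aligned B v δ t x) (c : ℝ) : Aligned B v δ t (c • x) := by
  rw [Aligned, perp_smul, qform_smul, dotProduct_smul, smul_eq_mul]
  have := mul_le_mul_of_nonneg_left h (sq_nonneg c)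
  linarith

theorem tanSq_smul {d : ℕ} (B : Matrix (Fin d) (Fin d) ℝ) (v x : Fin d → ℝ) (δ : ℝ) {c : ℝ}
    (hc : c ≠ 0) : tanSq B v δ (c • x) = tanSq B v δ x := by
  rw [tanSq, tanSq, perp_smul, qform_smul, dotProduct_smul, smul_eq_mul, mul_pow, mul_left_comm,
    mul_div_mul_left _ _ (pow_ne_zero 2 hc)]

theorem unitize_dotProduct_self {d : ℕ} {x : Fin d → ℝ} (hx : 0 < x ⬝ᵥ x) :
    unitize x ⬝ᵥ unitize x = 1 := by
  rw [unitize, smul_dotProduct, dotProduct_smul, smul_eq_mul, smul_eq_mul, ← mul_assoc,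
    ← mul_inv, Real.mul_self_sqrt hx.le, inv_mul_cancel₀ hx.ne']

/-- Unit vectors with `Aligned t`. -/
def Good {d : ℕ} (B : Matrix (Fin d) (Fin d) ℝ) (v : Fin d → ℝ) (δ t : ℝ) (x : Fin d → ℝ) : Prop :=
  x ⬝ᵥ x = 1 ∧ Aligned B v δ t x

theorem Aligned.unitize {d : ℕ} {B : Matrix (Fin d) (Fin d) ℝ} {v x : Fin d → ℝ} {δ t : ℝ}
    (h : Aligned B v δ t x) (hx : 0 < x ⬝ᵥ x) : Good B v δ t (unitize x) :=
  ⟨unitize_dotProduct_self hx, h.smul _⟩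

namespace IsolatedBottom

variable {d : ℕ} {B : Matrix (Fin d) (Fin d) ℝ} {v : Fin d → ℝ} {δ : ℝ}

/-- Pythagoras: the spectral gap turns the energy bound on `perp v x` into a bound on its Euclidean
norm, at the gain of a factor `101`. -/
theorem one_le_sq (h : IsolatedBottom B v δ) {x : Fin d → ℝ} {t : ℝ} (hx : Good B v δ t x) :
    1 ≤ (1 + t / 101) * (v ⬝ᵥ x) ^ 2 := by
  have h₁ := h.dotProduct_self x
  have h₂ := h.qform_perp_ge x
  have h₃ := hx.2
  rw [hx.1] at h₁
  rw [Aligned] at h₃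
  have h₄ : δ * (101 * (perp v x ⬝ᵥ perp v x)) ≤ δ * (t * (v ⬝ᵥ x) ^ 2) := by linarith
  have := le_of_mul_le_mul_left h₄ h.pos
  linarith

theorem sq_pos (h : IsolatedBottom B v δ) {x : Fin d → ℝ} {t : ℝ} (hx : Good B v δ t x) :
    0 < (v ⬝ᵥ x) ^ 2 := by
  rcases (sq_nonneg (v ⬝ᵥ x)).eq_or_lt with h₀ | h₀
  · have := h.one_le_sq hx
    rw [← h₀] at this
    linarith
  · exact h₀

theorem sq_le_one (h : IsolatedBottom B v δ) {x : Fin d → ℝ} (hx : x ⬝ᵥ x = 1) :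
    (v ⬝ᵥ x) ^ 2 ≤ 1 := by
  have h₁ := h.dotProduct_self x
  have h₂ := dotProduct_self_nonneg' (perp v x)
  linarith

theorem dotProduct_self_ge (h : IsolatedBottom B v δ) (x : Fin d → ℝ) :
    (v ⬝ᵥ x) ^ 2 ≤ x ⬝ᵥ x := by
  have h₁ := h.dotProduct_self x
  have h₂ := dotProduct_self_nonneg' (perp v x)
  linarith

/-- Bounds for an approximate solution `y` of `B w = x`. -/
theorem approx_perp_le (h : IsolatedBottom B v δ) {w x : Fin d → ℝ} (hw : B *ᵥ w = x)
    (y : Fin d → ℝ) : qform B (perp v y) ≤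
      2 * (qform B (perp v x) / (101 * δ) ^ 2) + 2 * qform B (y - w) := by
  have h₁ := h.sq_qform_perp_solution_le hw
  have h₂ := h.qform_add_le (perp v w) (perp v (y - w))
  have h₃ := h.qform_eq (y - w)
  have h₄ : 0 ≤ δ * (v ⬝ᵥ (y - w)) ^ 2 := mul_nonneg h.pos.le (sq_nonneg _)
  have h₅ : qform B (perp v w) ≤ qform B (perp v x) / (101 * δ) ^ 2 := by
    rw [le_div_iff₀ (by have := h.pos; positivity), mul_comm]
    exact h₁
  rw [← perp_add, add_sub_cancel] at h₂
  linarith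

theorem approx_sq_ge (h : IsolatedBottom B v δ) {w x : Fin d → ℝ} (hw : B *ᵥ w = x)
    (y : Fin d → ℝ) : 9 / 10 * ((v ⬝ᵥ x) ^ 2 / δ ^ 2) - 9 * (qform B (y - w) / δ) ≤
      (v ⬝ᵥ y) ^ 2 := by
  have hδ := h.pos
  have h₁ : v ⬝ᵥ w = (v ⬝ᵥ x) / δ := by
    rw [eq_div_iff hδ.ne', mul_comm]
    exact h.dotProduct_solution hw
  have h₂ : v ⬝ᵥ y = (v ⬝ᵥ x) / δ + v ⬝ᵥ (y - w) := by
    rw [dotProduct_sub, h₁]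
    ring
  have h₃ : (v ⬝ᵥ (y - w)) ^ 2 ≤ qform B (y - w) / δ := by
    rw [le_div_iff₀ hδ, h.qform_eq]
    linarith [h.qform_perp_nonneg (y - w)]
  rw [h₂, ← div_pow]
  -- `(a + b)² - (9/10) a² + 9 b² = (a + 10 b)² / 10`.
  nlinarith [sq_nonneg ((v ⬝ᵥ x) / δ + 10 * (v ⬝ᵥ (y - w)))]

/-- An accurate approximate solution is twice as well aligned. -/
theorem aligned_half (h : IsolatedBottom B v δ) {w x y : Fin d → ℝ} {t β : ℝ} (hw : B *ᵥ w = x)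
    (hx : Good B v δ t x) (ht : 0 < t) (hβ : β ≤ 1 / 100) (hβt : β * t ≤ 1 / 100)
    (hy : qform B (y - w) ≤ β * (t * (v ⬝ᵥ x) ^ 2 / δ)) :
    Good B v δ (t / 2) (unitize y) := by
  have hδ := h.pos
  have h₁ := h.approx_perp_le hw y
  have h₂ := h.approx_sq_ge hw y
  have hα := h.sq_pos hx
  set s := (v ⬝ᵥ x) ^ 2 / δ ^ 2 with hs
  have hs₀ : 0 < s := by positivity
  have hαs : (v ⬝ᵥ x) ^ 2 = s * δ ^ 2 := by rw [hs]; field_simp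
  -- The bound on `β t` protects the component along `v`; the bound on `β` alone controls the
  -- orthogonal energy. For large `t` the former is the stronger demand.
  have h₃ : qform B (y - w) / δ ≤ 1 / 100 * s := by
    rw [div_le_iff₀ hδ]
    refine hy.trans ?_
    rw [hαs, show β * (t * (s * δ ^ 2) / δ) = (β * t) * (s * δ) by field_simp,
      show 1 / 100 * s * δ = 1 / 100 * (s * δ) by ring]
    exact mul_le_mul_of_nonneg_right hβt (by positivity)
  have h₄ : 0.81 * s ≤ (v ⬝ᵥ y) ^ 2 := by linarith
  have h₅ : qform B (perp v x) / (101 * δ) ^ 2 ≤ 1 / 10000 * (t * δ * s) := by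
    rw [div_le_iff₀ (by positivity)]
    have := hx.2
    rw [Aligned, hαs] at this
    have h0 : 0 < t * (δ * (s * δ ^ 2)) := by positivity
    nlinarith
  have h₆ : qform B (y - w) ≤ 1 / 100 * (t * δ * s) := by
    refine hy.trans ?_
    rw [hαs, show β * (t * (s * δ ^ 2) / δ) = β * (t * δ * s) by field_simp]
    exact mul_le_mul_of_nonneg_right hβ (by positivity)
  refine Aligned.unitize ?_ (lt_of_lt_of_le (by linarith) (h.dotProduct_self_ge y))
  rw [Aligned]
  have h₇ : 0 < t * δ * s := by positivity
  have h₈ : t * δ * (0.81 * s) ≤ t * δ * (v ⬝ᵥ y) ^ 2 :=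
    mul_le_mul_of_nonneg_left h₄ (by positivity)
  linarith

end IsolatedBottom

namespace Admissible

variable {r d : ℕ} {A : Matrix (Fin r) (Fin d) ℝ} {lam lamHat : ℝ} {v : Fin d → ℝ} {δ : ℝ}

/-- For a unit vector, `lam - xᵀΣx` is its energy, at most `(1 + ε) δ`. The loss against `λ₁` is
thus at most `ε δ`, and `δ ≤ λ₁`. -/
theorem rayleigh_ge (h : Admissible A lam lamHat v δ) {x : Fin d → ℝ} {ε : ℝ} (hε : 0 ≤ ε)
    (hx : Good (shifted A lam) v δ ε x) : (1 - ε) * (lam - δ) ≤ x ⬝ᵥ ((Aᵀ * A) *ᵥ x) := by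
  have h₁ := qform_shifted A lam x
  have h₂ := h.bottom.qform_eq x
  have h₃ := hx.2
  have h₄ := h.bottom.sq_le_one hx.1
  have h₅ := h.bottom.pos
  have h₆ := h.delta_le
  rw [hx.1] at h₁
  rw [Aligned] at h₃
  have h₇ : (1 + ε) * (δ * (v ⬝ᵥ x) ^ 2) ≤ (1 + ε) * (δ * 1) := by gcongr
  have h₈ : ε * δ ≤ ε * (lam - δ) := by gcongr; linarith
  linarith

/-- What the two tests of a warm-start iteration guarantee. -/
theorem of_warmTest (h : Admissible A lam lamHat v δ) {y : Fin d → ℝ}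
    (hy : WarmTest A lam lamHat y) : Aligned (shifted A lam) v δ (1 / 5) y ∧
      0.44 / δ ^ 2 ≤ (v ⬝ᵥ y) ^ 2 ∧ 0 < y ⬝ᵥ y := by
  have hδ := h.bottom.pos
  have hmu := h.mu_pos
  have h₁ : 2 / 3 / δ ≤ √(y ⬝ᵥ y) :=
    le_trans (div_le_div_of_nonneg_left (by norm_num) hmu h.mu_le) hy.2
  have h₂ : 4 / 9 / δ ^ 2 ≤ y ⬝ᵥ y := by
    have := (Real.le_sqrt' (by positivity)).1 h₁
    convert this using 1
    ring
  have hn : 0 < y ⬝ᵥ y := lt_of_lt_of_le (by positivity) h₂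
  have h₃ := hy.1
  rw [le_div_iff₀ hn] at h₃
  have h₄ := qform_shifted A lam y
  have h₅ : qform (shifted A lam) y ≤ 7 / 6 * (δ * (y ⬝ᵥ y)) := by
    have := mul_le_mul_of_nonneg_right h.mu_le hn.le
    linarith
  rw [h.bottom.qform_eq] at h₅
  have h₆ := h.bottom.dotProduct_self y
  have h₇ := h.bottom.qform_perp_ge y
  set a := (v ⬝ᵥ y) ^ 2
  set ρ := perp v y ⬝ᵥ perp v y
  have h₈ : δ * (y ⬝ᵥ y) = δ * a + δ * ρ := by rw [h₆]; ring
  -- The orthogonal energy `Q` satisfies `δ a + Q ≤ (7/6)(δ a + δ ρ)` and `101 δ ρ ≤ Q`; solving for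
  -- `Q` leaves a little more than `δ a / 6`.
  have h₉ : qform (shifted A lam) (perp v y) ≤ 1 / 5 * (δ * a) := by nlinarith
  refine ⟨h₉, ?_, hn⟩
  have h₀ : δ * (101 * ρ) ≤ δ * (1 / 5 * a) := by linarith
  have h₁₀ := le_of_mul_le_mul_left h₀ hδ
  have h₁₁ : 0.44 / δ ^ 2 = 0.99 * (4 / 9 / δ ^ 2) := by ring
  rw [h₁₁]
  linarith

/-- A sufficiently accurate approximate solution passes the tests. -/
theorem warmTest_of_le (h : Admissible A lam lamHat v δ) {w x y : Fin d → ℝ}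
    (hw : shifted A lam *ᵥ w = x) (hx : Good (shifted A lam) v δ (1 / 5) x)
    (hy : qform (shifted A lam) (y - w) ≤ 0.01 / δ) : WarmTest A lam lamHat y := by
  have hδ := h.bottom.pos
  have hmu := h.mu_pos
  have h₁ := h.bottom.approx_perp_le hw y
  have h₂ := h.bottom.approx_sq_ge hw y
  have h₃ := h.bottom.one_le_sq hx
  have h₄ := h.bottom.sq_le_one hx.1
  have h₅ := hx.2
  rw [Aligned] at h₅
  have h₆ : 0.8 / δ ^ 2 ≤ (v ⬝ᵥ y) ^ 2 := by
    refine le_trans ?_ h₂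
    have t₁ : qform (shifted A lam) (y - w) / δ ≤ 0.01 / δ ^ 2 := by
      rw [sq, ← div_div]
      gcongr
    have t₂ : 0.99 / δ ^ 2 ≤ (v ⬝ᵥ x) ^ 2 / δ ^ 2 := by
      gcongr
      linarith
    have t₃ : 0.8 / δ ^ 2 ≤ 9 / 10 * (0.99 / δ ^ 2) - 9 * (0.01 / δ ^ 2) := by
      rw [show 9 / 10 * (0.99 / δ ^ 2) - 9 * (0.01 / δ ^ 2) = 0.801 / δ ^ 2 by ring]
      gcongr
      norm_num
    linarith
  -- The constant `0.06` is dictated by the Rayleigh test, which tolerates energy `(7/6) μ |y|²`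
  -- with `μ ≥ (10/11) δ`, and `70/66 > 1.06`.
  have h₇ : qform (shifted A lam) (perp v y) ≤ 0.06 * (δ * (v ⬝ᵥ y) ^ 2) := by
    have t₁ : qform (shifted A lam) (perp v x) / (101 * δ) ^ 2 ≤ 0.0001 / δ := by
      rw [div_le_div_iff₀ (by positivity) hδ]
      have : δ * (v ⬝ᵥ x) ^ 2 ≤ δ * 1 := by gcongr
      have : qform (shifted A lam) (perp v x) ≤ 1 / 5 * δ := by linarith
      nlinarith
    have t₂ : 0.8 / δ ≤ δ * (v ⬝ᵥ y) ^ 2 := by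
      calc 0.8 / δ = δ * (0.8 / δ ^ 2) := by field_simp
        _ ≤ _ := by gcongr
    have t₃ : 0.0001 / δ = 0.0001 * (1 / δ) := by ring
    have t₄ : 0.01 / δ = 0.01 * (1 / δ) := by ring
    have t₅ : 0.8 / δ = 0.8 * (1 / δ) := by ring
    have t₆ : 0 < 1 / δ := by positivity
    linarith
  have h₈ := h.bottom.dotProduct_self_ge y
  have hn : 0 < y ⬝ᵥ y := lt_of_lt_of_le (by positivity) (h₆.trans h₈)
  refine ⟨?_, ?_⟩
  · rw [le_div_iff₀ hn]
    have t₁ := qform_shifted A lam y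
    rw [h.bottom.qform_eq] at t₁
    have t₂ : δ * (v ⬝ᵥ y) ^ 2 ≤ δ * (y ⬝ᵥ y) := by gcongr
    have t₃ := mul_le_mul_of_nonneg_right h.le_mu hn.le
    have t₄ : 0 < δ * (y ⬝ᵥ y) := by positivity
    linarith
  · refine Real.le_sqrt_of_sq_le ?_
    have t₁ : 2 / 3 / (lam - lamHat) ≤ 0.74 / δ := by
      rw [div_le_div_iff₀ hmu hδ]
      linarith [h.le_mu]
    calc (2 / 3 / (lam - lamHat)) ^ 2 ≤ (0.74 / δ) ^ 2 := by gcongr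
      _ = 0.5476 / δ ^ 2 := by ring
      _ ≤ 0.8 / δ ^ 2 := by gcongr; norm_num
      _ ≤ _ := h₆.trans h₈

/-- This holds for every `y`, however bad: a `y` that passes the tests is well aligned, and
otherwise `x` is kept. No union bound over the warm-start rounds is needed. -/
theorem good_warmUpdate (h : Admissible A lam lamHat v δ) {x : Fin d → ℝ}
    (hx : Good (shifted A lam) v δ (1 / 5) x) (y : Fin d → ℝ) :
    Good (shifted A lam) v δ (1 / 5) (warmUpdate A lam lamHat x y) := by
  rw [warmUpdate]
  split_ifs with hy
  · exact (h.of_warmTest hy).1.unitize (h.of_warmTest hy).2.2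
  · exact hx

theorem tanSq_nonneg (h : Admissible A lam lamHat v δ) (x : Fin d → ℝ) :
    0 ≤ tanSq (shifted A lam) v δ x :=
  div_nonneg (h.bottom.qform_perp_nonneg x) (mul_nonneg h.bottom.pos.le (sq_nonneg _))

theorem tanSq_le (h : Admissible A lam lamHat v δ) {x : Fin d → ℝ} {t : ℝ}
    (hx : Good (shifted A lam) v δ t x) : tanSq (shifted A lam) v δ x ≤ t := by
  rw [tanSq, div_le_iff₀ (mul_pos h.bottom.pos (h.bottom.sq_pos hx))]
  exact hx.2

theorem qform_perp_le (h : Admissible A lam lamHat v δ) {x : Fin d → ℝ} {t : ℝ}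
    (hx : Good (shifted A lam) v δ t x) :
    qform (shifted A lam) (perp v x) ≤ tanSq (shifted A lam) v δ x * δ := by
  have hδ := h.bottom.pos
  have e : tanSq (shifted A lam) v δ x * (δ * (v ⬝ᵥ x) ^ 2) = qform (shifted A lam) (perp v x) :=
    div_mul_cancel₀ _ (mul_pos hδ (h.bottom.sq_pos hx)).ne'
  rw [← e]
  have h₁ : δ * (v ⬝ᵥ x) ^ 2 ≤ δ * 1 := by gcongr; exact h.bottom.sq_le_one hx.1
  exact mul_le_mul_of_nonneg_left (by linarith) (h.tanSq_nonneg x)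

/-- If `y` is accepted, the tests bound the denominator of its tangent from below and
`approx_perp_le` bounds the numerator. If `y` is rejected, the solver error exceeds `0.01/δ`, so the
error term exceeds `0.25`, more than the old value. -/
theorem tanSq_warmUpdate_le (h : Admissible A lam lamHat v δ) {w x : Fin d → ℝ}
    (hw : shifted A lam *ᵥ w = x) (hx : Good (shifted A lam) v δ (1 / 5) x) (y : Fin d → ℝ) :
    tanSq (shifted A lam) v δ (warmUpdate A lam lamHat x y) ≤
      0.1 * tanSq (shifted A lam) v δ x + 25 * δ * qform (shifted A lam) (y - w) := by
  have hδ := h.bottom.pos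
  have hH := h.tanSq_le hx
  have hH₀ := h.tanSq_nonneg x
  have hN := h.bottom.qform_nonneg (y - w)
  rw [warmUpdate]
  split_ifs with hy
  · obtain ⟨h₁, h₂, h₃⟩ := h.of_warmTest hy
    rw [unitize, tanSq_smul _ _ _ _ (inv_ne_zero (Real.sqrt_pos.2 h₃).ne')]
    have h₄ := h.bottom.approx_perp_le hw y
    have h₅ : 0.44 / δ ≤ δ * (v ⬝ᵥ y) ^ 2 := by
      calc 0.44 / δ = δ * (0.44 / δ ^ 2) := by field_simp
        _ ≤ _ := by gcongr
    have h₆ := h.qform_perp_le hx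
    have h₇ : qform (shifted A lam) (perp v x) / (101 * δ) ^ 2 ≤
        0.01 * tanSq (shifted A lam) v δ x / δ := by
      rw [div_le_div_iff₀ (by positivity) hδ]
      have : 0 ≤ tanSq (shifted A lam) v δ x * δ * δ := by positivity
      nlinarith
    rw [tanSq, div_le_iff₀ (lt_of_lt_of_le (by positivity) h₅)]
    have h₈ : (0.1 * tanSq (shifted A lam) v δ x + 25 * δ * qform (shifted A lam) (y - w)) *
        (0.44 / δ) ≤ (0.1 * tanSq (shifted A lam) v δ x +
          25 * δ * qform (shifted A lam) (y - w)) * (δ * (v ⬝ᵥ y) ^ 2) := by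
      gcongr
    have h₉ : (0.1 * tanSq (shifted A lam) v δ x + 25 * δ * qform (shifted A lam) (y - w)) *
        (0.44 / δ) = 0.044 * tanSq (shifted A lam) v δ x / δ +
          11 * qform (shifted A lam) (y - w) := by
      field_simp
      ring
    have h₀ : 0 ≤ tanSq (shifted A lam) v δ x / δ := by positivity
    have t₁ : 0.01 * tanSq (shifted A lam) v δ x / δ =
      0.01 * (tanSq (shifted A lam) v δ x / δ) := by ring
    have t₂ : 0.044 * tanSq (shifted A lam) v δ x / δ =
      0.044 * (tanSq (shifted A lam) v δ x / δ) := by ring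
    linarith
  · have h₁ : 0.01 / δ < qform (shifted A lam) (y - w) :=
      not_le.1 fun h₁ => hy (h.warmTest_of_le hw hx h₁)
    rw [div_lt_iff₀ hδ] at h₁
    linarith

/-! ### Probabilistic analysis of the two phases -/

open scoped ENNReal

/-- A warm-start iteration halves the expected squared tangent. -/
theorem expect_warmKernel_le (h : Admissible A lam lamHat v δ) {K : ℕ} (hK : 5 ≤ K)
    {x : Fin d → ℝ} (hx : Good (shifted A lam) v δ (1 / 5) x) :
    (warmKernel A lam lamHat K x).expect (fun y => ENNReal.ofReal (tanSq (shifted A lam) v δ y)) ≤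
      2⁻¹ * ENNReal.ofReal (tanSq (shifted A lam) v δ x) := by
  have hδ := h.bottom.pos
  obtain ⟨w, hw⟩ := h.bottom.exists_solution x
  have hH₀ := h.tanSq_nonneg x
  set H := tanSq (shifted A lam) v δ x with hH
  rw [warmKernel, PMF.expect_map]
  have h₁ : ∀ y, ENNReal.ofReal (tanSq (shifted A lam) v δ (warmUpdate A lam lamHat x y)) ≤
      ENNReal.ofReal (0.1 * H) + ENNReal.ofReal (25 * δ) *
        ENNReal.ofReal (qform (shifted A lam) (y - w)) := fun y => by
    rw [← ENNReal.ofReal_mul (by positivity), ← ENNReal.ofReal_add (by positivity)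
      (mul_nonneg (by positivity) (h.bottom.qform_nonneg _))]
    exact ENNReal.ofReal_le_ofReal (h.tanSq_warmUpdate_le hw hx y)
  refine (PMF.expect_mono h₁).trans ?_
  rw [PMF.expect_add, PMF.expect_const, PMF.expect_mul_left]
  have h₂ := h.expect_solveKernel_le hw hx.1 K
  -- Five epochs suffice: `0.1 + 25/1024 < 1/2`.
  have h₃ : (4⁻¹ : ℝ≥0∞) ^ K ≤ ENNReal.ofReal (1 / 1024) := by
    calc (4⁻¹ : ℝ≥0∞) ^ K ≤ 4⁻¹ ^ 5 :=
          pow_le_pow_of_le_one (zero_le) (ENNReal.inv_le_one.2 (by norm_num)) hK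
      _ = ENNReal.ofReal (1 / 1024) := by
          rw [one_div, ENNReal.ofReal_inv_of_pos (by norm_num), ← ENNReal.inv_pow]
          norm_num
  have h₄ : qform (shifted A lam) (perp v x) / δ ^ 2 ≤ H / δ := by
    rw [div_le_div_iff₀ (by positivity) hδ]
    have := mul_le_mul_of_nonneg_right (h.qform_perp_le hx) hδ.le
    linarith
  calc _ ≤ ENNReal.ofReal (0.1 * H) + ENNReal.ofReal (25 * δ) *
        (ENNReal.ofReal (1 / 1024) * ENNReal.ofReal (H / δ)) := by
        gcongr
        exact h₂.trans (mul_le_mul' h₃ (ENNReal.ofReal_le_ofReal h₄))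
    _ = ENNReal.ofReal (0.1 * H + 25 * δ * (1 / 1024 * (H / δ))) := by
        rw [ENNReal.ofReal_add (by positivity) (by positivity),
          ENNReal.ofReal_mul (p := 25 * δ) (by positivity),
          ENNReal.ofReal_mul (p := 1 / 1024) (by positivity)]
    _ ≤ ENNReal.ofReal (1 / 2 * H) := by
        refine ENNReal.ofReal_le_ofReal ?_
        rw [show 25 * δ * (1 / 1024 * (H / δ)) = 25 / 1024 * H by field_simp]
        linarith
    _ = 2⁻¹ * ENNReal.ofReal H := by
        rw [ENNReal.ofReal_mul (by norm_num), one_div, ENNReal.ofReal_inv_of_pos (by norm_num)]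
        norm_num

/-- The failure probability of the warm-start phase. -/
theorem failure_warm_le (h : Admissible A lam lamHat v δ) {K : ℕ} (hK : 5 ≤ K) (T : ℕ)
    {x : Fin d → ℝ} (hx : Good (shifted A lam) v δ (1 / 5) x) {ε : ℝ} (hε : 0 < ε) :
    ENNReal.ofReal ε * (PMF.iter (warmKernel A lam lamHat K) T x).failure
      (fun y => y ⬝ᵥ y = 1 ∧ (1 - ε) * (lam - δ) ≤ y ⬝ᵥ ((Aᵀ * A) *ᵥ y)) ≤ 2⁻¹ ^ T := by
  have hsupp : ∀ a, Good (shifted A lam) v δ (1 / 5) a →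
      ∀ b ∈ (warmKernel A lam lamHat K a).support, Good (shifted A lam) v δ (1 / 5) b := by
    intro a ha b hb
    rw [warmKernel, PMF.mem_support_map_iff] at hb
    obtain ⟨y, -, rfl⟩ := hb
    exact h.good_warmUpdate ha y
  have h₁ := PMF.expect_iter_le hsupp (fun a ha => h.expect_warmKernel_le hK ha) T x hx
  have h₂ : ENNReal.ofReal (tanSq (shifted A lam) v δ x) ≤ 1 := by
    rw [← ENNReal.ofReal_one]
    exact ENNReal.ofReal_le_ofReal ((h.tanSq_le hx).trans (by norm_num))
  refine (PMF.failure_mul_le fun y hy hfail => ?_).trans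
    (h₁.trans ((mul_le_mul_right h₂ _).trans (mul_one _).le))
  have hg := PMF.iter_support hsupp T x hx y hy
  refine ENNReal.ofReal_le_ofReal (not_lt.1 fun hlt => hfail ⟨hg.1, h.rayleigh_ge hε.le ⟨hg.1, ?_⟩⟩)
  rw [tanSq, div_lt_iff₀ (mul_pos h.bottom.pos (h.bottom.sq_pos hg))] at hlt
  exact hlt.le

/-- The failure probability of a burn-in iteration. -/
theorem failure_burnInKernel_le (h : Admissible A lam lamHat v δ) (K : ℕ) {x : Fin d → ℝ}
    {t t₀ : ℝ} (ht : 0 < t) (htt : t ≤ t₀) (ht₀ : 1 ≤ t₀) (hx : Good (shifted A lam) v δ t x) :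
    (burnInKernel A lam lamHat K x).failure (Good (shifted A lam) v δ (t / 2)) ≤
      ENNReal.ofReal (100 * t₀) * 4⁻¹ ^ K := by
  have hδ := h.bottom.pos
  obtain ⟨w, hw⟩ := h.bottom.exists_solution x
  have hα := h.bottom.sq_pos hx
  set m := t * (v ⬝ᵥ x) ^ 2 / δ with hm
  have hm₀ : 0 < m := by positivity
  rw [burnInKernel, PMF.failure_map]
  -- Markov's inequality with `β = 1/(100 t₀)`. As `t₀ ≥ 1` and `t ≤ t₀`, both `β` and `β t` are at
  -- most `1/100`; fixing `t₀` gives one failure bound for all rounds.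
  have h₁ : ENNReal.ofReal (1 / (100 * t₀) * m) * (solveKernel A lam (rowProb A)
      (setupOf A lam lamHat).eta (setupOf A lam lamHat).M K x).failure
      (Good (shifted A lam) v δ (t / 2) ∘ unitize) ≤
      4⁻¹ ^ K * ENNReal.ofReal (qform (shifted A lam) (perp v x) / δ ^ 2) := by
    refine (PMF.failure_mul_le fun y _ hy => ?_).trans (h.expect_solveKernel_le hw hx.1 K)
    refine ENNReal.ofReal_le_ofReal (not_lt.1 fun hlt => hy ?_)
    refine h.bottom.aligned_half hw hx ht ?_ ?_ hlt.le
    · gcongr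
      linarith
    · rw [div_mul_eq_mul_div, div_le_div_iff₀ (by positivity) (by norm_num)]
      linarith
  have h₂ : qform (shifted A lam) (perp v x) / δ ^ 2 ≤ m := by
    rw [hm, div_le_div_iff₀ (by positivity) hδ]
    have := mul_le_mul_of_nonneg_right hx.2 hδ.le
    linarith
  have h₃ : ENNReal.ofReal m ≤
      ENNReal.ofReal (100 * t₀) * ENNReal.ofReal (1 / (100 * t₀) * m) := by
    rw [← ENNReal.ofReal_mul (by positivity)]
    refine ENNReal.ofReal_le_ofReal (le_of_eq ?_)
    field_simp
  have h₄ : ENNReal.ofReal (1 / (100 * t₀) * m) ≠ 0 := by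
    rw [Ne, ENNReal.ofReal_eq_zero, not_le]
    positivity
  rw [← ENNReal.mul_le_mul_iff_right h₄ ENNReal.ofReal_ne_top]
  refine h₁.trans ?_
  calc _ ≤ 4⁻¹ ^ K * ENNReal.ofReal m := by gcongr
    _ ≤ 4⁻¹ ^ K * (ENNReal.ofReal (100 * t₀) * ENNReal.ofReal (1 / (100 * t₀) * m)) := by gcongr
    _ = _ := by ring

/-- The failure probability of the burn-in phase. -/
theorem failure_burnIn_le (h : Admissible A lam lamHat v δ) (K T : ℕ) {x : Fin d → ℝ} {t₀ : ℝ}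
    (ht₀ : 1 ≤ t₀) (hx : Good (shifted A lam) v δ t₀ x) :
    (PMF.iter (burnInKernel A lam lamHat K) T x).failure
      (Good (shifted A lam) v δ (t₀ / 2 ^ T)) ≤ T * (ENNReal.ofReal (100 * t₀) * 4⁻¹ ^ K) := by
  have h₁ := PMF.failure_iter_le (κ := burnInKernel A lam lamHat K)
    (P := fun j => Good (shifted A lam) v δ (t₀ / 2 ^ j)) (c := ENNReal.ofReal (100 * t₀) * 4⁻¹ ^ K)
    (fun j a ha => by
      have := h.failure_burnInKernel_le K (t := t₀ / 2 ^ j) (by positivity)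
        (div_le_self (by linarith) (one_le_pow₀ (by norm_num))) ht₀ ha
      rwa [div_div, ← pow_succ] at this) T 0 x (by simpa using hx)
  simpa using h₁

/-- The failure probability of both phases from a start vector that is not too badly aligned. -/
theorem failure_phases_le (h : Admissible A lam lamHat v δ) {K₁ T₁ K₂ T₂ : ℕ} (hK₂ : 5 ≤ K₂)
    {x : Fin d → ℝ} {t₀ ε : ℝ} (ht₀ : 1 ≤ t₀) (hT₁ : t₀ / 2 ^ T₁ ≤ 1 / 5) (hε : 0 < ε)
    (hx : Good (shifted A lam) v δ t₀ x) :
    ((PMF.iter (burnInKernel A lam lamHat K₁) T₁ x).bind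
      (PMF.iter (warmKernel A lam lamHat K₂) T₂)).failure
      (fun y => y ⬝ᵥ y = 1 ∧ (1 - ε) * (lam - δ) ≤ y ⬝ᵥ ((Aᵀ * A) *ᵥ y)) ≤
      ENNReal.ofReal (T₁ * (100 * t₀) * (1 / 4) ^ K₁ + (1 / 2) ^ T₂ / ε) := by
  have hδ := h.bottom.pos
  have e₁ : ENNReal.ofReal (T₁ * (100 * t₀) * (1 / 4) ^ K₁) =
      T₁ * (ENNReal.ofReal (100 * t₀) * 4⁻¹ ^ K₁) := by
    rw [ENNReal.ofReal_mul (by positivity), ENNReal.ofReal_mul (by positivity),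
      ENNReal.ofReal_natCast, ENNReal.ofReal_pow (by norm_num), one_div,
      ENNReal.ofReal_inv_of_pos (by norm_num), mul_assoc]
    norm_num
  have e₂ : ENNReal.ofReal ε * ENNReal.ofReal ((1 / 2) ^ T₂ / ε) = 2⁻¹ ^ T₂ := by
    rw [← ENNReal.ofReal_mul hε.le, mul_div_cancel₀ _ hε.ne', ENNReal.ofReal_pow (by norm_num),
      one_div, ENNReal.ofReal_inv_of_pos (by norm_num)]
    norm_num
  rw [ENNReal.ofReal_add (by positivity) (by positivity), e₁]
  refine PMF.failure_bind_le (h.failure_burnIn_le K₁ T₁ ht₀ hx) fun y hy => ?_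
  have hy' : Good (shifted A lam) v δ (1 / 5) y := by
    refine ⟨hy.1, hy.2.trans ?_⟩
    exact mul_le_mul_of_nonneg_right hT₁ (mul_nonneg hδ.le (sq_nonneg _))
  have h₁ := h.failure_warm_le hK₂ T₂ hy' hε
  rw [← e₂] at h₁
  exact (ENNReal.mul_le_mul_iff_right (by simpa using hε) ENNReal.ofReal_ne_top).1 h₁

end Admissible

/-! ## The Gaussian start vector -/

section Gaussian

variable {d : ℕ}

/-- A linear functional of a standard Gaussian vector is Gaussian with mean zero and variance its
squared norm. -/
theorem map_dotProduct_pi_gaussianReal {v : Fin d → ℝ} (hv : v ⬝ᵥ v = 1) :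
    (Measure.pi fun _ : Fin d => gaussianReal 0 1).map (fun x => v ⬝ᵥ x) = gaussianReal 0 1 := by
  have h₁ : (fun x : Fin d → ℝ => v ⬝ᵥ x) =
      (innerSL ℝ (WithLp.toLp 2 v : EuclideanSpace ℝ (Fin d))) ∘ WithLp.toLp 2 := by
    ext x
    simp [EuclideanSpace.inner_eq_star_dotProduct, dotProduct_comm]
  have hn : ‖(WithLp.toLp 2 v : EuclideanSpace ℝ (Fin d))‖ ^ 2 = 1 := by
    rw [EuclideanSpace.real_norm_sq_eq, ← hv]
    simp [dotProduct, sq]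
  rw [h₁, ← Measure.map_map (by fun_prop) (by fun_prop), map_pi_eq_stdGaussian,
    IsGaussian.map_eq_gaussianReal, integral_strongDual_stdGaussian, variance_dual_stdGaussian,
    innerSL_apply_norm, hn]
  simp

/-- The density is at most `1/√(2π) ≤ 1/2`, on an interval of length `2t`. -/
theorem gaussianReal_abs_lt_le (t : ℝ) :
    gaussianReal 0 1 {z | |z| < t} ≤ ENNReal.ofReal t := by
  have hpdf : ∀ z, gaussianPDF 0 1 z ≤ ENNReal.ofReal (1 / 2) := fun z => by
    refine ENNReal.ofReal_le_ofReal ?_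
    have h₁ : (2 : ℝ) ≤ √(2 * Real.pi) := Real.le_sqrt_of_sq_le (by linarith [Real.pi_gt_three])
    have h₂ : Real.exp (-(z - 0) ^ 2 / (2 * 1)) ≤ 1 := Real.exp_le_one_iff.2 (by
      nlinarith [sq_nonneg z])
    rw [gaussianPDFReal, NNReal.coe_one, mul_one, one_div]
    calc _ ≤ (2 : ℝ)⁻¹ * 1 := by gcongr
      _ = _ := mul_one _
  have hs : {z : ℝ | |z| < t} = Set.Ioo (-t) t := by
    ext z
    simp [abs_lt]
  rw [gaussianReal_apply _ one_ne_zero]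
  refine (lintegral_mono hpdf).trans ?_
  rw [lintegral_const, Measure.restrict_apply MeasurableSet.univ, Set.univ_inter, hs,
    Real.volume_Ioo, ← ENNReal.ofReal_mul (by norm_num)]
  exact ENNReal.ofReal_le_ofReal (by linarith)

theorem lintegral_sq_gaussianReal : ∫⁻ z, ENNReal.ofReal (z ^ 2) ∂(gaussianReal 0 1) = 1 := by
  have h₁ : Integrable (fun z : ℝ => z ^ 2) (gaussianReal 0 1) :=
    (memLp_id_gaussianReal (μ := 0) (v := 1) 2).integrable_sq
  rw [← ofReal_integral_eq_lintegral_ofReal h₁ (ae_of_all _ fun z => sq_nonneg z)]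
  have h₂ := variance_id_gaussianReal (μ := 0) (v := 1)
  rw [variance_eq_integral aemeasurable_id] at h₂
  simp only [id, integral_id_gaussianReal, sub_zero] at h₂
  rw [show ∫ x : ℝ, x ^ 2 ∂gaussianReal 0 1 = ((1 : NNReal) : ℝ) from h₂]
  simp

theorem lintegral_dotProduct_self_gaussian :
    ∫⁻ x : Fin d → ℝ, ENNReal.ofReal (x ⬝ᵥ x) ∂(Measure.pi fun _ : Fin d => gaussianReal 0 1) =
      d := by
  have h₁ : ∀ x : Fin d → ℝ, ENNReal.ofReal (x ⬝ᵥ x) = ∑ i, ENNReal.ofReal (x i ^ 2) := fun x => by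
    rw [← ENNReal.ofReal_sum_of_nonneg fun i _ => sq_nonneg _]
    simp [dotProduct, sq]
  simp only [h₁]
  rw [lintegral_finsetSum _ fun i _ => by fun_prop]
  have h₂ : ∀ i, ∫⁻ x : Fin d → ℝ, ENNReal.ofReal (x i ^ 2)
      ∂(Measure.pi fun _ : Fin d => gaussianReal 0 1) = 1 := fun i => by
    have := (measurePreserving_eval (fun _ : Fin d => gaussianReal 0 1) i).lintegral_comp
      (f := fun z : ℝ => ENNReal.ofReal (z ^ 2)) (by fun_prop)
    rw [lintegral_sq_gaussianReal] at this
    exact this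
  simp [h₂]

/-- With high probability the start vector is not too long, and not too orthogonal to `v`. -/
theorem gaussian_start {v : Fin d → ℝ} (hv : v ⬝ᵥ v = 1) {t s : ℝ} (ht : 0 ≤ t) (hs : 0 < s) :
    MeasurableSet {x : Fin d → ℝ | t ≤ |v ⬝ᵥ x| ∧ x ⬝ᵥ x ≤ s} ∧
    1 - ENNReal.ofReal (t + d / s) ≤ (Measure.pi fun _ : Fin d => gaussianReal 0 1)
      {x : Fin d → ℝ | t ≤ |v ⬝ᵥ x| ∧ x ⬝ᵥ x ≤ s} := by
  have hm₁ : Measurable fun x : Fin d → ℝ => v ⬝ᵥ x := by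
    unfold dotProduct
    fun_prop
  have hm₂ : Measurable fun x : Fin d → ℝ => x ⬝ᵥ x := by
    unfold dotProduct
    fun_prop
  have hm : MeasurableSet {x : Fin d → ℝ | t ≤ |v ⬝ᵥ x| ∧ x ⬝ᵥ x ≤ s} :=
    (measurableSet_le measurable_const hm₁.abs).inter (measurableSet_le hm₂ measurable_const)
  refine ⟨hm, ?_⟩
  set μ := Measure.pi fun _ : Fin d => gaussianReal 0 1
  have h₁ : μ {x | |v ⬝ᵥ x| < t} ≤ ENNReal.ofReal t := by
    have := gaussianReal_abs_lt_le t
    rw [← map_dotProduct_pi_gaussianReal hv, Measure.map_apply hm₁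
      (measurableSet_lt (by fun_prop) measurable_const)] at this
    exact this
  have h₂ : μ {x | s < x ⬝ᵥ x} ≤ ENNReal.ofReal (d / s) := by
    have h := mul_meas_ge_le_lintegral (μ := μ) (hm₂.ennreal_ofReal) (ENNReal.ofReal s)
    rw [lintegral_dotProduct_self_gaussian] at h
    rw [ENNReal.ofReal_div_of_pos hs, ENNReal.ofReal_natCast,
      ENNReal.le_div_iff_mul_le (Or.inl (by simpa using hs)) (Or.inl ENNReal.ofReal_ne_top),
      mul_comm]
    refine le_trans ?_ h
    gcongr
    intro hx
    exact ENNReal.ofReal_le_ofReal (le_of_lt hx)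
  rw [tsub_le_iff_right, ENNReal.ofReal_add ht (by positivity)]
  calc (1 : ENNReal) = μ Set.univ := measure_univ.symm
    _ ≤ μ ({x : Fin d → ℝ | t ≤ |v ⬝ᵥ x| ∧ x ⬝ᵥ x ≤ s} ∪
        ({x | |v ⬝ᵥ x| < t} ∪ {x | s < x ⬝ᵥ x})) := by
        refine measure_mono fun x _ => ?_
        simp only [Set.mem_union, Set.mem_ofPred_eq]
        by_cases h1 : |v ⬝ᵥ x| < t
        · simp [h1]
        · by_cases h2 : s < x ⬝ᵥ x
          · simp [h2]
          · exact Or.inl ⟨not_lt.1 h1, not_lt.1 h2⟩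
    _ ≤ _ := (measure_union_le _ _).trans (by
        gcongr
        exact (measure_union_le _ _).trans (add_le_add h₁ h₂))

end Gaussian

/-! ## The sparse format of a matrix -/

section Sparse

variable {n d : ℕ} (A : Matrix (Fin n) (Fin d) ℝ)

theorem List.sum_map_filter_of_zero {α β : Type*} [AddCommMonoid β] (p : α → Prop)
    [DecidablePred p] (f : α → β) (h : ∀ a, ¬ p a → f a = 0) (l : List α) :
    ((l.filter fun a => p a).map f).sum = (l.map f).sum := by
  induction l with
  | nil => rfl
  | cons a l ih =>
    by_cases ha : p a
    · simp [ha, ih]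
    · simp [ha, ih, h a ha]

-- The whole interface to the storage format. The summation rule is polymorphic because it serves
-- vectors (the Gram matrix), reals (the Frobenius norm) and natural numbers (the entry count).
open scoped Classical in
theorem sparseRows_spec : ∃ e : Fin (sparseRows A).r → Fin n, (∀ k, A (e k) ≠ 0) ∧
    (∀ k, (sparseRows A).row k = ((List.finRange d).filter fun j => A (e k) j ≠ 0).map
      fun j => (j, A (e k) j)) ∧
    ∀ {β : Type} [AddCommMonoid β] (f : Fin n → β), (∀ i, A i = 0 → f i = 0) →
      ∑ k, f (e k) = ∑ i, f i := by
  refine ⟨((List.finRange n).filter fun i => ∃ j, A i j ≠ 0).get, fun k h => ?_, fun k => rfl,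
    fun f hf => ?_⟩
  · have := List.of_mem_filter
      (List.get_mem ((List.finRange n).filter fun i => ∃ j, A i j ≠ 0) k)
    obtain ⟨j, hj⟩ := of_decide_eq_true this
    exact hj (congrFun h j)
  · have h₁ := List.sum_map_filter_of_zero (fun i => ∃ j, A i j ≠ 0) f
      (fun i hi => hf i (by ext j; by_contra hj; exact hi ⟨j, hj⟩)) (List.finRange n)
    rw [Fin.sum_univ_def f, ← h₁]
    exact Fin.sum_univ_fun_getElem ((List.finRange n).filter fun i => ∃ j, A i j ≠ 0) f

open scoped Classical in
theorem rowVec_filter (a : Fin d → ℝ) :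
    rowVec (((List.finRange d).filter fun j => a j ≠ 0).map fun j => (j, a j)) = a := by
  rw [rowVec, List.map_map]
  have := List.sum_map_filter_of_zero (fun j => a j ≠ 0)
    (fun j => (Pi.single j (a j) : Fin d → ℝ)) (fun j hj => by
      rw [not_not.1 hj, Pi.single_zero]) (List.finRange d)
  refine this.trans ?_
  rw [← Fin.sum_univ_def]
  exact Finset.univ_sum_single a

theorem sparseRows_proper : (sparseRows A).Proper := by
  classical
  obtain ⟨e, h₁, h₂, h₃⟩ := sparseRows_spec A
  refine ⟨fun k => ?_, fun k => ?_⟩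
  · obtain ⟨j, hj⟩ := Function.ne_iff.1 (h₁ k)
    rw [h₂, List.length_map, Nat.one_le_iff_ne_zero, ← Nat.pos_iff_ne_zero, List.length_pos_iff]
    refine List.ne_nil_of_mem (a := j) ?_
    simpa using hj
  · rw [h₂, List.map_map]
    simpa [Function.comp_def] using (List.nodup_finRange d).filter _

theorem sparseRows_toMatrix : ∃ e : Fin (sparseRows A).r → Fin n,
    (∀ k, (sparseRows A).toMatrix k ≠ 0) ∧ (∀ k, (sparseRows A).toMatrix k = A (e k)) ∧
    ∀ {β : Type} [AddCommMonoid β] (f : Fin n → β), (∀ i, A i = 0 → f i = 0) →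
      ∑ k, f (e k) = ∑ i, f i := by
  obtain ⟨e, h₁, h₂, h₃⟩ := sparseRows_spec A
  have h₄ : ∀ k, (sparseRows A).toMatrix k = A (e k) := fun k => by
    rw [SparseRows.toMatrix, h₂]
    exact rowVec_filter (A (e k))
  exact ⟨e, fun k => by rw [h₄]; exact h₁ k, h₄, h₃⟩

theorem sparseRows_gram :
    (sparseRows A).toMatrixᵀ * (sparseRows A).toMatrix = Aᵀ * A := by
  obtain ⟨e, h₁, h₂, h₃⟩ := sparseRows_toMatrix A
  refine Matrix.ext_of_mulVec_single fun j => ?_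
  rw [gram_mulVec, gram_mulVec, ← h₃ fun i => (A i ⬝ᵥ _) • A i]
  · simp only [h₂]
  · intro i hi
    simp [hi]

theorem sparseRows_frobSq : frobSq (sparseRows A).toMatrix = frobSq A := by
  obtain ⟨e, h₁, h₂, h₃⟩ := sparseRows_toMatrix A
  rw [frobSq, frobSq, ← h₃ fun i => A i ⬝ᵥ A i]
  · simp only [h₂]
  · intro i hi
    simp [hi]

theorem sparseRows_size : (sparseRows A).size = numNonzero A := by
  classical
  obtain ⟨e, h₁, h₂, h₃⟩ := sparseRows_spec A
  have h₄ : ∀ k, ((sparseRows A).row k).length =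
      ∑ j, if A (e k) j ≠ 0 then 1 else 0 := fun k => by
    rw [h₂, List.length_map, Fin.sum_univ_def]
    generalize List.finRange d = l
    induction l with
    | nil => rfl
    | cons j l ih =>
      by_cases hj : A (e k) j = 0
      · simpa [hj] using ih
      · simp [hj] at ih ⊢
        omega
  simp only [SparseRows.size, h₄]
  rw [h₃ (fun i => ∑ j, if A i j ≠ 0 then 1 else 0) (fun i hi => by simp [hi]), numNonzero,
    Set.ncard_eq_toFinset_card', Set.toFinset_ofPred, Finset.card_filter, ← Finset.univ_product_univ,
    Finset.sum_product]

end Sparse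

/-! ## The assumptions of the theorem -/

section Main

variable {n d : ℕ} {A : Matrix (Fin n) (Fin d) ℝ} {lam lamHat : ℝ}

theorem eigval_zero_pos (hgap : 0 < eigengap A) : 0 < eigval A 0 := by
  refine lt_of_le_of_ne (eigval_nonneg A 0) fun h => ?_
  rw [eigengap, ← h, div_zero] at hgap
  exact lt_irrefl _ hgap

theorem eigengap_mul (hgap : 0 < eigengap A) :
    eigengap A * eigval A 0 = eigval A 0 - eigval A 1 :=
  div_mul_cancel₀ _ (eigval_zero_pos hgap).ne'

theorem eigengap_le_one (hgap : 0 < eigengap A) : eigengap A ≤ 1 := by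
  rw [eigengap, div_le_one (eigval_zero_pos hgap)]
  linarith [eigval_nonneg A 1]

/-- From `0 < δ ≤ gap λ₁ / 100` follows `lam - λ₂ = δ + gap λ₁ ≥ 101 δ`. Dropping zero rows
preserves the Gram matrix and makes all row probabilities positive. -/
theorem exists_admissible (hd : 2 ≤ d) (hgap : 0 < eigengap A)
    (h₁ : (1 + eigengap A / 150) * eigval A 0 ≤ lam)
    (h₂ : lam ≤ (1 + eigengap A / 100) * eigval A 0)
    (h₃ : 10 / 11 * (lam - eigval A 0) ≤ lam - lamHat)
    (h₄ : lam - lamHat ≤ lam - eigval A 0) :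
    ∃ v, Admissible (sparseRows A).toMatrix lam lamHat v (lam - eigval A 0) := by
  obtain ⟨v, hv, hv₁, hv₂⟩ := exists_top_eigenvector A hd
  have hpos := eigval_zero_pos hgap
  have hmul := eigengap_mul hgap
  have hle := eigengap_le_one hgap
  have hgl : 0 < eigengap A * eigval A 0 := mul_pos hgap hpos
  have hgl' : eigengap A * eigval A 0 ≤ 1 * eigval A 0 := by gcongr
  have hB : shifted (sparseRows A).toMatrix lam = shifted A lam := by
    rw [shifted, shifted, sparseRows_gram]
  have hq : ∀ x y : Fin d → ℝ, x ⬝ᵥ (shifted A lam *ᵥ y) =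
      lam * (x ⬝ᵥ y) - x ⬝ᵥ ((Aᵀ * A) *ᵥ y) := fun x y => by
    simp [shifted, sub_mulVec, smul_mulVec, dotProduct_sub]
  refine ⟨v, ⟨?_, ?_, ?_, ?_, h₄, h₃⟩⟩
  · rw [hB]
    refine ⟨fun x y => ?_, hv, ?_, by linarith, fun u hu => ?_⟩
    · rw [hq, hq, dotProduct_comm x y, gram_symm]
    · rw [shifted, sub_mulVec, hv₁, smul_mulVec, one_mulVec, sub_smul]
    · rw [hq]
      have := hv₂ u hu
      have h₅ := dotProduct_self_nonneg' u
      have h₆ : 101 * (lam - eigval A 0) ≤ lam - eigval A 1 := by linarith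
      have := mul_le_mul_of_nonneg_right h₆ h₅
      linarith
  · intro k
    obtain ⟨e, h₅, -, -⟩ := sparseRows_toMatrix A
    exact lt_of_le_of_ne (dotProduct_self_nonneg' _)
      fun h => h₅ k (dotProduct_self_eq_zero' h.symm)
  · linarith
  · rw [sparseRows_frobSq, ← sum_eigval, sub_sub_cancel]
    exact Finset.single_le_sum (f := fun k : Fin d => eigval A k) (fun k _ => eigval_nonneg A k)
      (Finset.mem_univ (⟨0, by omega⟩ : Fin d))

end Main

section Main

variable {n d : ℕ} {A : Matrix (Fin n) (Fin d) ℝ} {lam lamHat : ℝ}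

/-! ## The success probability -/

/-- Because `log 2 > 1/2`. With `k = 50` this is where the constant `100` comes from. -/
theorem pow_le_two_pow {x : ℝ} (hx : 0 < x) {T k : ℕ} (hT : 2 * k * Real.log x ≤ T) :
    x ^ k ≤ 2 ^ T := by
  have h₁ : Real.log (x ^ k) ≤ Real.log (2 ^ T) := by
    rw [Real.log_pow, Real.log_pow]
    have h₂ : (1 / 2 : ℝ) ≤ Real.log 2 := by linarith [Real.log_two_gt_d9]
    have h₃ : (T : ℝ) * (1 / 2) ≤ T * Real.log 2 := by gcongr
    linarith
  exact (Real.log_le_log_iff (by positivity) (by positivity)).1 h₁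

/-- A well aligned start vector. -/
theorem good_start {r : ℕ} {A' : Matrix (Fin r) (Fin d) ℝ} {v : Fin d → ℝ} {δ : ℝ}
    (h : Admissible A' lam lamHat v δ) {x : Fin d → ℝ} {t s c : ℝ} (ht : 0 < t)
    (hlam : lam ≤ c * δ) (hx : t ≤ |v ⬝ᵥ x| ∧ x ⬝ᵥ x ≤ s) :
    Good (shifted A' lam) v δ (c * s / t ^ 2) (unitize x) := by
  have hδ := h.bottom.pos
  have h₁ : t ^ 2 ≤ (v ⬝ᵥ x) ^ 2 := by
    rw [← sq_abs (v ⬝ᵥ x)]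
    gcongr
    exact hx.1
  have h₂ := h.bottom.dotProduct_self_ge x
  have h₃ : 0 < t ^ 2 := by positivity
  refine Aligned.unitize ?_ (by linarith)
  have h₄ := qform_shifted A' lam (perp v x)
  have h₅ := gram_nonneg A' (perp v x)
  have h₆ := h.bottom.dotProduct_self x
  have h₇ : 0 < lam := by linarith [h.delta_le]
  have h₈ : lam * (perp v x ⬝ᵥ perp v x) ≤ lam * s := by
    gcongr
    nlinarith [sq_nonneg (v ⬝ᵥ x), hx.2]
  have hs : 0 < s := by linarith [hx.2]
  have h₉ : lam * s ≤ c * δ * s := by gcongr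
  have hc : 0 < c := pos_of_mul_pos_left (h₇.trans_le hlam) hδ.le
  rw [Aligned]
  -- The energy is at most `lam` times the squared norm since `Aᵀ A` is positive semidefinite.
  calc qform (shifted A' lam) (perp v x) ≤ c * δ * s := by linarith
    _ = c * s / t ^ 2 * (δ * t ^ 2) := by field_simp
    _ ≤ _ := by gcongr

/-- Here `152 D³²` is the initial squared tangent. Halving it `T₁` times gains `D⁵⁰`; the solver
accuracy `4^(-K₁) ≤ D^(-100)` outweighs it together with the number `T₁ ≤ c₁ D` of rounds; and
`2^(-T₂) ≤ (ε/d)⁵⁰` absorbs the `1/ε` of Markov's inequality. -/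
theorem failure_bound {D c₁ : ℝ} {T₁ K₁ T₂ : ℕ} {ε : ℝ} (hd : 2 ≤ d)
    (hD : (d : ℝ) ≤ D) (hε : 0 < ε) (hε₁ : ε ≤ 1)
    (hT₁ : 100 * Real.log D ≤ T₁) (hT₁' : T₁ ≤ c₁ * Real.log D) (hK₁ : 100 * Real.log D ≤ K₁)
    (hT₂ : 100 * Real.log (d / ε) ≤ T₂) (hc₁ : 0 ≤ c₁) :
    152 * D ^ 32 / 2 ^ T₁ ≤ 1 / 5 ∧
    T₁ * (100 * (152 * D ^ 32)) * (1 / 4) ^ K₁ + (1 / 2) ^ T₂ / ε ≤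
      (15200 * c₁ + 1) / (d : ℝ) ^ 10 := by
  have hd' : (2 : ℝ) ≤ d := by exact_mod_cast hd
  have hD₀ : 2 ≤ D := hd'.trans hD
  have h₁ : D ^ 50 ≤ 2 ^ T₁ := pow_le_two_pow (by linarith) (by push_cast; linarith)
  have h₂ : D ^ 50 ≤ 2 ^ K₁ := pow_le_two_pow (by linarith) (by push_cast; linarith)
  have h₃ : (d / ε) ^ 50 ≤ 2 ^ T₂ := pow_le_two_pow (by positivity) (by push_cast; linarith)
  have hlog : Real.log D ≤ D := (Real.log_le_sub_one_of_pos (by linarith)).trans (by linarith)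
  refine ⟨?_, ?_⟩
  · rw [div_le_iff₀ (by positivity)]
    have h₄ : (2 : ℝ) ^ 18 ≤ D ^ 18 := by gcongr
    calc 152 * D ^ 32 ≤ 1 / 5 * 2 ^ 18 * D ^ 32 := by gcongr; norm_num
      _ ≤ 1 / 5 * D ^ 18 * D ^ 32 := by gcongr
      _ = 1 / 5 * D ^ 50 := by ring
      _ ≤ _ := by gcongr
  · rw [add_div]
    refine add_le_add ?_ ?_
    · have h₄ : ((1 / 4 : ℝ)) ^ K₁ ≤ 1 / D ^ 100 := by
        rw [_root_.one_div_pow]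
        refine one_div_le_one_div_of_le (by positivity) ?_
        calc D ^ 100 = D ^ 50 * D ^ 50 := by ring
          _ ≤ 2 ^ K₁ * 2 ^ K₁ := by gcongr
          _ = 4 ^ K₁ := by rw [← mul_pow]; norm_num
      have h₅ : (T₁ : ℝ) ≤ c₁ * D := hT₁'.trans (by gcongr)
      calc T₁ * (100 * (152 * D ^ 32)) * (1 / 4) ^ K₁
          ≤ c₁ * D * (100 * (152 * D ^ 32)) * (1 / D ^ 100) := by gcongr
        _ = 15200 * c₁ / D ^ 67 := by field_simp; ring
        _ ≤ 15200 * c₁ / D ^ 10 := by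
            gcongr
            · linarith
            · norm_num
        _ ≤ _ := by gcongr
    · have h₄ : ((1 / 2 : ℝ)) ^ T₂ ≤ 1 / (d / ε) ^ 50 := by
        rw [_root_.one_div_pow]
        exact one_div_le_one_div_of_le (by positivity) h₃
      calc (1 / 2 : ℝ) ^ T₂ / ε ≤ 1 / (d / ε) ^ 50 / ε := by gcongr
        _ = ε ^ 49 / (d : ℝ) ^ 50 := by field_simp
        _ ≤ 1 / (d : ℝ) ^ 50 := by
            gcongr
            exact pow_le_one₀ hε.le hε₁
        _ ≤ 1 / (d : ℝ) ^ 10 := by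
            gcongr
            · linarith
            · norm_num

theorem le_mul_of_one_sub_le {x y a b : ENNReal} (hx : 1 - a ≤ x) (hy : 1 - b ≤ y) (hy₁ : y ≤ 1) :
    1 - (a + b) ≤ x * y := by
  rw [tsub_le_iff_right] at *
  calc (1 : ENNReal) ≤ y + b := hy
    _ ≤ y * (x + a) + b := by
        gcongr
        exact le_mul_of_one_le_right' hx
    _ = x * y + (y * a + b) := by ring
    _ ≤ x * y + (1 * a + b) := by gcongr
    _ = _ := by rw [one_mul]

theorem success_probability {c₁ ε : ℝ} {T₁ K₁ T₂ K₂ : ℕ} (hc₁ : 0 ≤ c₁) (hd : 2 ≤ d)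
    (hgap : 0 < eigengap A)
    (h₁ : (1 + eigengap A / 150) * eigval A 0 ≤ lam)
    (h₂ : lam ≤ (1 + eigengap A / 100) * eigval A 0)
    (h₃ : 10 / 11 * (lam - eigval A 0) ≤ lam - lamHat)
    (h₄ : lam - lamHat ≤ lam - eigval A 0) (hε : 0 < ε) (hε₁ : ε ≤ 1)
    (hT₁ : 100 * Real.log (d / eigengap A) ≤ T₁) (hT₁' : T₁ ≤ c₁ * Real.log (d / eigengap A))
    (hK₁ : 100 * Real.log (d / eigengap A) ≤ K₁)
    (hT₂ : 100 * Real.log (d / ε) ≤ T₂) (hK₂ : 5 ≤ K₂) :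
    1 - ENNReal.ofReal ((15200 * c₁ + 3) / (d : ℝ) ^ 10) ≤
      ∫⁻ x₀ : Fin d → ℝ,
        (powerMethod (sparseRows A) lam lamHat T₁ K₁ T₂ K₂ x₀).run.toOuterMeasure
          {o | o.1 ⬝ᵥ o.1 = 1 ∧ (1 - ε) * eigval A 0 ≤ o.1 ⬝ᵥ ((Aᵀ * A) *ᵥ o.1)}
        ∂(Measure.pi fun _ : Fin d => gaussianReal 0 1) := by
  obtain ⟨v, h⟩ := exists_admissible hd hgap h₁ h₂ h₃ h₄
  have hpos := eigval_zero_pos hgap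
  have hle := eigengap_le_one hgap
  have hd' : (2 : ℝ) ≤ d := by exact_mod_cast hd
  have hD : (d : ℝ) ≤ d / eigengap A := by
    rw [le_div_iff₀ hgap]
    exact mul_le_of_le_one_right (by positivity) hle
  obtain ⟨hfb₁, hfb₂⟩ := failure_bound hd hD hε hε₁ hT₁ hT₁' hK₁ hT₂ hc₁
  set D := (d : ℝ) / eigengap A with hDdef
  have hD₀ : 2 ≤ D := hd'.trans hD
  -- The two thresholds are chosen so that each failure term, `t` and `d/s`, equals `1/d¹⁰`.
  set t : ℝ := 1 / (d : ℝ) ^ 10 with ht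
  set s : ℝ := (d : ℝ) ^ 11 with hs
  have ht₀ : 0 < t := by positivity
  obtain ⟨hm, hstart⟩ := gaussian_start h.bottom.unit ht₀.le (show 0 < s by positivity)
  set E := {x : Fin d → ℝ | t ≤ |v ⬝ᵥ x| ∧ x ⬝ᵥ x ≤ s} with hE
  have hrun : ∀ x₀ ∈ E, 1 - ENNReal.ofReal ((15200 * c₁ + 1) / (d : ℝ) ^ 10) ≤
      (powerMethod (sparseRows A) lam lamHat T₁ K₁ T₂ K₂ x₀).run.toOuterMeasure
        {o | o.1 ⬝ᵥ o.1 = 1 ∧ (1 - ε) * eigval A 0 ≤ o.1 ⬝ᵥ ((Aᵀ * A) *ᵥ o.1)} := by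
    intro x₀ hx₀
    -- `lam ≤ 1.01 λ₁` and `λ₁ ≤ 150 δ / gap`, and `151.5 < 152`.
    have hlam : lam ≤ 152 * (1 / eigengap A) * (lam - eigval A 0) := by
      rw [mul_one_div, div_mul_eq_mul_div, le_div_iff₀ hgap]
      have := mul_le_mul_of_nonneg_left hle hpos.le
      have := mul_le_mul_of_nonneg_left h₂ hgap.le
      have h5 : eigengap A * (eigval A 0 * eigengap A) ≤ eigengap A * (eigval A 0 * 1) := by gcongr
      nlinarith
    have hgood := good_start h ht₀ hlam hx₀
    have hgood' : Good (shifted (sparseRows A).toMatrix lam) v (lam - eigval A 0) (152 * D ^ 32)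
        (unitize x₀) := by
      refine ⟨hgood.1, hgood.2.trans ?_⟩
      refine mul_le_mul_of_nonneg_right ?_ (mul_nonneg h.bottom.pos.le (sq_nonneg _))
      have hgD : 1 / eigengap A ≤ D := by
        rw [hDdef]
        gcongr
        linarith
      calc 152 * (1 / eigengap A) * s / t ^ 2 = 152 * (1 / eigengap A) * (d : ℝ) ^ 31 := by
            rw [hs, ht]
            field_simp
        _ ≤ 152 * D * D ^ 31 := by gcongr
        _ = _ := by ring
    have hfail := h.failure_phases_le (K₁ := K₁) (K₂ := K₂) (T₂ := T₂) (ε := ε) hK₂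
      (by have : 1 ≤ D ^ 32 := one_le_pow₀ (by linarith)
          linarith) hfb₁ hε hgood'
    rw [← law_powerMethod (sparseRows_proper A), sparseRows_gram, sub_sub_cancel] at hfail
    have hfail' := (tsub_le_tsub_left (hfail.trans (ENNReal.ofReal_le_ofReal hfb₂)) 1).trans
      (PMF.one_sub_failure_le _ _)
    rw [RealProg.law, PMF.toOuterMeasure_map_apply] at hfail'
    exact hfail'
  have hprob : 1 - ENNReal.ofReal (2 / (d : ℝ) ^ 10) ≤
      (Measure.pi fun _ : Fin d => gaussianReal 0 1) E := by
    convert hstart using 3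
    rw [ht, hs]
    field_simp
    norm_num
  calc _ = 1 - (ENNReal.ofReal ((15200 * c₁ + 1) / (d : ℝ) ^ 10) +
        ENNReal.ofReal (2 / (d : ℝ) ^ 10)) := by
        rw [← ENNReal.ofReal_add (by positivity) (by positivity), ← add_div]
        ring_nf
    _ ≤ (1 - ENNReal.ofReal ((15200 * c₁ + 1) / (d : ℝ) ^ 10)) *
        (Measure.pi fun _ : Fin d => gaussianReal 0 1) E :=
        le_mul_of_one_sub_le le_rfl hprob prob_le_one
    -- A measurable minorant of the integrand, so that measurability of the success probability in
    -- `x₀` is never required.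
    _ = ∫⁻ x₀, E.indicator (fun _ => 1 - ENNReal.ofReal ((15200 * c₁ + 1) / (d : ℝ) ^ 10)) x₀
        ∂(Measure.pi fun _ : Fin d => gaussianReal 0 1) := by
        rw [lintegral_indicator_const hm]
    _ ≤ _ := by
        refine lintegral_mono fun x₀ => ?_
        by_cases hx₀ : x₀ ∈ E
        · rw [Set.indicator_of_mem hx₀]
          exact hrun x₀ hx₀
        · rw [Set.indicator_of_notMem hx₀]
          exact zero_le

/-! ## The running time -/

theorem stableRank_eq : stableRank A = frobSq A / eigval A 0 := by
  rw [stableRank, ← Finset.sum_div, sum_eigval]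

theorem one_le_stableRank (hd : 2 ≤ d) (hgap : 0 < eigengap A) : 1 ≤ stableRank A := by
  rw [stableRank_eq, le_div_iff₀ (eigval_zero_pos hgap), one_mul, ← sum_eigval]
  exact Finset.single_le_sum (f := fun k : Fin d => eigval A k) (fun k _ => eigval_nonneg A k)
    (Finset.mem_univ (⟨0, by omega⟩ : Fin d))

theorem epoch_length_le (hd : 2 ≤ d) (hgap : 0 < eigengap A)
    (h₁ : (1 + eigengap A / 150) * eigval A 0 ≤ lam)
    (h₂ : lam ≤ (1 + eigengap A / 100) * eigval A 0)
    (h₃ : 10 / 11 * (lam - eigval A 0) ≤ lam - lamHat) :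
    ((setupOf (sparseRows A).toMatrix lam lamHat).M : ℝ) ≤
      4000000 * (stableRank A / eigengap A ^ 2) := by
  have hpos := eigval_zero_pos hgap
  have hle := eigengap_le_one hgap
  have hS := one_le_stableRank hd hgap
  have hF : frobSq A = stableRank A * eigval A 0 := by
    rw [stableRank_eq, div_mul_cancel₀ _ hpos.ne']
  -- `165 = 150 · 11/10`.
  have hmu : eigengap A * eigval A 0 / 165 ≤ lam - lamHat := by linarith
  have hmu₀ : 0 < lam - lamHat := lt_of_lt_of_le (by positivity) hmu
  have hgl : eigengap A * eigval A 0 ≤ 1 * eigval A 0 := by gcongr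
  have hhat : lamHat ≤ 1.01 * eigval A 0 := by linarith
  have hbase : 1 ≤ stableRank A / eigengap A ^ 2 := by
    rw [le_div_iff₀ (by positivity), one_mul]
    exact (pow_le_one₀ hgap.le hle).trans hS
  have hx : 64 * smoothness (sparseRows A).toMatrix lam lamHat / (lam - lamHat) ≤
      3600000 * (stableRank A / eigengap A ^ 2) := by
    rw [smoothness, sparseRows_frobSq, hF]
    calc 64 * (2 * lamHat * (stableRank A * eigval A 0) / (lam - lamHat)) / (lam - lamHat)
        = 128 * (lamHat * (stableRank A * eigval A 0)) / (lam - lamHat) ^ 2 := by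
          field_simp; ring
      _ ≤ 128 * (1.01 * eigval A 0 * (stableRank A * eigval A 0)) /
          (eigengap A * eigval A 0 / 165) ^ 2 := by gcongr
      _ = 128 * 1.01 * 165 ^ 2 * (stableRank A / eigengap A ^ 2) := by field_simp
      _ ≤ _ := by gcongr; norm_num
  -- Rounding up costs `1`, which is absorbed since `srank/gap² ≥ 1`.
  have hceil : ((setupOf (sparseRows A).toMatrix lam lamHat).M : ℝ) ≤
      3600000 * (stableRank A / eigengap A ^ 2) + 1 := by
    refine le_trans ?_ (Nat.ceil_lt_add_one (by positivity)).le
    exact_mod_cast Nat.ceil_le_ceil hx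
  linarith

theorem running_time {c₁ ε : ℝ} {T₁ K₁ T₂ K₂ : ℕ} (hd : 2 ≤ d)
    (hgap : 0 < eigengap A)
    (h₁ : (1 + eigengap A / 150) * eigval A 0 ≤ lam)
    (h₂ : lam ≤ (1 + eigengap A / 100) * eigval A 0)
    (h₃ : 10 / 11 * (lam - eigval A 0) ≤ lam - lamHat)
    (h₄ : lam - lamHat ≤ lam - eigval A 0) (hε : 0 < ε) (hε₁ : ε ≤ 1)
    (hT₁ : T₁ ≤ c₁ * Real.log (d / eigengap A))
    (hK₁ : 0 < K₁) (hK₁' : K₁ ≤ c₁ * Real.log (d / eigengap A))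
    (hT₂ : T₂ ≤ c₁ * Real.log (d / ε)) (hK₂ : 0 < K₂) (hK₂' : K₂ ≤ c₁)
    (x₀ : Fin d → ℝ) :
    ∀ o ∈ (powerMethod (sparseRows A) lam lamHat T₁ K₁ T₂ K₂ x₀).run.support,
      (d : ℝ) + o.2 ≤ 4000000 * (100 + 139 * c₁ ^ 2) *
        ((numNonzero A + d * stableRank A / eigengap A ^ 2) *
          (Real.log (d / eigengap A) ^ 2 + Real.log (1 / ε))) := by
  intro o ho
  obtain ⟨v, h⟩ := exists_admissible hd hgap h₁ h₂ h₃ h₄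
  have hd' : (2 : ℝ) ≤ d := by exact_mod_cast hd
  have hle := eigengap_le_one hgap
  have hD : (d : ℝ) ≤ d / eigengap A := by
    rw [le_div_iff₀ hgap]
    exact mul_le_of_le_one_right (by positivity) hle
  set S := sparseRows A
  set M := (setupOf S.toMatrix lam lamHat).M with hMdef
  have hM : 1 ≤ M := Nat.ceil_pos.2 (div_pos (mul_pos (by norm_num) h.smoothness_pos) h.mu_pos)
  have hcost := costLE_powerMethod (sparseRows_proper A) (by omega : 1 ≤ d) lam lamHat hM
    T₁ K₁ T₂ K₂ x₀ o ho
  -- The `d` Gaussian draws take one further cost unit, and `K₁, K₂ ≥ 1` absorb the work per round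
  -- outside the epochs.
  have hcost' : d + o.2 ≤ (25 + 33 * (T₁ * K₁) + 53 * (T₂ * K₂)) * costUnit S M := by
    have t₁ : d ≤ costUnit S M :=
      (Nat.le_mul_of_pos_right d hM).trans (Nat.le_add_left _ _)
    have t₂ : 24 + T₁ * (12 + 21 * K₁) + T₂ * (32 + 21 * K₂) ≤
        24 + 33 * (T₁ * K₁) + 53 * (T₂ * K₂) := by
      have := Nat.le_mul_of_pos_right T₁ hK₁
      have := Nat.le_mul_of_pos_right T₂ hK₂
      have e₁ : T₁ * (12 + 21 * K₁) = 12 * T₁ + 21 * (T₁ * K₁) := by ring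
      have e₂ : T₂ * (32 + 21 * K₂) = 32 * T₂ + 21 * (T₂ * K₂) := by ring
      omega
    have t₃ := hcost.trans (Nat.mul_le_mul_right _ t₂)
    calc d + o.2 ≤ costUnit S M + (24 + 33 * (T₁ * K₁) + 53 * (T₂ * K₂)) * costUnit S M :=
          add_le_add t₁ t₃
      _ = _ := by ring
  have hreal : (d : ℝ) + o.2 ≤ (25 + 33 * (T₁ * K₁) + 53 * (T₂ * K₂)) *
      (costUnit S M : ℝ) := by exact_mod_cast hcost'
  set L := Real.log (d / eigengap A) with hL
  have hlogd : Real.log d ≤ L := Real.log_le_log (by linarith) hD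
  have hL₀ : 1 / 2 ≤ L := by
    have := Real.log_le_log (by norm_num) hd'
    linarith [Real.log_two_gt_d9]
  have hl : 0 ≤ Real.log (1 / ε) := Real.log_nonneg (by rw [le_div_iff₀ hε]; linarith)
  have hlog : Real.log (d / ε) = Real.log d + Real.log (1 / ε) := by
    rw [← Real.log_mul (by positivity) (by positivity), mul_one_div]
  have hc₁ : 0 ≤ c₁ := (Nat.cast_nonneg K₂).trans hK₂'
  have hTK₁ : (T₁ : ℝ) * K₁ ≤ c₁ ^ 2 * L ^ 2 := by
    calc (T₁ : ℝ) * K₁ ≤ (c₁ * L) * (c₁ * L) := by gcongr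
      _ = _ := by ring
  have hTK₂ : (T₂ : ℝ) * K₂ ≤ 2 * c₁ ^ 2 * (L ^ 2 + Real.log (1 / ε)) := by
    -- `log d ≤ L ≤ 2 L²`, because `L ≥ log 2 > 1/2`.
    have t₁ : Real.log (d / ε) ≤ 2 * (L ^ 2 + Real.log (1 / ε)) := by
      rw [hlog]
      nlinarith
    calc (T₂ : ℝ) * K₂ ≤ (c₁ * (2 * (L ^ 2 + Real.log (1 / ε)))) * c₁ := by
          gcongr
          exact hT₂.trans (by gcongr)
      _ = _ := by ring
  have hcoef : 25 + 33 * ((T₁ : ℝ) * K₁) + 53 * (T₂ * K₂) ≤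
      (100 + 139 * c₁ ^ 2) * (L ^ 2 + Real.log (1 / ε)) := by
    have t₁ : 25 ≤ 100 * L ^ 2 := by nlinarith
    have t₂ : 0 ≤ c₁ ^ 2 * Real.log (1 / ε) := by positivity
    nlinarith
  have hQ : (costUnit S M : ℝ) ≤
      4000000 * (numNonzero A + d * stableRank A / eigengap A ^ 2) := by
    have t₁ := epoch_length_le hd hgap h₁ h₂ h₃
    have t₂ : (d : ℝ) * M ≤ d * (4000000 * (stableRank A / eigengap A ^ 2)) := by gcongr
    have t₃ : (costUnit S M : ℝ) = numNonzero A + d * M := by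
      rw [costUnit, sparseRows_size]
      push_cast
      rfl
    have t₄ : (0 : ℝ) ≤ numNonzero A := Nat.cast_nonneg _
    rw [t₃, mul_add, mul_div_assoc]
    linarith
  calc (d : ℝ) + o.2 ≤ (25 + 33 * (T₁ * K₁) + 53 * (T₂ * K₂)) * (costUnit S M : ℝ) := hreal
    _ ≤ (100 + 139 * c₁ ^ 2) * (L ^ 2 + Real.log (1 / ε)) *
        (4000000 * (numNonzero A + d * stableRank A / eigengap A ^ 2)) := by gcongr
    _ = _ := by ring

end Main

/-! ### The theorem and its constants -/

theorem mainTheorem1 :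
    ∃ c₀ : ℝ, 0 < c₀ ∧ ∀ c₁ : ℝ, c₀ ≤ c₁ → ∃ C : ℝ, 0 < C ∧
      ∀ (n d : ℕ) (A : Matrix (Fin n) (Fin d) ℝ) (lam lamHat ε : ℝ) (T₁ K₁ T₂ K₂ : ℕ),
        2 ≤ d →
        0 < eigengap A →
        (1 + eigengap A / 150) * eigval A 0 ≤ lam →
        lam ≤ (1 + eigengap A / 100) * eigval A 0 →
        10 / 11 * (lam - eigval A 0) ≤ lam - lamHat →
        lam - lamHat ≤ lam - eigval A 0 →
        0 < ε →
        ε ≤ 1 →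
        (T₁ : ℝ) ∈ Set.Icc (c₀ * Real.log (d / eigengap A)) (c₁ * Real.log (d / eigengap A)) →
        (K₁ : ℝ) ∈ Set.Icc (c₀ * Real.log (d / eigengap A)) (c₁ * Real.log (d / eigengap A)) →
        (T₂ : ℝ) ∈ Set.Icc (c₀ * Real.log (d / ε)) (c₁ * Real.log (d / ε)) →
        (K₂ : ℝ) ∈ Set.Icc c₀ c₁ →
        -- success probability over the Gaussian start and the random choices of the run
        1 - ENNReal.ofReal (C / (d : ℝ) ^ 10) ≤
            ∫⁻ x₀ : Fin d → ℝ,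
              (ShiftInvert.powerMethod (sparseRows A) lam lamHat T₁ K₁ T₂ K₂ x₀).run.toOuterMeasure
                {o | o.1 ⬝ᵥ o.1 = 1 ∧ (1 - ε) * eigval A 0 ≤ o.1 ⬝ᵥ ((Aᵀ * A) *ᵥ o.1)}
              ∂(Measure.pi fun _ : Fin d => gaussianReal 0 1) ∧
        -- running time on every run, with the `d` Gaussian draws for the start vector
        ∀ x₀ : Fin d → ℝ,
          ∀ o ∈ (ShiftInvert.powerMethod (sparseRows A) lam lamHat T₁ K₁ T₂ K₂ x₀).run.support,
            (d : ℝ) + o.2 ≤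
              C * ((numNonzero A + d * stableRank A / eigengap A ^ 2) *
                (Real.log (d / eigengap A) ^ 2 + Real.log (1 / ε))) := by
  refine ⟨100, by norm_num, fun c₁ hc₁ => ?_⟩
  have hc₀ : 0 ≤ c₁ := by linarith
  -- The sum of the constants of the two claims; both bounds only weaken when `C` grows.
  refine ⟨(15200 * c₁ + 3) + 4000000 * (100 + 139 * c₁ ^ 2), by positivity, ?_⟩
  intro n d A lam lamHat ε T₁ K₁ T₂ K₂ hd hgap h₁ h₂ h₃ h₄ hε hε₁ hT₁ hK₁ hT₂ hK₂
  have hd' : (2 : ℝ) ≤ d := by exact_mod_cast hd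
  have hle := eigengap_le_one hgap
  have hD : 1 < d / eigengap A := by
    rw [lt_div_iff₀ hgap]
    linarith
  have hK₁' : 0 < K₁ := by
    have := Real.log_pos hD
    have h₅ : (0 : ℝ) < K₁ := by linarith [hK₁.1]
    exact_mod_cast h₅
  have hK₂' : 100 ≤ K₂ := by exact_mod_cast hK₂.1
  refine ⟨?_, fun x₀ o ho => ?_⟩
  · refine le_trans ?_ (success_probability hc₀ hd hgap h₁ h₂ h₃ h₄ hε hε₁ hT₁.1 hT₁.2 hK₁.1 hT₂.1
      (by omega))
    refine tsub_le_tsub_left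
      (ENNReal.ofReal_le_ofReal (div_le_div_of_nonneg_right ?_ (by positivity))) 1
    linarith [sq_nonneg c₁]
  · refine (running_time hd hgap h₁ h₂ h₃ h₄ hε hε₁ hT₁.2 hK₁' hK₁.2 hT₂.2 (by omega) hK₂.2 x₀ o
      ho).trans ?_
    have hS := one_le_stableRank hd hgap
    have hl : 0 ≤ Real.log (1 / ε) := Real.log_nonneg (by rw [le_div_iff₀ hε]; linarith)
    gcongr
    linarith
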